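/- **Setting.** Let $\mu$ be a probability measure on $\mathbb R$ with $\int x\,\mu(dx)=0$ and $\int x^2\,\mu(dx)\in(0,\infty)$, let $h_1,h_2,\dots$ be i.i.d. with law $\mu$, and let $S_0=0$, $S_n=h_1+\dots+h_n$. For $\Gamma>0$ set $t_0=0$ and, for $j\ge 0$, $$t_{j+1}=\min\Big\{n>t_j:\ \max_{t_j\le i\le k\le n}(S_i-S_k)\ge\Gamma\Big\}\ (j\text{ even}),\qquad t_{j+1}=\min\Big\{n>t_j:\ \max_{t_j\le i\le k\le n}(S_k-S_i)\ge\Gamma\Big\}\ (j\text{ odd}).$$ Let $u_{j+1}$ and $u_{j+1}^+$ be the first and the last time in $[t_j,t_{j+1}]\cap\mathbb Z$ at which $S$ attains its maximum ($j$ even), respectively its minimum ($j$ odd), over $[t_j,t_{j+1}]\cap\mathbb Z$. All these times are almost surely finite. Put $u_{-1}=u_1-u_2$, $u_{+1}^+=u_3^+-u_2$, and $$S^{(\Gamma)}_n=S_{u_2+n}-S_{u_2}\quad(u_{-1}\le n\le u_{+1}^+),$$ $$\tau^-_{\Gamma/2}=\sup\{u_{-1}\le n\le 0: S^{(\Gamma)}_n\ge\Gamma/2\},\qquad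 \tau^+_{\Gamma/2}=\inf\{0\le n\le u^+_{+1}: S^{(\Gamma)}_n\ge\Gamma/2\}.$$ **The limit process.** Let $Z=(Z_n)_{n\in\mathbb Z}$ be the process with $Z_0=0$ whose two halves $(Z_n)_{n\ge0}$ and $(Z_{-n})_{n\ge 0}$ are independent and are distributed as follows. * $(Z_n)_{n\ge 0}$ is the random walk with step law $\mu$ started at $0$ and conditioned not to visit $(-\infty,0)$. That is, it is the Markov chain with transition kernel proportional to $\mathbf 1_{y\ge0}\,V(y)\,\mathbb P[x+h_1\in dy]$, where $V(y)$ is the expected number of times $n\ge0$ with $S_n<\min_{0\le j<n}S_j$ and $S_n\ge -y$ (the time $n=0$ is counted). * $(Z_{-n})_{n\ge0}$ is the random walk $W$ whose steps have the law of $-h_1$, started at $0$ and conditioned not to visit $(-\infty,0]$ after time $0$. That is, it is the Markov chain with transition kernel proportional to $\mathbf 1_{y>0}\,\widehat V(y)\,\mathbb P[x-h_1\in dy]$, where $\widehat V(y)$ is the expected number of times $n\ge0$ with $W_n\le\min_{0\le j<n}W_j$ and $W_n>-y$ (the time $n=0$ is counted). **Lemma.** For every $\Gamma>0$ the random variables $$\log\Big(\sum_{\tau^-_{\Gamma/2}<n<\tau^+_{\Gamma/2}}e^{-2S^{(\Gamma)}_n}\Big)\qquad\text{and}\qquad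 \log\Big(\sum_{u_{-1}\le n\le u^+_{+1}}e^{-2S^{(\Gamma)}_n}\Big)$$ are integrable. Almost surely $\sum_{n\in\mathbb Z}e^{-2Z_n}<\infty$, and $\log\big(\sum_{n\in\mathbb Z}e^{-2Z_n}\big)$ is integrable. As $\Gamma\to\infty$, the expectations $$\mathbb E\Big[\log\Big(\sum_{\tau^-_{\Gamma/2}<n<\tau^+_{\Gamma/2}}e^{-2S^{(\Gamma)}_n}\Big)\Big]\qquad\text{and}\qquad \mathbb E\Big[\log\Big(\sum_{u_{-1}\le n\le u^+_{+1}}e^{-2S^{(\Gamma)}_n}\Big)\Big]$$ both converge to $$\mathbb E\Big[\log\Big(\sum_{n\in\mathbb Z}e^{-2Z_n}\Big)\Big].$$ -/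

import Mathlib

open MeasureTheory ProbabilityTheory Filter Topology
open scoped ENNReal

noncomputable section

/-! ### The walk, the times `t_j`, the `Γ`-extrema and the environment around a `Γ`-minimum

Everything here is a function of one trajectory `S : ℕ → ℝ`. The infima and suprema of sets of
integers below are minima and maxima whenever `S` oscillates, that is almost surely. -/

/-- The partial sums `S_n = h_1 + ⋯ + h_n`, where `h_{j+1}` is written `h j`. -/
def partialSum (h : ℕ → ℝ) (n : ℕ) : ℝ := ∑ j ∈ Finset.range n, h j

/-- `max_{m ≤ i ≤ j ≤ n} (S_j - S_i) ≥ Γ`. -/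
def HasRise (S : ℕ → ℝ) (Γ : ℝ) (m n : ℕ) : Prop :=
  ∃ i j : ℕ, m ≤ i ∧ i ≤ j ∧ j ≤ n ∧ Γ ≤ S j - S i

/-- `max_{m ≤ i ≤ j ≤ n} (S_i - S_j) ≥ Γ`. -/
def HasDrop (S : ℕ → ℝ) (Γ : ℝ) (m n : ℕ) : Prop :=
  ∃ i j : ℕ, m ≤ i ∧ i ≤ j ∧ j ≤ n ∧ Γ ≤ S i - S j

open Classical in
/-- The times `t_j(Γ)`, with `t_0 = 0`: `t_{j+1}` is the first time after `t_j` at which the walk,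
observed from `t_j` on, has made a drop (`j` even) or a rise (`j` odd) of at least `Γ`. -/
def tTime (S : ℕ → ℝ) (Γ : ℝ) : ℕ → ℕ
  | 0 => 0
  | j + 1 => sInf {n : ℕ | tTime S Γ j < n ∧
      if Even j then HasDrop S Γ (tTime S Γ j) n else HasRise S Γ (tTime S Γ j) n}

open Classical in
/-- The times in `⟦t_j, t_{j+1}⟧` at which `S` is maximal over that interval (`j` even),
respectively minimal (`j` odd). -/
def extremalTimes (S : ℕ → ℝ) (Γ : ℝ) (j : ℕ) : Set ℕ :=
  {n : ℕ | n ∈ Set.Icc (tTime S Γ j) (tTime S Γ (j + 1)) ∧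
    ∀ i ∈ Set.Icc (tTime S Γ j) (tTime S Γ (j + 1)),
      if Even j then S i ≤ S n else S n ≤ S i}

/-- `uFirst S Γ k = u_k(Γ)`, the first `Γ`-extremum in `⟦t_{k-1}, t_k⟧`, for `k ≥ 1`. -/
def uFirst (S : ℕ → ℝ) (Γ : ℝ) (k : ℕ) : ℕ := sInf (extremalTimes S Γ (k - 1))

/-- `uLast S Γ k = u_k^+(Γ)`, the last `Γ`-extremum in `⟦t_{k-1}, t_k⟧`, for `k ≥ 1`. -/
def uLast (S : ℕ → ℝ) (Γ : ℝ) (k : ℕ) : ℕ := sSup (extremalTimes S Γ (k - 1))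

/-- `u_{-1} = u_1 - u_2`. -/
def leftEnd (S : ℕ → ℝ) (Γ : ℝ) : ℤ := (uFirst S Γ 1 : ℤ) - (uFirst S Γ 2 : ℤ)

/-- `u_{+1}^+ = u_3^+ - u_2`. -/
def rightEnd (S : ℕ → ℝ) (Γ : ℝ) : ℤ := (uLast S Γ 3 : ℤ) - (uFirst S Γ 2 : ℤ)

/-- `S^{(Γ)}_n = S_{u_2 + n} - S_{u_2}`, meaningful for `u_{-1} ≤ n ≤ u_{+1}^+`
(on that range `u_2 + n ≥ u_1 ≥ 0`). -/
def envWalk (S : ℕ → ℝ) (Γ : ℝ) (n : ℤ) : ℝ :=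
  S ((uFirst S Γ 2 : ℤ) + n).toNat - S (uFirst S Γ 2)

/-- `τ^-_{Γ/2}`, the last `n` in `⟦u_{-1}, 0⟧` with `S^{(Γ)}_n ≥ Γ/2`. -/
def tauMinus (S : ℕ → ℝ) (Γ : ℝ) : ℤ :=
  sSup {n : ℤ | leftEnd S Γ ≤ n ∧ n ≤ 0 ∧ Γ / 2 ≤ envWalk S Γ n}

/-- `τ^+_{Γ/2}`, the first `n` in `⟦0, u_{+1}^+⟧` with `S^{(Γ)}_n ≥ Γ/2`. -/
def tauPlus (S : ℕ → ℝ) (Γ : ℝ) : ℤ :=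
  sInf {n : ℤ | 0 ≤ n ∧ n ≤ rightEnd S Γ ∧ Γ / 2 ≤ envWalk S Γ n}

/-- `log ∑_{τ^- < n < τ^+} e^{-2 S^{(Γ)}_n}`. -/
def logSumBelow (S : ℕ → ℝ) (Γ : ℝ) : ℝ :=
  Real.log (∑ n ∈ Finset.Ioo (tauMinus S Γ) (tauPlus S Γ), Real.exp (-2 * envWalk S Γ n))

/-- `log ∑_{u_{-1} ≤ n ≤ u_{+1}^+} e^{-2 S^{(Γ)}_n}`. -/
def logSumFull (S : ℕ → ℝ) (Γ : ℝ) : ℝ :=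
  Real.log (∑ n ∈ Finset.Icc (leftEnd S Γ) (rightEnd S Γ), Real.exp (-2 * envWalk S Γ n))

/-! ### Random walks conditioned to stay non-negative, or positive, as Doob transforms -/

/-- The renewal function of the strict descending ladder heights of the walk with step law `ν`:
the expected number of strict descending record times `n ≥ 0` (time `0` included) with
`S_n ≥ -x`. It is harmonic for the walk killed on entering `(-∞, 0)`. -/
def renewalStrict (ν : Measure ℝ) [IsProbabilityMeasure ν] (x : ℝ) : ℝ≥0∞ :=
  ∑' n : ℕ, Measure.infinitePi (fun _ : ℕ => ν)
    {w | (∀ j < n, partialSum w n < partialSum w j) ∧ -x ≤ partialSum w n}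

/-- The renewal function of the weak descending ladder heights of the walk with step law `ν`:
the expected number of weak descending record times `n ≥ 0` (time `0` included) with
`S_n > -x`. It is harmonic for the walk killed on entering `(-∞, 0]`. -/
def renewalWeak (ν : Measure ℝ) [IsProbabilityMeasure ν] (x : ℝ) : ℝ≥0∞ :=
  ∑' n : ℕ, Measure.infinitePi (fun _ : ℕ => ν)
    {w | (∀ j < n, partialSum w n ≤ partialSum w j) ∧ -x < partialSum w n}

lemma renewalStrict_mono (ν : Measure ℝ) [IsProbabilityMeasure ν] :
    Monotone (renewalStrict ν) := by
  intro x y hxy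
  refine ENNReal.tsum_le_tsum fun n => measure_mono ?_
  rintro w ⟨h1, h2⟩
  exact ⟨h1, by linarith⟩

lemma renewalWeak_mono (ν : Measure ℝ) [IsProbabilityMeasure ν] :
    Monotone (renewalWeak ν) := by
  intro x y hxy
  refine ENNReal.tsum_le_tsum fun n => measure_mono ?_
  rintro w ⟨h1, h2⟩
  exact ⟨h1, by linarith⟩

/-- The one-step kernel `x ↦ law of x + ξ`, `ξ` of law `ν`. -/
def stepKernel (ν : Measure ℝ) [IsProbabilityMeasure ν] : Kernel ℝ ℝ :=
  (Kernel.id ×ₖ Kernel.const ℝ ν).map (fun p : ℝ × ℝ => p.1 + p.2)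

instance (ν : Measure ℝ) [IsProbabilityMeasure ν] : IsMarkovKernel (stepKernel ν) := by
  unfold stepKernel
  exact Kernel.IsMarkovKernel.map _ (by fun_prop)

lemma stepKernel_apply (ν : Measure ℝ) [IsProbabilityMeasure ν] (x : ℝ) :
    stepKernel ν x = ν.map (fun z => x + z) := by
  unfold stepKernel
  rw [Kernel.map_apply _ (by fun_prop), Kernel.prod_apply, Kernel.id_apply, Kernel.const_apply,
    Measure.dirac_prod, Measure.map_map (by fun_prop) (by fun_prop)]
  rfl

/-- The mass `∫ g(y) P(x, dy)`, `P` being the one-step kernel of the walk. -/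
def stepMass (ν : Measure ℝ) [IsProbabilityMeasure ν] (g : ℝ → ℝ≥0∞) (x : ℝ) : ℝ≥0∞ :=
  ∫⁻ y, g y ∂(stepKernel ν x)

lemma measurableSet_stepMass (ν : Measure ℝ) [IsProbabilityMeasure ν] (g : ℝ → ℝ≥0∞)
    (hg : Measurable g) : MeasurableSet {x | stepMass ν g x ≠ 0 ∧ stepMass ν g x ≠ ∞} := by
  have hm : Measurable (stepMass ν g) := hg.lintegral_kernel
  exact (hm (measurableSet_singleton 0).compl).inter (hm (measurableSet_singleton ∞).compl)

open Classical in
/-- The Doob transform `P^g(x, dy) = g(y) P(x, dy) / ∫ g(z) P(x, dz)` of the one-step kernel of the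
walk. At a point `x` where `g` is harmonic, the denominator is `g x`. Where the denominator
is `0` or `∞` the value is irrelevant, and set to `δ_x`. -/
def doobKernel (ν : Measure ℝ) [IsProbabilityMeasure ν] (g : ℝ → ℝ≥0∞) (hg : Measurable g) :
    Kernel ℝ ℝ :=
  Kernel.piecewise (measurableSet_stepMass ν g hg)
    ((stepKernel ν).withDensity (fun x y => (stepMass ν g x)⁻¹ * g y)) Kernel.id

lemma doobKernel_apply (ν : Measure ℝ) [IsProbabilityMeasure ν] (g : ℝ → ℝ≥0∞)
    (hg : Measurable g) {x : ℝ} (h0 : stepMass ν g x ≠ 0) (h1 : stepMass ν g x ≠ ∞) :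
    doobKernel ν g hg x =
      (ν.map (fun z => x + z)).withDensity (fun y => (stepMass ν g x)⁻¹ * g y) := by
  have hm : Measurable (stepMass ν g) := hg.lintegral_kernel
  classical
  unfold doobKernel
  rw [Kernel.piecewise_apply, if_pos (by exact ⟨h0, h1⟩), Kernel.withDensity_apply _ (by fun_prop),
    stepKernel_apply]

instance (ν : Measure ℝ) [IsProbabilityMeasure ν] (g : ℝ → ℝ≥0∞) (hg : Measurable g) :
    IsMarkovKernel (doobKernel ν g hg) := by
  have hm : Measurable (stepMass ν g) := hg.lintegral_kernel
  refine ⟨fun x => ⟨?_⟩⟩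
  by_cases h : stepMass ν g x ≠ 0 ∧ stepMass ν g x ≠ ∞
  · rw [doobKernel_apply ν g hg h.1 h.2, withDensity_apply _ MeasurableSet.univ,
      Measure.restrict_univ, lintegral_const_mul _ hg, ← stepKernel_apply]
    exact ENNReal.inv_mul_cancel h.1 h.2
  · classical
    unfold doobKernel
    rw [Kernel.piecewise_apply, if_neg (by exact h)]
    simp

/-- The law on `ℕ → ℝ` of the Markov chain started at `0` with one-step kernel `P^g`. -/
def doobChain (ν : Measure ℝ) [IsProbabilityMeasure ν] (g : ℝ → ℝ≥0∞) (hg : Measurable g) :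
    Measure (ℕ → ℝ) :=
  Kernel.trajMeasure (X := fun _ => ℝ) (Measure.dirac 0) fun n : ℕ =>
    (doobKernel ν g hg).comap
      (fun p : (i : Finset.Iic n) → ℝ => p ⟨n, Finset.mem_Iic.2 le_rfl⟩) (by fun_prop)

/-- The law of the walk with step law `ν`, started at `0` and conditioned not to visit
`(-∞, 0)`. -/
def condNonnegLaw (ν : Measure ℝ) [IsProbabilityMeasure ν] : Measure (ℕ → ℝ) :=
  doobChain ν ((Set.Ici (0 : ℝ)).indicator (renewalStrict ν))
    ((renewalStrict_mono ν).measurable.indicator measurableSet_Ici)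

/-- The law of the walk with step law `ν`, started at `0` and conditioned not to visit
`(-∞, 0]` after time `0`. -/
def condPosLaw (ν : Measure ℝ) [IsProbabilityMeasure ν] : Measure (ℕ → ℝ) :=
  doobChain ν ((Set.Ioi (0 : ℝ)).indicator (renewalWeak ν))
    ((renewalWeak_mono ν).measurable.indicator measurableSet_Ioi)

instance (μ : Measure ℝ) [IsProbabilityMeasure μ] :
    IsProbabilityMeasure (μ.map (fun x => -x)) :=
  Measure.isProbabilityMeasure_map (by fun_prop)

/-- Glue two one-sided trajectories into a two-sided one: `n ↦ p.1 n` for `n ≥ 0` and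
`-n ↦ p.2 n` for `n ≥ 1`. -/
def glue (p : (ℕ → ℝ) × (ℕ → ℝ)) (n : ℤ) : ℝ :=
  if 0 ≤ n then p.1 n.natAbs else p.2 n.natAbs

lemma measurable_glue : Measurable glue := by
  refine measurable_pi_iff.2 fun n => ?_
  unfold glue
  split_ifs <;> fun_prop

/-- The law on `ℤ → ℝ` of the process `Z`. The halves are independent; `(Z_n)_{n ≥ 0}` is the walk
with step law `μ` conditioned not to visit `(-∞, 0)`; and `(Z_{-n})_{n ≥ 0}` is the walk
`(S_{-n})_{n ≥ 0}`, whose steps have the law of `-h_1`, conditioned not to visit `(-∞, 0]` after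
time `0`. -/
def lawZ (μ : Measure ℝ) [IsProbabilityMeasure μ] : Measure (ℤ → ℝ) :=
  ((condNonnegLaw μ).prod (condPosLaw (μ.map (fun x => -x)))).map glue

instance (ν : Measure ℝ) [IsProbabilityMeasure ν] (g : ℝ → ℝ≥0∞) (hg : Measurable g) :
    IsProbabilityMeasure (doobChain ν g hg) := by
  unfold doobChain
  infer_instance

instance (μ : Measure ℝ) [IsProbabilityMeasure μ] : IsProbabilityMeasure (lawZ μ) := by
  unfold lawZ condNonnegLaw condPosLaw
  exact Measure.isProbabilityMeasure_map measurable_glue.aemeasurable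

end

/-! The second moment enters only through the central limit theorem, which makes the walk oscillate
(`oscillates_of_integral_eq_zero`). Everything else uses oscillation alone.

The environment is cut at the Γ-minimum N = u_2, with M = u_1. The pair (M, N) is the only one with
properties that can be read separately on the increments before M, on those between M and N, and on
those after N (`isSlope_uFirst`, `IsSlope.unique`, `isSlope_iff`). The expectation of a functional
of the environment is therefore a sum over (M, N) of products over independent blocks
(`lintegral_slopeSum`). To the right of N the walk is conditioned to reach Γ before becoming
negative. To the left, read backwards with steps of law -h_1, it is conditioned to stay positive
until it reaches Γ and then to run on to a maximum without dropping by Γ. The normalising constant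
follows from total mass one (`measure_slope_eq_one`).

Let q_Γ(x) be the probability that the walk started at x reaches Γ before leaving the half-line.
Decomposing paths at their minimum gives q_Γ(x) / q_Γ(0) → V(x), where V is the renewal function
(`tendsto_reachProb_div`), and also q_Γ(x) ≤ C e^x V(x) q_Γ(0) uniformly in Γ
(`exists_reachProb_le`). Time reversal turns the renewal series into first-entrance probabilities
and shows that V is harmonic (`lintegral_potential`). Hence V(S_n) is the density of the Doob chain
on its first n steps (`lintegral_doobChain`). A Scheffé argument then gives convergence of the law
of any fixed window around the minimum to that of Z (`tendsto_belowMean`).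

It remains to control what lies outside the window. Since log(Y + T) ≤ log Y + T for Y ≥ 1, only the
mean of the remainder T matters. Before Γ is reached, the weight e^{-2x} combined with the bound on
q_Γ leaves e^{-x} V(x). Its sum along the killed walk converges, because after time reversal it is
controlled by exponential moments of a ladder renewal measure (`tsum_lintegral_ladder_lt_top`), and
its tail is small uniformly in Γ (`exists_midTerm_le`). After Γ has been reached, a low point must
be followed by a climb back to the running maximum without a drop of Γ. This makes the mean
contribution of order q_Γ(0), which tends to 0 (`exists_peakRun_le`, `tendsto_reachProb_zero`).

The sum up to Γ/2 is at most the full sum, and it dominates the window sum on the event that the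
window stays below Γ/2. Letting Γ → ∞ and then enlarging the window squeezes both expectations onto
the same limit. -/

/-! ### Independent increments: splitting and time reversal -/

/-- The law of a sequence of independent variables with law `ν`. -/
noncomputable abbrev iid (ν : Measure ℝ) [IsProbabilityMeasure ν] : Measure (ℕ → ℝ) :=
  Measure.infinitePi fun _ => ν

/-- Forget the first `m` entries. -/
def shiftSeq (m : ℕ) (w : ℕ → ℝ) : ℕ → ℝ := fun i => w (m + i)

/-- The first `m` entries of `w`, followed by `w'`. -/
def concatSeq (m : ℕ) (w w' : ℕ → ℝ) : ℕ → ℝ := fun i => if i < m then w i else w' (i - m)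

/-- Reverse the order of the first `n` entries. -/
def revSeq (n : ℕ) (w : ℕ → ℝ) : ℕ → ℝ := fun i => if i < n then w (n - 1 - i) else w i

@[fun_prop]
lemma measurable_partialSum (n : ℕ) : Measurable fun w : ℕ → ℝ => partialSum w n := by
  unfold partialSum; fun_prop

@[fun_prop]
lemma measurable_partialSum_seq : Measurable (partialSum : (ℕ → ℝ) → ℕ → ℝ) :=
  measurable_pi_iff.2 fun n => measurable_partialSum n

@[fun_prop]
lemma measurable_shiftSeq (m : ℕ) : Measurable (shiftSeq m) := by
  unfold shiftSeq; fun_prop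

@[fun_prop]
lemma measurable_revSeq (m : ℕ) : Measurable (revSeq m) := by
  refine measurable_pi_iff.2 fun i => ?_
  unfold revSeq; split_ifs <;> fun_prop

@[fun_prop]
lemma measurable_concatSeq (m : ℕ) :
    Measurable (fun p : (ℕ → ℝ) × (ℕ → ℝ) => concatSeq m p.1 p.2) := by
  refine measurable_pi_iff.2 fun i => ?_
  unfold concatSeq; split_ifs <;> fun_prop

@[simp] lemma partialSum_zero (w : ℕ → ℝ) : partialSum w 0 = 0 := by simp [partialSum]

lemma partialSum_succ (w : ℕ → ℝ) (n : ℕ) : partialSum w (n + 1) = partialSum w n + w n := by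
  simp [partialSum, Finset.sum_range_succ]

@[simp] lemma partialSum_one (w : ℕ → ℝ) : partialSum w 1 = w 0 := by simp [partialSum]

lemma partialSum_add (w : ℕ → ℝ) (m k : ℕ) :
    partialSum w (m + k) = partialSum w m + partialSum (shiftSeq m w) k := by
  simp [partialSum, shiftSeq, Finset.sum_range_add]

lemma partialSum_shiftSeq (w : ℕ → ℝ) (m k : ℕ) :
    partialSum (shiftSeq m w) k = partialSum w (m + k) - partialSum w m := by
  rw [partialSum_add]; ring

lemma partialSum_congr {w w' : ℕ → ℝ} {n : ℕ} (h : ∀ i < n, w i = w' i) {k : ℕ} (hk : k ≤ n) :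
    partialSum w k = partialSum w' k :=
  Finset.sum_congr rfl fun i hi => h i (by have := Finset.mem_range.1 hi; omega)

lemma concatSeq_apply_lt (m : ℕ) (w w' : ℕ → ℝ) {i : ℕ} (h : i < m) :
    concatSeq m w w' i = w i := if_pos h

lemma shiftSeq_concatSeq (m : ℕ) (w w' : ℕ → ℝ) : shiftSeq m (concatSeq m w w') = w' := by
  funext i; simp [shiftSeq, concatSeq]

lemma shiftSeq_shiftSeq (m k : ℕ) (w : ℕ → ℝ) :
    shiftSeq k (shiftSeq m w) = shiftSeq (m + k) w := by
  funext i; simp [shiftSeq, add_assoc]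

lemma partialSum_revSeq {n k : ℕ} (w : ℕ → ℝ) (hk : k ≤ n) :
    partialSum (revSeq n w) k = partialSum w n - partialSum w (n - k) := by
  induction k with
  | zero => simp
  | succ k ih =>
    rw [partialSum_succ, ih (by omega)]
    have e : n - k = (n - (k + 1)) + 1 := by omega
    rw [e, partialSum_succ]
    have : revSeq n w k = w (n - (k + 1)) := by
      simp only [revSeq, if_pos (show k < n by omega)]; congr 1; omega
    rw [this]; ring

lemma partialSum_neg (w : ℕ → ℝ) (k : ℕ) :
    partialSum (fun i => - w i) k = - partialSum w k := by simp [partialSum]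

section
variable (ν : Measure ℝ) [IsProbabilityMeasure ν]

/-- Splicing an independent copy after time m leaves the law unchanged; it is enough to compare
finite boxes. The independence and Markov properties used below come from substituting the spliced
sequence. -/
lemma measurePreserving_concatSeq (m : ℕ) :
    MeasurePreserving (fun p : (ℕ → ℝ) × (ℕ → ℝ) => concatSeq m p.1 p.2)
      ((iid ν).prod (iid ν)) (iid ν) := by
  refine ⟨measurable_concatSeq m, Measure.eq_infinitePi _ fun s t ht => ?_⟩
  rw [Measure.map_apply (measurable_concatSeq m)
    (MeasurableSet.pi s.countable_toSet fun i _ => ht i)]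
  have e : (fun p : (ℕ → ℝ) × (ℕ → ℝ) => concatSeq m p.1 p.2) ⁻¹' (Set.pi s t) =
      (Set.pi (↑(s.filter (· < m))) t) ×ˢ
      (Set.pi (↑((s.filter (¬ · < m)).image (· - m))) fun j => t (j + m)) := by
    ext ⟨w, w'⟩
    simp only [Set.mem_preimage, Set.mem_pi, Set.mem_prod, Finset.coe_image, Finset.coe_filter,
      Set.mem_ofPred_eq, Finset.mem_coe, Set.mem_image, forall_exists_index, and_imp]
    constructor
    · intro h
      refine ⟨fun i hi him => ?_, fun j i hi him hj => ?_⟩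
      · have := h i hi; rwa [concatSeq, if_pos him] at this
      · subst hj
        have := h i hi
        rw [concatSeq, if_neg him] at this
        rwa [Nat.sub_add_cancel (not_lt.1 him)]
    · rintro ⟨h1, h2⟩ i hi
      by_cases him : i < m
      · rw [concatSeq, if_pos him]; exact h1 i hi him
      · rw [concatSeq, if_neg him]
        have := h2 (i - m) i hi him rfl
        rwa [Nat.sub_add_cancel (not_lt.1 him)] at this
  rw [e, Measure.prod_prod, Measure.infinitePi_pi _ (fun i _ => ht i),
    Measure.infinitePi_pi _ (fun i _ => ht _), Finset.prod_image]
  · rw [← Finset.prod_filter_mul_prod_filter_not s (· < m)]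
    congr 1
    refine Finset.prod_congr rfl fun i hi => ?_
    rw [Nat.sub_add_cancel (not_lt.1 (Finset.mem_filter.1 hi).2)]
  · intro i hi j hj hij
    have h1 := (Finset.mem_filter.1 hi).2
    have h2 := (Finset.mem_filter.1 hj).2
    simp only at hij
    omega

lemma lintegral_concatSeq (m : ℕ) {F : (ℕ → ℝ) → ℝ≥0∞} (hF : Measurable F) :
    ∫⁻ w, F w ∂(iid ν) = ∫⁻ w, ∫⁻ w', F (concatSeq m w w') ∂(iid ν) ∂(iid ν) := by
  rw [← (measurePreserving_concatSeq ν m).lintegral_comp hF,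
    lintegral_prod _ (by fun_prop)]

/-- The increments after time `m` are independent of those before. -/
lemma lintegral_mul_shiftSeq (m : ℕ) {F G : (ℕ → ℝ) → ℝ≥0∞} (hF : Measurable F)
    (hG : Measurable G) (hd : DependsOn F (Set.Iio m)) :
    ∫⁻ w, F w * G (shiftSeq m w) ∂(iid ν) = (∫⁻ w, F w ∂(iid ν)) * ∫⁻ w, G w ∂(iid ν) := by
  rw [lintegral_concatSeq ν m (by fun_prop)]
  simp_rw [shiftSeq_concatSeq]
  rw [← lintegral_mul_const _ hF]
  refine lintegral_congr fun w => ?_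
  rw [← lintegral_const_mul _ hG]
  refine lintegral_congr fun w' => ?_
  rw [hd (fun i hi => concatSeq_apply_lt m w w' hi)]

/-- Markov property at a fixed time, for a functional of the future that depends on the past
through a parameter. -/
lemma lintegral_shiftSeq_param (m : ℕ) {E : Type*} [MeasurableSpace E] {X : (ℕ → ℝ) → E}
    {F : E → (ℕ → ℝ) → ℝ≥0∞} (hX : Measurable X) (hF : Measurable (Function.uncurry F))
    (hd : DependsOn X (Set.Iio m)) :
    ∫⁻ w, F (X w) (shiftSeq m w) ∂(iid ν) = ∫⁻ w, ∫⁻ w', F (X w) w' ∂(iid ν) ∂(iid ν) := by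
  have h0 : Measurable fun w => F (X w) (shiftSeq m w) :=
    hF.comp (hX.prodMk (measurable_shiftSeq m))
  rw [lintegral_concatSeq ν m h0]
  refine lintegral_congr fun w => lintegral_congr fun w' => ?_
  rw [shiftSeq_concatSeq, hd (fun i hi => concatSeq_apply_lt m w w' hi)]

lemma revSeq_perm_injective (n : ℕ) :
    Function.Injective (fun i : ℕ => if i < n then n - 1 - i else i) := by
  intro i j h
  simp only at h
  split_ifs at h <;> omega

/-- Reversing a finite block is an injective relabelling of coordinates, which preserves a product
of identical factors. -/
lemma measurePreserving_revSeq (n : ℕ) : MeasurePreserving (revSeq n) (iid ν) (iid ν) := by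
  refine ⟨measurable_revSeq n, ?_⟩
  have := Measure.map_infinitePi_infinitePi_of_inj (P := fun _ : ℕ => ν) (revSeq_perm_injective n)
  convert this using 2
  funext w i
  simp only [revSeq]
  split_ifs <;> rfl

lemma measurePreserving_neg_seq :
    MeasurePreserving (fun (w : ℕ → ℝ) i => - w i) (iid ν) (iid (ν.map fun x => -x)) :=
  ⟨by fun_prop, Measure.infinitePi_map_pi (μ := fun _ : ℕ => ν) (f := fun _ x => -x)
    (fun _ => by fun_prop)⟩

lemma lintegral_eval (i : ℕ) {f : ℝ → ℝ≥0∞} (hf : Measurable f) :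
    ∫⁻ w, f (w i) ∂(iid ν) = ∫⁻ x, f x ∂ν :=
  (measurePreserving_eval_infinitePi (fun _ : ℕ => ν) i).lintegral_comp hf

end

/-- A series whose terms are at most `b`, with at most one nonzero term. -/
lemma tsum_le_of_unique {f : ℕ → ℝ≥0∞} {b : ℝ≥0∞} (h1 : ∀ m n, f m ≠ 0 → f n ≠ 0 → m = n)
    (h2 : ∀ m, f m ≤ b) : ∑' m, f m ≤ b := by
  by_cases h : ∃ m, f m ≠ 0
  · obtain ⟨m, hm⟩ := h
    rw [tsum_eq_single m fun n hn => by_contra fun h' => hn (h1 _ _ h' hm)]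
    exact h2 m
  · push Not at h
    simp [h]

/-! ### Ladder times and exponential moments of renewal measures -/

/-- The real exponential with values in `ℝ≥0∞`. -/
noncomputable def expE (x : ℝ) : ℝ≥0∞ := ENNReal.ofReal (Real.exp x)

@[fun_prop]
lemma measurable_expE : Measurable expE := by unfold expE; fun_prop

lemma expE_add (x y : ℝ) : expE (x + y) = expE x * expE y := by
  rw [expE, Real.exp_add, ENNReal.ofReal_mul (Real.exp_pos x).le]; rfl

@[simp] lemma expE_zero : expE 0 = 1 := by simp [expE]

lemma expE_ne_top (x : ℝ) : expE x ≠ ∞ := ENNReal.ofReal_ne_top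

lemma expE_mono : Monotone expE := fun _ _ h =>
  ENNReal.ofReal_le_ofReal (Real.exp_le_exp.2 h)

lemma expE_le_one {x : ℝ} (h : x ≤ 0) : expE x ≤ 1 := expE_zero ▸ expE_mono h

lemma expE_lt_one {x : ℝ} (h : x < 0) : expE x < 1 := by
  rw [expE, ENNReal.ofReal_lt_one]; exact Real.exp_zero ▸ Real.exp_lt_exp.2 h

lemma one_le_expE {x : ℝ} (h : 0 ≤ x) : 1 ≤ expE x := expE_zero ▸ expE_mono h

/-- The walk started at `x` is in `A` at the times `1, …, n`. -/
def staysIn (A : Set ℝ) (x : ℝ) (n : ℕ) : Set (ℕ → ℝ) :=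
  {w | ∀ j, 1 ≤ j → j ≤ n → x + partialSum w j ∈ A}

/-- The increments of the walk up to time `n` from all earlier times are in `A`. -/
def ladder (A : Set ℝ) (n : ℕ) : Set (ℕ → ℝ) :=
  {w | ∀ j < n, partialSum w n - partialSum w j ∈ A}

lemma measurableSet_staysIn {A : Set ℝ} (hA : MeasurableSet A) (x : ℝ) (n : ℕ) :
    MeasurableSet (staysIn A x n) := by
  unfold staysIn; measurability

lemma measurableSet_ladder {A : Set ℝ} (hA : MeasurableSet A) (n : ℕ) :
    MeasurableSet (ladder A n) := by
  unfold ladder; measurability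

/-- Serves to resum the double series that appear when a path is cut at time m: the sum over the
total length becomes a sum over the remaining length. -/
lemma tsum_shift (m : ℕ) (g : ℕ → ℝ≥0∞) :
    ∑' n, (if m ≤ n then g (n - m) else 0) = ∑' k, g k := by
  have hi : Function.Injective fun k : ℕ => m + k := fun a b h => by simpa using h
  rw [← hi.tsum_eq (f := fun n => if m ≤ n then g (n - m) else 0)]
  · refine tsum_congr fun k => ?_
    simp
  · intro n hn
    by_cases h : m ≤ n
    · exact ⟨n - m, by simp [h]⟩
    · simp [h] at hn

lemma dependsOn_partialSum {n k : ℕ} (hk : k ≤ n) :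
    DependsOn (fun w : ℕ → ℝ => partialSum w k) (Set.Iio n) :=
  fun _ _ h => partialSum_congr h hk

lemma mem_ladder_shift {A : Set ℝ} {m n : ℕ} {w : ℕ → ℝ} (hmn : m ≤ n) (h : w ∈ ladder A n) :
    shiftSeq m w ∈ ladder A (n - m) := by
  intro j hj
  rw [partialSum_shiftSeq, partialSum_shiftSeq, Nat.add_sub_cancel' hmn]
  have := h (m + j) (by omega)
  convert this using 1; ring

lemma tsum_geometric_eq_one_add (a : ℝ≥0∞) : ∑' k : ℕ, a ^ k = 1 + a * ∑' k : ℕ, a ^ k := by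
  rw [← ENNReal.tsum_mul_left, tsum_eq_zero_add' (f := fun k => a ^ k) ENNReal.summable, pow_zero]
  simp_rw [pow_succ']

lemma dependsOn_of_partialSum {β : Type*} {m : ℕ} {f : (ℕ → ℝ) → β}
    (h : ∀ w w', (∀ k ≤ m, partialSum w k = partialSum w' k) → f w = f w') :
    DependsOn f (Set.Iio m) :=
  fun w w' h' => h w w' fun _ hk => partialSum_congr h' hk

lemma dependsOn_indicator {s : Set (ℕ → ℝ)} {f : (ℕ → ℝ) → ℝ≥0∞} {I : Set ℕ}
    (hs : DependsOn (fun w => w ∈ s) I) (hf : DependsOn f I) : DependsOn (s.indicator f) I := by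
  intro w w' h
  classical
  have e : (w ∈ s) = (w' ∈ s) := hs h
  rw [Set.indicator_apply, Set.indicator_apply, hf h]
  simp only [e]

section
variable (ν : Measure ℝ) [IsProbabilityMeasure ν]

/-- Time reversal exchanges ladder times and times up to which the walk stays in a set. -/
lemma lintegral_staysIn_eq_ladder {A : Set ℝ} (hA : MeasurableSet A) (n : ℕ) {F : ℝ → ℝ≥0∞}
    (hF : Measurable F) :
    ∫⁻ w in staysIn A 0 n, F (partialSum w n) ∂(iid ν) =
      ∫⁻ w in ladder A n, F (partialSum w n) ∂(iid ν) := by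
  rw [← lintegral_indicator (measurableSet_staysIn hA 0 n),
    ← lintegral_indicator (measurableSet_ladder hA n),
    ← (measurePreserving_revSeq ν n).lintegral_comp
      (Measurable.indicator (by fun_prop) (measurableSet_staysIn hA 0 n))]
  refine lintegral_congr fun w => ?_
  -- Reversal sends S_k to S_n - S_{n-k}; the range 1 ≤ k ≤ n of one event corresponds to 0 ≤ j < n
  -- in the other.
  have e : revSeq n w ∈ staysIn A 0 n ↔ w ∈ ladder A n := by
    constructor
    · intro h j hj
      have := h (n - j) (by omega) (by omega)
      rw [partialSum_revSeq w (by omega), zero_add] at this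
      rwa [show n - (n - j) = j by omega] at this
    · intro h j h1 h2
      rw [partialSum_revSeq w h2, zero_add]
      exact h _ (by omega)
  by_cases hw : w ∈ ladder A n
  · rw [Set.indicator_of_mem hw, Set.indicator_of_mem (e.2 hw), partialSum_revSeq w le_rfl]
    simp
  · rw [Set.indicator_of_notMem hw, Set.indicator_of_notMem fun h => hw (e.1 h)]

lemma measure_staysIn_eq_ladder {A B : Set ℝ} (hA : MeasurableSet A) (hB : MeasurableSet B)
    (n : ℕ) :
    iid ν (staysIn A 0 n ∩ {w | partialSum w n ∈ B}) =
      iid ν (ladder A n ∩ {w | partialSum w n ∈ B}) := by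
  have hB' : MeasurableSet {w : ℕ → ℝ | partialSum w n ∈ B} := measurable_partialSum n hB
  have := lintegral_staysIn_eq_ladder ν hA n (F := B.indicator 1)
    (measurable_one.indicator hB)
  have e (s : Set (ℕ → ℝ)) : ∫⁻ w in s, B.indicator 1 (partialSum w n) ∂(iid ν) =
      iid ν (s ∩ {w | partialSum w n ∈ B}) := by
    rw [Set.inter_comm, ← Measure.restrict_apply hB', ← lintegral_indicator_one hB']
    rfl
  rwa [e, e] at this

/-- The exponential moments of the renewal measure of the ladder points are finite. -/
lemma tsum_lintegral_ladder_lt_top {A : Set ℝ} (hA : MeasurableSet A) (c : ℝ)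
    (hc : ∀ x ∈ A, c * x ≤ 0) (hpos : 0 < ν {x | x ∈ A ∧ c * x < 0}) :
    ∑' n, ∫⁻ w in ladder A n, expE (c * partialSum w n) ∂(iid ν) < ∞ := by
  let lad : ℕ → (ℕ → ℝ) → ℝ≥0∞ := fun n =>
    (ladder A n).indicator fun w => expE (c * partialSum w n)
  -- The path is cut at its first entrance into `A` after time 0. What follows is again a ladder
  -- path, so the moments satisfy a renewal inequality with mass `a`.
  let first : ℕ → Set (ℕ → ℝ) := fun m =>
    {w | 1 ≤ m ∧ partialSum w m ∈ A ∧ ∀ j, 1 ≤ j → j < m → partialSum w j ∉ A}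
  have hfirst : ∀ m, MeasurableSet (first m) := fun m => by
    simp only [first]; measurability
  let f : ℕ → (ℕ → ℝ) → ℝ≥0∞ := fun m => (first m).indicator fun w => expE (c * partialSum w m)
  have hlad : ∀ n, Measurable (lad n) := fun n =>
    Measurable.indicator (by fun_prop) (measurableSet_ladder hA n)
  have hf : ∀ n, Measurable (f n) := fun n =>
    Measurable.indicator (by fun_prop) (hfirst n)
  have hfd : ∀ m, DependsOn (f m) (Set.Iio m) := by
    intro m w w' h
    have e : ∀ k ≤ m, partialSum w k = partialSum w' k := fun k hk => partialSum_congr h hk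
    have e1 : w ∈ first m ↔ w' ∈ first m := by
      simp only [first, Set.mem_ofPred_eq, e m le_rfl]
      refine and_congr_right fun _ => and_congr_right fun _ => ?_
      refine forall_congr' fun j => forall_congr' fun _ => forall_congr' fun hj => ?_
      rw [e j hj.le]
    simp only [f, Set.indicator, e m le_rfl]
    by_cases h' : w ∈ first m
    · rw [if_pos h', if_pos (e1.1 h')]
    · rw [if_neg h', if_neg fun hh => h' (e1.2 hh)]
  -- the recursion
  have hrec : ∀ n w, lad (n + 1) w ≤
      ∑' m, if m ≤ n + 1 then f m w * lad (n + 1 - m) (shiftSeq m w) else 0 := by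
    intro n w
    by_cases hw : w ∈ ladder A (n + 1)
    -- Comparison with time 0 puts S_{n+1} in `A`, so the entrance occurs by time n + 1.
    · have hex : ∃ m, 1 ≤ m ∧ partialSum w m ∈ A :=
        ⟨n + 1, by omega, by simpa using hw 0 (by omega)⟩
      classical
      let m := Nat.find hex
      obtain ⟨h1, h2⟩ := Nat.find_spec hex
      have hm : m ≤ n + 1 := Nat.find_min' hex ⟨by omega, by simpa using hw 0 (by omega)⟩
      refine le_trans ?_ (ENNReal.le_tsum m)
      have hmf : w ∈ first m := ⟨h1, h2, fun j hj hjm hjA => Nat.find_min hex hjm ⟨hj, hjA⟩⟩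
      rw [if_pos hm]
      simp only [lad, f]
      rw [Set.indicator_of_mem hw, Set.indicator_of_mem hmf,
        Set.indicator_of_mem (mem_ladder_shift hm hw), ← expE_add, partialSum_shiftSeq,
        Nat.add_sub_cancel' hm]
      apply le_of_eq; congr 1; ring
    · simp [lad, Set.indicator_of_notMem hw]
  let a : ℝ≥0∞ := ∑' m, ∫⁻ w, f m w ∂(iid ν)
  let Lam : ℕ → ℝ≥0∞ := fun n => ∫⁻ w, lad n w ∂(iid ν)
  have hf0 : ∫⁻ w, f 0 w ∂(iid ν) = 0 := by simp [f, first]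
  have hstep : ∀ n, Lam (n + 1) ≤
      ∑' m, if m ≤ n + 1 then (∫⁻ w, f m w ∂(iid ν)) * Lam (n + 1 - m) else 0 := by
    intro n
    refine (lintegral_mono (hrec n)).trans ?_
    rw [lintegral_tsum]
    · refine ENNReal.tsum_le_tsum fun m => ?_
      split_ifs with h
      · exact (lintegral_mul_shiftSeq ν m (hf m) (hlad _) (hfd m)).le
      · simp
    · intro m
      split_ifs with h
      · exact ((hf m).mul ((hlad _).comp (measurable_shiftSeq m))).aemeasurable
      · fun_prop
  -- If the first step is in `A`, the entrance is immediate and its weight is below 1 with positive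
  -- probability; otherwise the weight is at most 1.
  have ha : a < 1 := by
    let g : ℝ → ℝ≥0∞ := fun x => A.indicator (fun x => expE (c * x)) x + Aᶜ.indicator 1 x
    have hg : Measurable g := by
      refine Measurable.add (Measurable.indicator (by fun_prop) hA)
        (measurable_one.indicator hA.compl)
    have hle1 : ∀ x, g x ≤ 1 := by
      intro x
      by_cases hx : x ∈ A
      · simp [g, hx, expE_le_one (hc x hx)]
      · simp [g, hx]
    have h1 : a ≤ ∫⁻ x, g x ∂ν := by
      rw [← lintegral_eval ν 0 hg]
      simp only [a]
      rw [← lintegral_tsum fun m => (hf m).aemeasurable]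
      refine lintegral_mono fun w => ?_
      have huniq : ∀ m n, w ∈ first m → w ∈ first n → m = n := by
        intro m n h h'
        rcases lt_trichotomy m n with hl | hl | hl
        · exact absurd h.2.1 (h'.2.2 m h.1 hl)
        · exact hl
        · exact absurd h'.2.1 (h.2.2 n h'.1 hl)
      refine tsum_le_of_unique (fun m n h h' => huniq m n (Set.mem_of_indicator_ne_zero h)
        (Set.mem_of_indicator_ne_zero h')) fun m => ?_
      by_cases hm : w ∈ first m
      · simp only [f]
        rw [Set.indicator_of_mem hm]
        by_cases hw0 : w 0 ∈ A
        · have : m = 1 := huniq m 1 hm ⟨le_rfl, by simpa using hw0, by omega⟩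
          subst this
          simp [g, hw0]
        · simp only [g, Set.indicator_of_notMem hw0, Set.indicator_of_mem (show w 0 ∈ Aᶜ from hw0)]
          simpa using expE_le_one (hc _ hm.2.1)
      · simp [f, hm]
    refine h1.trans_lt ?_
    have hne : ∫⁻ x, g x ∂ν ≠ ∞ :=
      ((lintegral_mono hle1).trans_lt (by simp)).ne
    have : ∫⁻ x, g x ∂ν < ∫⁻ _, 1 ∂ν := by
      refine lintegral_strict_mono_of_ae_le_of_ae_lt_on measurable_const.aemeasurable hne
        (ae_of_all _ hle1) hpos.ne' ?_
      refine ae_of_all _ fun x hx => ?_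
      simpa [g, hx.1] using expE_lt_one hx.2
    simpa using this
  have hLam0 : Lam 0 ≤ 1 := by
    refine (lintegral_mono (g := fun _ => 1) fun w => ?_).trans (by simp)
    simp only [lad, Set.indicator]
    split_ifs <;> simp
  -- Partial sums L_N satisfy L_{N+1} ≤ 1 + a L_N, which avoids subtracting possibly infinite
  -- quantities. The geometric series is the fixed point of this recursion.
  have hbound : ∀ N, ∑ n ∈ Finset.range N, Lam n ≤ ∑' k : ℕ, a ^ k := by
    intro N
    induction N with
    | zero => simp
    | succ N ih =>
      rw [Finset.sum_range_succ', add_comm]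
      have h2 : ∑ n ∈ Finset.range N, Lam (n + 1) ≤ a * ∑ n ∈ Finset.range N, Lam n := by
        refine (Finset.sum_le_sum fun n _ => hstep n).trans ?_
        rw [← Summable.tsum_finsetSum fun _ _ => ENNReal.summable]
        simp only [a]
        rw [← ENNReal.tsum_mul_right]
        refine ENNReal.tsum_le_tsum fun m => ?_
        rcases Nat.eq_zero_or_pos m with rfl | hm
        · simp [hf0]
        · rw [← Finset.sum_filter, ← Finset.mul_sum]
          gcongr
          rw [← Finset.sum_image (f := Lam) (g := fun n => n + 1 - m)]
          · refine Finset.sum_le_sum_of_subset fun k hk => ?_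
            simp only [Finset.mem_image, Finset.mem_filter, Finset.mem_range] at hk ⊢
            omega
          · intro i hi j hj hij
            have h1 := (Finset.mem_filter.1 hi).2
            have h2 := (Finset.mem_filter.1 hj).2
            simp only at hij
            omega
      rw [tsum_geometric_eq_one_add a]
      gcongr
      exact h2.trans (by gcongr)
  have e : ∑' n, ∫⁻ w in ladder A n, expE (c * partialSum w n) ∂(iid ν) = ∑' n, Lam n :=
    tsum_congr fun n => (lintegral_indicator (measurableSet_ladder hA n) _).symm
  rw [e, ENNReal.tsum_eq_iSup_nat]
  refine (iSup_le hbound).trans_lt ?_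
  rw [ENNReal.tsum_geometric, ENNReal.inv_lt_top]
  exact tsub_pos_of_lt ha

/-- The expected number of ladder points in a window is at most the expected number of those
within the diameter of the window. -/
lemma tsum_measure_ladder_window {A I D : Set ℝ} (hA : MeasurableSet A) (hI : MeasurableSet I)
    (hD : MeasurableSet D) (hID : ∀ x ∈ I, ∀ y ∈ I, y - x ∈ D) :
    ∑' n, iid ν (ladder A n ∩ {w | partialSum w n ∈ I}) ≤
      ∑' n, iid ν (ladder A n ∩ {w | partialSum w n ∈ D}) := by
  have hm (B : Set ℝ) (hB : MeasurableSet B) (n : ℕ) :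
      MeasurableSet (ladder A n ∩ {w : ℕ → ℝ | partialSum w n ∈ B}) :=
    (measurableSet_ladder hA n).inter (measurable_partialSum n hB)
  -- Restart at the first ladder point in the window: the later ones in the window are ladder points
  -- of the restarted walk, at a displacement in `D`.
  let first : ℕ → Set (ℕ → ℝ) := fun m =>
    (ladder A m ∩ {w | partialSum w m ∈ I}) ∩ {w | ∀ j < m, w ∉ ladder A j ∩ {w | partialSum w j ∈ I}}
  have hfirst : ∀ m, MeasurableSet (first m) := fun m => by
    refine (hm I hI m).inter ?_
    have : {w | ∀ j < m, w ∉ ladder A j ∩ {w | partialSum w j ∈ I}} =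
      ⋂ j, ⋂ (_ : j < m), (ladder A j ∩ {w | partialSum w j ∈ I})ᶜ := by ext w; simp
    rw [this]
    exact MeasurableSet.iInter fun j => MeasurableSet.iInter fun _ => (hm I hI j).compl
  have hdep (B : Set ℝ) (m : ℕ) (w w' : ℕ → ℝ) (h : ∀ i ∈ Set.Iio m, w i = w' i) (j : ℕ)
      (hj : j ≤ m) : w ∈ ladder A j ∩ {w | partialSum w j ∈ B} ↔
        w' ∈ ladder A j ∩ {w | partialSum w j ∈ B} := by
    have e : ∀ k ≤ m, partialSum w k = partialSum w' k := fun k hk => partialSum_congr h hk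
    simp only [ladder, Set.mem_inter_iff, Set.mem_ofPred_eq, e j hj]
    refine and_congr_left fun _ => forall_congr' fun k => forall_congr' fun hk => ?_
    rw [e k (by omega)]
  have hfd : ∀ m, DependsOn ((first m).indicator (1 : (ℕ → ℝ) → ℝ≥0∞)) (Set.Iio m) := by
    intro m w w' h
    have : w ∈ first m ↔ w' ∈ first m := by
      refine and_congr (hdep I m w w' h m le_rfl)
        (forall_congr' fun j => forall_congr' fun hj => ?_)
      rw [hdep I m w w' h j hj.le]
    simp only [Set.indicator]
    by_cases h' : w ∈ first m
    · rw [if_pos h', if_pos (this.1 h')]; rfl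
    · rw [if_neg h', if_neg fun hh => h' (this.2 hh)]
  have hpt : ∀ n w, (ladder A n ∩ {w | partialSum w n ∈ I}).indicator (1 : (ℕ → ℝ) → ℝ≥0∞) w ≤
      ∑' m, if m ≤ n then (first m).indicator 1 w *
        (ladder A (n - m) ∩ {w | partialSum w (n - m) ∈ D}).indicator (1 : (ℕ → ℝ) → ℝ≥0∞)
          (shiftSeq m w) else 0 := by
    intro n w
    by_cases hw : w ∈ ladder A n ∩ {w | partialSum w n ∈ I}
    · classical
      have hex : ∃ m, w ∈ ladder A m ∩ {w | partialSum w m ∈ I} := ⟨n, hw⟩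
      have hmn : Nat.find hex ≤ n := Nat.find_min' hex hw
      have hm1 := Nat.find_spec hex
      refine le_trans ?_ (ENNReal.le_tsum (Nat.find hex))
      have h1 : w ∈ first (Nat.find hex) := ⟨hm1, fun j hj => Nat.find_min hex hj⟩
      have h2 : shiftSeq (Nat.find hex) w ∈ ladder A (n - Nat.find hex) ∩
          {w | partialSum w (n - Nat.find hex) ∈ D} := by
        refine ⟨mem_ladder_shift hmn hw.1, ?_⟩
        show partialSum _ _ ∈ D
        rw [partialSum_shiftSeq, Nat.add_sub_cancel' hmn]
        exact hID _ hm1.2 _ hw.2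
      rw [if_pos hmn, Set.indicator_of_mem hw, Set.indicator_of_mem h1, Set.indicator_of_mem h2]
      simp
    · rw [Set.indicator_of_notMem hw]; exact zero_le
  let g : ℕ → ℝ≥0∞ := fun n => iid ν (ladder A n ∩ {w | partialSum w n ∈ D})
  have hstep : ∀ n, iid ν (ladder A n ∩ {w | partialSum w n ∈ I}) ≤
      ∑' m, if m ≤ n then iid ν (first m) * g (n - m) else 0 := by
    intro n
    rw [← lintegral_indicator_one (hm I hI n)]
    refine (lintegral_mono (hpt n)).trans ?_
    rw [lintegral_tsum]
    · refine ENNReal.tsum_le_tsum fun m => ?_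
      split_ifs with h
      · rw [lintegral_mul_shiftSeq ν m (measurable_one.indicator (hfirst m))
          (measurable_one.indicator (hm D hD _)) (hfd m), lintegral_indicator_one (hfirst m),
          lintegral_indicator_one (hm D hD _)]
      · simp
    · intro m
      split_ifs with h
      · exact ((measurable_one.indicator (hfirst m)).mul
          ((measurable_one.indicator (hm D hD _)).comp (measurable_shiftSeq m))).aemeasurable
      · fun_prop
  refine (ENNReal.tsum_le_tsum hstep).trans ?_
  rw [ENNReal.tsum_comm]
  have h1 : ∀ m, ∑' n, (if m ≤ n then iid ν (first m) * g (n - m) else 0) =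
      iid ν (first m) * ∑' k, g k := by
    intro m
    rw [← tsum_shift m g, ← ENNReal.tsum_mul_left]
    refine tsum_congr fun n => ?_
    split_ifs <;> simp
  simp_rw [h1]
  rw [ENNReal.tsum_mul_right]
  have h2 : ∑' m, iid ν (first m) ≤ 1 := by
    rw [← measure_iUnion _ hfirst]
    · exact prob_le_one
    · intro i j hij
      refine Set.disjoint_left.2 fun w hi hj => ?_
      rcases lt_or_gt_of_ne hij with h | h
      · exact hj.2 i h hi.1
      · exact hi.2 j h hj.1
  calc _ ≤ 1 * ∑' k, g k := by gcongr
    _ = _ := one_mul _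

end

/-! ### Oscillation of centred random walks -/

section
variable (ν : Measure ℝ) [IsProbabilityMeasure ν]

lemma measure_inter_shiftSeq (m : ℕ) {s t : Set (ℕ → ℝ)} (hs : MeasurableSet s)
    (ht : MeasurableSet t) (hd : DependsOn (fun w => w ∈ s) (Set.Iio m)) :
    iid ν (s ∩ shiftSeq m ⁻¹' t) = iid ν s * iid ν t := by
  have := lintegral_mul_shiftSeq ν m (measurable_one.indicator hs) (measurable_one.indicator ht)
    (dependsOn_indicator (f := 1) hd fun _ _ _ => rfl)
  rw [lintegral_indicator_one hs, lintegral_indicator_one ht] at this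
  rw [← this, ← lintegral_indicator_one (hs.inter (measurable_shiftSeq m ht))]
  refine lintegral_congr fun w => ?_
  by_cases h1 : w ∈ s <;> by_cases h2 : shiftSeq m w ∈ t <;> simp [h1, h2]

/-- Almost surely, the walk is unbounded above and unbounded below. -/
def Oscillates : Prop :=
  (∀ᵐ w ∂(iid ν), ∀ a : ℝ, ∃ n, a ≤ partialSum w n) ∧
  (∀ᵐ w ∂(iid ν), ∀ a : ℝ, ∃ n, partialSum w n ≤ a)

/-- For large n a path that stays below a satisfies S_n ≤ √n, and the central limit theorem bounds
the probability of that. The bound is the same for every a. -/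
lemma measure_forall_partialSum_lt_le (hsq : Integrable (fun x : ℝ => x ^ 2) ν)
    (hmean : ∫ x, x ∂ν = 0) (a : ℝ) :
    iid ν {w | ∀ n, partialSum w n < a} ≤
      gaussianReal 0 (∫ x, x ^ 2 ∂ν).toNNReal (Set.Iic 1) := by
  have hL2 : MemLp (fun x : ℝ => x) 2 ν :=
    (memLp_two_iff_integrable_sq measurable_id.aestronglyMeasurable).2 hsq
  let X : ℕ → (ℕ → ℝ) → ℝ := fun k w => w k
  have hX : ∀ k, MeasurePreserving (X k) (iid ν) ν := fun k =>
    measurePreserving_eval_infinitePi (fun _ : ℕ => ν) k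
  have hX2 : MemLp (X 0) 2 (iid ν) := hL2.comp_measurePreserving (hX 0)
  have hm0 : ∫ w, X 0 w ∂(iid ν) = 0 := by
    rw [← hmean]
    conv_rhs => rw [← (hX 0).map_eq]
    rw [integral_map (hX 0).measurable.aemeasurable (by fun_prop)]
  have hvar : Var[X 0; iid ν] = ∫ x, x ^ 2 ∂ν := by
    rw [variance_of_integral_eq_zero (hX 0).measurable.aemeasurable hm0]
    conv_rhs => rw [← (hX 0).map_eq]
    rw [integral_map (hX 0).measurable.aemeasurable (by fun_prop)]
  have hclt := tendstoInDistribution_inv_sqrt_mul_sum_sub (P := iid ν) (X := X) (Y := id)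
    (P' := gaussianReal 0 (∫ x, x ^ 2 ∂ν).toNNReal)
    (by rw [hvar]; exact HasLaw.id) hX2
    (iIndepFun_infinitePi (P := fun _ : ℕ => ν) (X := fun _ x => x) fun _ => measurable_id)
    (fun i => ⟨(hX i).measurable.aemeasurable, (hX 0).measurable.aemeasurable, by
      rw [(hX i).map_eq, (hX 0).map_eq]⟩)
  have h := ProbabilityMeasure.limsup_measure_closed_le_of_tendsto hclt.tendsto
    (F := Set.Iic 1) isClosed_Iic
  simp only [ProbabilityMeasure.coe_mk, Measure.map_id] at h
  refine le_trans ?_ h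
  refine le_limsup_of_frequently_le (Eventually.frequently ?_) (by isBoundedDefault)
  have hev : ∀ᶠ n : ℕ in atTop, a ≤ √(n : ℝ) :=
    (Real.tendsto_sqrt_atTop.comp tendsto_natCast_atTop_atTop).eventually_ge_atTop a
  filter_upwards [hev, eventually_gt_atTop 0] with n hn hn0
  rw [Measure.map_apply (by simp only [X]; fun_prop) measurableSet_Iic]
  refine measure_mono fun w hw => ?_
  have h1 := hw n
  have hs : 0 < √(n : ℝ) := Real.sqrt_pos.2 (by exact_mod_cast hn0)
  simp only [Set.mem_preimage, Set.mem_Iic, hm0, mul_zero, sub_zero]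
  rw [inv_mul_le_iff₀ hs, mul_one]
  exact (h1.le.trans hn)

/-- Dropping m steps does not affect boundedness from above, an event of probability at most c < 1.
Hence P(S < a always) ≤ c · P(S < a up to m), and letting m grow forces the left side to vanish. -/
lemma ae_exists_le_partialSum (hsq : Integrable (fun x : ℝ => x ^ 2) ν)
    (hpos : 0 < ∫ x, x ^ 2 ∂ν) (hmean : ∫ x, x ∂ν = 0) :
    ∀ᵐ w ∂(iid ν), ∀ a : ℝ, ∃ n, a ≤ partialSum w n := by
  set c := gaussianReal 0 (∫ x, x ^ 2 ∂ν).toNNReal (Set.Iic 1) with hc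
  have hc1 : c < 1 := by
    have hv : (∫ x, x ^ 2 ∂ν).toNNReal ≠ 0 := by simpa using hpos
    have h1 : gaussianReal 0 (∫ x, x ^ 2 ∂ν).toNNReal (Set.Iic 1)ᶜ ≠ 0 := by
      intro h0
      have := gaussianReal_absolutelyContinuous' 0 hv h0
      simp at this
    rw [prob_compl_eq_one_sub measurableSet_Iic] at h1
    exact tsub_pos_iff_lt.1 (pos_iff_ne_zero.2 h1)
  let g : ℝ → Set (ℕ → ℝ) := fun a => {w | ∀ n, partialSum w n < a}
  have hg : ∀ a, iid ν (g a) ≤ c := measure_forall_partialSum_lt_le ν hsq hmean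
  have hgm : ∀ a, MeasurableSet (g a) := fun a => by simp only [g]; measurability
  let B : Set (ℕ → ℝ) := ⋃ k : ℕ, g k
  have hBm : MeasurableSet B := MeasurableSet.iUnion fun k => hgm k
  have hB : iid ν B ≤ c := by
    have hmono : Monotone fun k : ℕ => g k := fun i j hij w hw n =>
      (hw n).trans_le (by exact_mod_cast hij)
    simp only [B]
    rw [hmono.measure_iUnion]
    exact iSup_le fun k => hg k
  have hzero : ∀ a, iid ν (g a) = 0 := by
    intro a
    let s : ℕ → Set (ℕ → ℝ) := fun m => {w | ∀ n ≤ m, partialSum w n < a}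
    have hsm : ∀ m, MeasurableSet (s m) := fun m => by simp only [s]; measurability
    have h1 : ∀ m, iid ν (g a) ≤ iid ν (s m) * c := by
      intro m
      refine le_trans ?_ (mul_le_mul_right hB _)
      rw [← measure_inter_shiftSeq ν m (hsm m) hBm]
      · refine measure_mono fun w hw => ⟨fun n _ => hw n, ?_⟩
        obtain ⟨k, hk⟩ := exists_nat_ge (a - partialSum w m)
        refine Set.mem_iUnion.2 ⟨k, fun n => ?_⟩
        rw [partialSum_shiftSeq]
        have := hw (m + n)
        linarith
      · refine dependsOn_of_partialSum fun w w' h => ?_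
        simp only [s, Set.mem_ofPred_eq]
        grind
    have h2 : Tendsto (fun m => iid ν (s m)) atTop (𝓝 (iid ν (⋂ m, s m))) :=
      tendsto_measure_iInter_atTop (fun m => (hsm m).nullMeasurableSet)
        (fun i j hij w hw n hn => hw n (hn.trans hij)) ⟨0, measure_ne_top _ _⟩
    have h3 : ⋂ m, s m = g a := by
      ext w
      simp only [Set.mem_iInter]
      exact ⟨fun h n => h n n le_rfl, fun h m n _ => h n⟩
    rw [h3] at h2
    have h4 : iid ν (g a) ≤ iid ν (g a) * c :=
      ge_of_tendsto' (ENNReal.Tendsto.mul_const h2 (Or.inr hc1.ne_top)) h1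
    by_contra hne
    have : iid ν (g a) * c < iid ν (g a) * 1 :=
      ENNReal.mul_lt_mul_right hne (measure_ne_top _ _) hc1
    rw [mul_one] at this
    exact absurd h4 (not_le.2 this)
  have h5 : ∀ᵐ w ∂(iid ν), ∀ k : ℕ, w ∉ g k :=
    ae_all_iff.2 fun k => measure_eq_zero_iff_ae_notMem.1 (hzero k)
  filter_upwards [h5] with w hw a
  obtain ⟨k, hk⟩ := exists_nat_ge a
  have := hw k
  simp only [g, Set.mem_ofPred_eq, not_forall, not_lt] at this
  obtain ⟨n, hn⟩ := this
  exact ⟨n, hk.trans hn⟩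

lemma ae_iid_neg_iff {p : (ℕ → ℝ) → Prop} :
    (∀ᵐ w ∂(iid (ν.map fun x => -x)), p w) ↔ ∀ᵐ w ∂(iid ν), p fun i => - w i := by
  have e : MeasurableEmbedding fun (w : ℕ → ℝ) i => - w i :=
    (MeasurableEquiv.neg (ℕ → ℝ)).measurableEmbedding
  rw [← (measurePreserving_neg_seq ν).map_eq, e.ae_map_iff]

variable {ν}

lemma Oscillates.neg (h : Oscillates ν) : Oscillates (ν.map fun x => -x) := by
  constructor
  · rw [ae_iid_neg_iff]
    filter_upwards [h.2] with w hw a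
    obtain ⟨n, hn⟩ := hw (-a)
    exact ⟨n, by rw [partialSum_neg]; linarith⟩
  · rw [ae_iid_neg_iff]
    filter_upwards [h.1] with w hw a
    obtain ⟨n, hn⟩ := hw (-a)
    exact ⟨n, by rw [partialSum_neg]; linarith⟩

lemma oscillates_of_integral_eq_zero (hsq : Integrable (fun x : ℝ => x ^ 2) ν)
    (hpos : 0 < ∫ x, x ^ 2 ∂ν) (hmean : ∫ x, x ∂ν = 0) : Oscillates ν := by
  refine ⟨ae_exists_le_partialSum ν hsq hpos hmean, ?_⟩
  have h := ae_exists_le_partialSum (ν.map fun x => -x)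
    ((integrable_map_measure (by fun_prop) (by fun_prop)).2 (by simpa [Function.comp_def] using hsq))
    (by rw [integral_map (by fun_prop) (by fun_prop)]; simpa using hpos)
    (by rw [integral_map (by fun_prop) (by fun_prop), integral_neg, hmean, neg_zero])
  rw [ae_iid_neg_iff] at h
  filter_upwards [h] with w hw a
  obtain ⟨n, hn⟩ := hw (-a)
  exact ⟨n, by rw [partialSum_neg] at hn; linarith⟩

lemma Oscillates.measure_Ioi_pos (h : Oscillates ν) : 0 < ν (Set.Ioi 0) := by
  refine pos_iff_ne_zero.2 fun h0 => ?_
  have h1 : ∀ᵐ w ∂(iid ν), ∀ i, w i ≤ 0 := by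
    refine ae_all_iff.2 fun i => ?_
    have : ∀ᵐ x ∂ν, x ≤ 0 := by
      rw [ae_iff]; simpa [Set.Ioi] using h0
    exact (measurePreserving_eval_infinitePi (fun _ : ℕ => ν) i).quasiMeasurePreserving.ae this
  obtain ⟨w, hw1, hw2⟩ := (h1.and h.1).exists
  obtain ⟨n, hn⟩ := hw2 1
  have : partialSum w n ≤ 0 := Finset.sum_nonpos fun i _ => hw1 i
  linarith

lemma Oscillates.measure_Iio_pos (h : Oscillates ν) : 0 < ν (Set.Iio 0) := by
  have := h.neg.measure_Ioi_pos
  rw [Measure.map_apply (by fun_prop) measurableSet_Ioi] at this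
  simpa using this

end

/-! ### Walks killed outside a half-line: potential kernel and probability to reach a level -/

/-- A set which is `[0, ∞)` or `(0, ∞)`. -/
def IsHalfLine (K : Set ℝ) : Prop := K = Set.Ici 0 ∨ K = Set.Ioi 0

namespace IsHalfLine

variable {K : Set ℝ} (hK : IsHalfLine K)
include hK

lemma measurableSet : MeasurableSet K := by
  rcases hK with rfl | rfl <;> measurability

lemma mem_of_pos {x : ℝ} (h : 0 < x) : x ∈ K := by
  rcases hK with rfl | rfl
  · exact h.le
  · exact h

lemma nonneg {x : ℝ} (h : x ∈ K) : 0 ≤ x := by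
  rcases hK with rfl | rfl
  · exact h
  · exact le_of_lt h

lemma nonpos {x : ℝ} (h : x ∉ K) : x ≤ 0 := not_lt.1 fun h' => h (hK.mem_of_pos h')

lemma mem_of_le {x y : ℝ} (h : x ∈ K) (hxy : x ≤ y) : y ∈ K := by
  rcases hK with rfl | rfl
  · exact le_trans h hxy
  · exact lt_of_lt_of_le h hxy

lemma notMem_of_le {x y : ℝ} (h : x ∉ K) (hxy : y ≤ x) : y ∉ K :=
  fun h' => h (hK.mem_of_le h' hxy)

/-- Position of a minimum of a finite path: the first one or the last one, according to whether
`0` belongs to `K` or not. -/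
lemma exists_argmin (S : ℕ → ℝ) (N : ℕ) :
    ∃ n ≤ N, (∀ j < n, S n - S j ∉ K) ∧ ∀ j, n < j → j ≤ N → S j - S n ∈ K := by
  induction N with
  | zero => exact ⟨0, le_rfl, by simp, fun j h1 h2 => by omega⟩
  | succ N ih =>
    obtain ⟨n, hn, h1, h2⟩ := ih
    -- The new endpoint either leaves the current minimum in place or becomes the minimum itself.
    by_cases h : S (N + 1) - S n ∈ K
    · refine ⟨n, by omega, h1, fun j hj hjN => ?_⟩
      rcases Nat.lt_or_ge N j with h' | h'
      · rwa [show j = N + 1 by omega]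
      · exact h2 j hj h'
    · refine ⟨N + 1, le_rfl, fun j hj => ?_, fun j h3 h4 => by omega⟩
      refine hK.notMem_of_le h ?_
      rcases lt_trichotomy j n with hjn | rfl | hjn
      · linarith [hK.nonpos (h1 j hjn)]
      · rfl
      · linarith [hK.nonneg (h2 j hjn (by omega))]

end IsHalfLine

/-- The walk started at `x` reaches `[Γ, ∞)`, being in `K` from time `1` until then. -/
def reach (K : Set ℝ) (Γ x : ℝ) : Set (ℕ → ℝ) :=
  {w | ∃ n, Γ ≤ x + partialSum w n ∧ w ∈ staysIn K x n}

/-- The walk started at `x` reaches `[Γ, ∞)` for the first time at time `m`, being in `K` from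
time `1` until then. -/
def hit (K : Set ℝ) (Γ x : ℝ) (m : ℕ) : Set (ℕ → ℝ) :=
  {w | Γ ≤ x + partialSum w m ∧ (∀ j < m, x + partialSum w j < Γ) ∧ w ∈ staysIn K x m}

lemma measurableSet_reach {K : Set ℝ} (hK : MeasurableSet K) (Γ x : ℝ) :
    MeasurableSet (reach K Γ x) := by
  unfold reach staysIn; measurability

lemma measurableSet_reach_prod {K : Set ℝ} (hK : MeasurableSet K) (Γ : ℝ) :
    MeasurableSet {p : ℝ × (ℕ → ℝ) | p.2 ∈ reach K Γ p.1} := by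
  have h : ∀ j, Measurable fun p : ℝ × (ℕ → ℝ) => p.1 + partialSum p.2 j := fun j => by fun_prop
  have : {p : ℝ × (ℕ → ℝ) | p.2 ∈ reach K Γ p.1} = ⋃ n, ({p | Γ ≤ p.1 + partialSum p.2 n} ∩
      ⋂ j, ⋂ (_ : 1 ≤ j), ⋂ (_ : j ≤ n), {p | p.1 + partialSum p.2 j ∈ K}) := by
    ext p; simp [reach, staysIn]
  rw [this]
  exact MeasurableSet.iUnion fun n => (measurableSet_le measurable_const (h n)).inter
    (MeasurableSet.iInter fun j => MeasurableSet.iInter fun _ => MeasurableSet.iInter fun _ =>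
      h j hK)

lemma measurableSet_hit {K : Set ℝ} (hK : MeasurableSet K) (Γ x : ℝ) (m : ℕ) :
    MeasurableSet (hit K Γ x m) := by
  unfold hit staysIn; measurability

lemma dependsOn_hit (K : Set ℝ) (Γ x : ℝ) (m : ℕ) :
    DependsOn (fun w => w ∈ hit K Γ x m) (Set.Iio m) := by
  refine dependsOn_of_partialSum fun w w' h => ?_
  simp only [hit, staysIn, Set.mem_ofPred_eq]
  grind

lemma dependsOn_staysIn (A : Set ℝ) (x : ℝ) (m : ℕ) :
    DependsOn (fun w => w ∈ staysIn A x m) (Set.Iio m) := by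
  refine dependsOn_of_partialSum fun w w' h => ?_
  simp only [staysIn, Set.mem_ofPred_eq]
  grind

lemma dependsOn_ladder (A : Set ℝ) (m : ℕ) :
    DependsOn (fun w => w ∈ ladder A m) (Set.Iio m) := by
  refine dependsOn_of_partialSum fun w w' h => ?_
  simp only [ladder, Set.mem_ofPred_eq]
  grind

lemma hit_disjoint (K : Set ℝ) (Γ x : ℝ) : Pairwise (Function.onFun Disjoint (hit K Γ x)) := by
  intro i j hij
  refine Set.disjoint_left.2 fun w hi hj => ?_
  rcases lt_or_gt_of_ne hij with h | h
  · exact absurd hi.1 (not_le.2 (hj.2.1 i h))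
  · exact absurd hj.1 (not_le.2 (hi.2.1 j h))

/-- The constraint concerns only times up to the one at which Γ is exceeded, so it survives when
that time is moved back to the first passage. -/
lemma reach_eq_iUnion_hit (K : Set ℝ) (Γ x : ℝ) : reach K Γ x = ⋃ m, hit K Γ x m := by
  classical
  ext w
  rw [Set.mem_iUnion]
  constructor
  · rintro ⟨n, hn, hs⟩
    have hex : ∃ n, Γ ≤ x + partialSum w n := ⟨n, hn⟩
    refine ⟨Nat.find hex, Nat.find_spec hex, fun j hj => not_le.1 (Nat.find_min hex hj), ?_⟩
    exact fun j h1 h2 => hs j h1 (h2.trans (Nat.find_min' hex hn))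
  · rintro ⟨m, h1, -, h3⟩
    exact ⟨m, h1, h3⟩

lemma reach_anti {K : Set ℝ} {Γ Γ' x : ℝ} (h : Γ ≤ Γ') : reach K Γ' x ⊆ reach K Γ x :=
  fun _ ⟨n, h1, h2⟩ => ⟨n, h.trans h1, h2⟩

/-- Markov property of the event `reach` at a time before the level `Γ` is reached. -/
lemma mem_reach_iff {K : Set ℝ} {Γ x : ℝ} {N : ℕ} {w : ℕ → ℝ}
    (h : ∀ j < N, x + partialSum w j < Γ) :
    w ∈ reach K Γ x ↔ w ∈ staysIn K x N ∧ shiftSeq N w ∈ reach K Γ (x + partialSum w N) := by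
  constructor
  · rintro ⟨n, hn, hs⟩
    have hNn : N ≤ n := by
      by_contra hlt
      exact absurd hn (not_le.2 (h n (by omega)))
    refine ⟨fun j h1 h2 => hs j h1 (by omega), n - N, ?_, fun j h1 h2 => ?_⟩
    · rw [partialSum_shiftSeq, Nat.add_sub_cancel' hNn]; linarith
    · rw [partialSum_shiftSeq]
      have := hs (N + j) (by omega) (by omega)
      convert this using 1; ring
  · rintro ⟨h1, n, hn, hs⟩
    refine ⟨N + n, ?_, fun j hj hjn => ?_⟩
    · rw [partialSum_shiftSeq] at hn; linarith
    · rcases Nat.lt_or_ge N j with h' | h'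
      · have := hs (j - N) (by omega) (by omega)
        rw [partialSum_shiftSeq, Nat.add_sub_cancel' h'.le] at this
        convert this using 1; ring
      · exact h1 j hj h'

section
variable (ν : Measure ℝ) [IsProbabilityMeasure ν]

/-- The probability that the walk started at `x` reaches `[Γ, ∞)` before leaving `K`. -/
noncomputable def reachProb (K : Set ℝ) (Γ x : ℝ) : ℝ≥0∞ := iid ν (reach K Γ x)

/-- The harmonic function of the walk killed outside `K`, normalised to be `1` at `0`. -/
noncomputable def potential (K : Set ℝ) (x : ℝ) : ℝ≥0∞ :=
  1 + ∑' n, iid ν (ladder Kᶜ (n + 1) ∩ {w | partialSum w (n + 1) ∈ {y | x + y ∈ K}})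

lemma measurable_reachProb {K : Set ℝ} (hK : MeasurableSet K) (Γ : ℝ) :
    Measurable (reachProb ν K Γ) :=
  measurable_measure_prodMk_left (measurableSet_reach_prod hK Γ)

lemma measurableSet_add_mem {K : Set ℝ} (hK : MeasurableSet K) (x : ℝ) :
    MeasurableSet {y | x + y ∈ K} := by measurability

lemma measurableSet_partialSum_mem {B : Set ℝ} (hB : MeasurableSet B) (n : ℕ) :
    MeasurableSet {w : ℕ → ℝ | partialSum w n ∈ B} := measurable_partialSum n hB

lemma one_le_potential (K : Set ℝ) (x : ℝ) : 1 ≤ potential ν K x := le_self_add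

lemma potential_mono {K : Set ℝ} (hK : IsHalfLine K) : Monotone (potential ν K) := by
  intro x y hxy
  refine add_le_add_right (ENNReal.tsum_le_tsum fun n => measure_mono ?_) _
  rintro w ⟨h1, h2⟩
  exact ⟨h1, hK.mem_of_le h2 (by gcongr)⟩

lemma potential_eq_tsum {K : Set ℝ} {x : ℝ} (hx : x ∈ K) :
    potential ν K x = ∑' n, iid ν (ladder Kᶜ n ∩ {w | partialSum w n ∈ {y | x + y ∈ K}}) := by
  rw [tsum_eq_zero_add' (f := fun n =>
    iid ν (ladder Kᶜ n ∩ {w | partialSum w n ∈ {y | x + y ∈ K}})) ENNReal.summable]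
  have : ladder Kᶜ 0 ∩ {w | partialSum w 0 ∈ {y | x + y ∈ K}} = Set.univ := by
    ext w; simp [ladder, hx]
  rw [this, measure_univ, potential]

/-- At a positive ladder time S_n is outside `K`, by comparison with time 0, so only the leading 1
survives. That term is kept separate because for `K = (0, ∞)` the starting point 0 is not in `K`. -/
lemma potential_zero {K : Set ℝ} : potential ν K 0 = 1 := by
  rw [potential]
  have : ∀ n, ladder Kᶜ (n + 1) ∩ {w : ℕ → ℝ | partialSum w (n + 1) ∈ {y | 0 + y ∈ K}} = ∅ := by
    intro n
    ext w
    simp only [Set.mem_inter_iff, Set.mem_ofPred_eq, zero_add, Set.mem_empty_iff_false, iff_false,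
      not_and]
    intro h
    simpa using h 0 (by omega)
  rw [tsum_congr fun n => by rw [this n]]
  simp

lemma renewalStrict_eq {x : ℝ} (hx : x ∈ Set.Ici (0 : ℝ)) :
    renewalStrict ν x = potential ν (Set.Ici 0) x := by
  rw [potential_eq_tsum ν hx, renewalStrict]
  refine tsum_congr fun n => congrArg _ ?_
  ext w
  simp only [ladder, Set.mem_ofPred_eq, Set.mem_inter_iff, Set.mem_compl_iff, Set.mem_Ici, not_le,
    sub_neg, neg_le_iff_add_nonneg']

/-- The restriction to positive x matters: at 0 the renewal function vanishes while the potential is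
1. The indicator in the Doob kernel hides the difference. -/
lemma renewalWeak_eq {x : ℝ} (hx : x ∈ Set.Ioi (0 : ℝ)) :
    renewalWeak ν x = potential ν (Set.Ioi 0) x := by
  rw [potential_eq_tsum ν hx, renewalWeak]
  refine tsum_congr fun n => congrArg _ ?_
  ext w
  simp only [ladder, Set.mem_ofPred_eq, Set.mem_inter_iff, Set.mem_compl_iff, Set.mem_Ioi, not_lt,
    sub_nonpos, neg_lt_iff_pos_add']

variable {ν}

/-- The potential grows slower than any exponential. -/
lemma exists_potential_le (ho : Oscillates ν) {K : Set ℝ} (hK : IsHalfLine K) {l : ℝ}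
    (hl : 0 < l) : ∃ C : ℝ≥0∞, C ≠ ∞ ∧ ∀ x, 0 ≤ x → potential ν K x ≤ C * expE (l * x) := by
  -- Exponential Markov inequality: x + S_n ≥ 0 allows the factor exp(l (x + S_n)) to be inserted,
  -- and the ladder renewal measure has finite exponential moments.
  have hfin := tsum_lintegral_ladder_lt_top ν (A := Kᶜ) hK.measurableSet.compl l
    (fun x hx => mul_nonpos_of_nonneg_of_nonpos hl.le (hK.nonpos hx))
    (lt_of_lt_of_le ho.measure_Iio_pos (measure_mono fun x hx =>
      ⟨fun h => absurd (hK.nonneg h) (not_le.2 hx), mul_neg_of_pos_of_neg hl hx⟩))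
  refine ⟨1 + ∑' n, ∫⁻ w in ladder Kᶜ n, expE (l * partialSum w n) ∂(iid ν),
    (ENNReal.add_lt_top.2 ⟨by simp, hfin⟩).ne, fun x hx => ?_⟩
  rw [potential, add_mul]
  refine add_le_add ?_ ?_
  · simpa using one_le_expE (by positivity)
  · rw [← ENNReal.tsum_mul_right]
    refine le_trans (ENNReal.tsum_le_tsum fun n => ?_)
      (ENNReal.tsum_comp_le_tsum_of_injective (add_left_injective 1) _)
    rw [← lintegral_mul_const _ (by fun_prop),
      ← lintegral_indicator (measurableSet_ladder hK.measurableSet.compl _),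
      ← lintegral_indicator_one ((measurableSet_ladder hK.measurableSet.compl _).inter
        (measurableSet_partialSum_mem (measurableSet_add_mem hK.measurableSet x) _))]
    refine lintegral_mono fun w => ?_
    by_cases hw : w ∈ ladder Kᶜ (n + 1) ∩
        {w | partialSum w (n + 1) ∈ {y | x + y ∈ K}}
    · rw [Set.indicator_of_mem hw, Set.indicator_of_mem hw.1, ← expE_add]
      refine one_le_expE ?_
      have := hK.nonneg hw.2
      nlinarith
    · rw [Set.indicator_of_notMem hw]; exact zero_le

lemma potential_ne_top (ho : Oscillates ν) {K : Set ℝ} (hK : IsHalfLine K) (x : ℝ) :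
    potential ν K x ≠ ∞ := by
  obtain ⟨C, hC, h⟩ := exists_potential_le ho hK one_pos
  have h1 : potential ν K x ≤ potential ν K (max x 0) := potential_mono ν hK (le_max_left _ _)
  exact ne_top_of_le_ne_top (ENNReal.mul_ne_top hC (expE_ne_top _))
    (h1.trans (h _ (le_max_right _ _)))

/-- The potential is harmonic for the walk killed outside `K`. -/
lemma lintegral_potential (ho : Oscillates ν) {K : Set ℝ} (hK : IsHalfLine K) {x : ℝ}
    (hx : 0 ≤ x) : ∫⁻ y, K.indicator (potential ν K) (x + y) ∂ν = potential ν K x := by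
  have hKm := hK.measurableSet
  -- After time reversal, the n-th term of the potential at x + y, averaged over a step y appended
  -- at the end, is the probability of `E n`. Then either the path is still outside `K` at time n +
  -- 1 (`U n`, the next term of the potential at x), or it enters `K` for the first time (`D n`).
  let E : ℕ → Set (ℕ → ℝ) := fun n => staysIn Kᶜ 0 n ∩
    {w | x + w n ∈ K ∧ x + partialSum w (n + 1) ∈ K}
  let U : ℕ → Set (ℕ → ℝ) := fun n => staysIn Kᶜ 0 (n + 1) ∩
    {w | partialSum w (n + 1) ∈ {y | x + y ∈ K}}
  let D : ℕ → Set (ℕ → ℝ) := fun n => staysIn Kᶜ 0 n ∩ {w | partialSum w (n + 1) ∈ K}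
  have hUm : ∀ n, MeasurableSet (U n) := fun n => (measurableSet_staysIn hKm.compl _ _).inter
    (measurableSet_partialSum_mem (measurableSet_add_mem hKm x) _)
  have hDm : ∀ n, MeasurableSet (D n) := fun n => (measurableSet_staysIn hKm.compl _ _).inter
    (measurableSet_partialSum_mem hKm _)
  have hUD : ∀ n, Disjoint (U n) (D n) := fun n => Set.disjoint_left.2 fun w h1 h2 => by
    have := h1.1 (n + 1) (by omega) le_rfl
    rw [zero_add] at this
    exact this h2.2
  have hEUD : ∀ n, E n = U n ∪ D n := by
    intro n
    ext w
    have hs : w ∈ staysIn Kᶜ 0 n → partialSum w n ≤ 0 := by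
      intro h
      rcases Nat.eq_zero_or_pos n with rfl | hn
      · simp
      · have := h n hn le_rfl
        rw [zero_add] at this
        exact hK.nonpos this
    have hsucc := partialSum_succ w n
    constructor
    · rintro ⟨h1, h2, h3⟩
      by_cases h : partialSum w (n + 1) ∈ K
      · exact Or.inr ⟨h1, h⟩
      · refine Or.inl ⟨fun j hj hjn => ?_, h3⟩
        rcases Nat.lt_or_ge n j with h' | h'
        · rwa [show j = n + 1 by omega, zero_add]
        · exact h1 j hj h'
    · rintro (⟨h1, h2⟩ | ⟨h1, h2⟩)
      · have h1' : w ∈ staysIn Kᶜ 0 n := fun j hj hjn => h1 j hj (by omega)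
        exact ⟨h1', hK.mem_of_le h2 (by linarith [hs h1']), h2⟩
      · refine ⟨h1, hK.mem_of_le h2 (by linarith [hs h1]), hK.mem_of_le h2 (by linarith)⟩
  -- Oscillation makes the entrance into `K` certain; this total mass is the leading 1 of the
  -- potential.
  have hD : ∑' n, iid ν (D n) = 1 := by
    rw [← measure_iUnion _ hDm]
    · refine le_antisymm prob_le_one ?_
      rw [← measure_univ (μ := iid ν)]
      refine measure_mono_ae ?_
      filter_upwards [ho.1] with w hw _
      classical
      obtain ⟨n, hn⟩ := hw 1
      have hex : ∃ n, 1 ≤ n ∧ partialSum w n ∈ K := by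
        refine ⟨n, Nat.one_le_iff_ne_zero.2 fun h => ?_, hK.mem_of_pos (by linarith)⟩
        rw [h, partialSum_zero] at hn; linarith
      obtain ⟨h1, h2⟩ := Nat.find_spec hex
      refine Set.mem_iUnion.2 ⟨Nat.find hex - 1, fun j hj hjn => ?_, ?_⟩
      · rw [zero_add]
        exact fun h => Nat.find_min hex (m := j) (by omega) ⟨hj, h⟩
      · show partialSum w _ ∈ K
        rwa [Nat.sub_add_cancel h1]
    · intro i j hij
      refine Set.disjoint_left.2 fun w hi hj => ?_
      rcases lt_or_gt_of_ne hij with h | h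
      · have := hj.1 (i + 1) (by omega) (by omega)
        rw [zero_add] at this
        exact this hi.2
      · have := hi.1 (j + 1) (by omega) (by omega)
        rw [zero_add] at this
        exact this hj.2
  have hstep : ∀ n, ∫⁻ y, {y | x + y ∈ K}.indicator
      (fun y => iid ν (staysIn Kᶜ 0 n ∩ {w | partialSum w n ∈ {z | (x + y) + z ∈ K}})) y ∂ν =
      iid ν (E n) := by
    intro n
    have hEm : MeasurableSet (E n) := by rw [hEUD]; exact (hUm n).union (hDm n)
    let F : (ℕ → ℝ) → ℝ → ℝ≥0∞ := fun w y =>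
      (staysIn Kᶜ 0 n).indicator 1 w * {p : ℝ × ℝ | x + p.2 ∈ K ∧ x + (p.1 + p.2) ∈ K}.indicator 1
        (partialSum w n, y)
    have hpm : MeasurableSet {p : ℝ × ℝ | x + p.2 ∈ K ∧ x + (p.1 + p.2) ∈ K} := by
      have h1 : Measurable fun p : ℝ × ℝ => x + p.2 := by fun_prop
      have h2 : Measurable fun p : ℝ × ℝ => x + (p.1 + p.2) := by fun_prop
      exact (h1 hKm).inter (h2 hKm)
    have hF : Measurable (Function.uncurry F) := by
      refine Measurable.mul ?_ ?_
      · exact (measurable_one.indicator (measurableSet_staysIn hKm.compl 0 n)).comp measurable_fst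
      · exact (measurable_one.indicator hpm).comp (by fun_prop)
    have e1 : iid ν (E n) = ∫⁻ w, F w (shiftSeq n w 0) ∂(iid ν) := by
      rw [← lintegral_indicator_one hEm]
      refine lintegral_congr fun w => ?_
      have : partialSum w n + shiftSeq n w 0 = partialSum w (n + 1) := by
        rw [partialSum_succ]; rfl
      have e0 : shiftSeq n w 0 = w n := rfl
      by_cases h1 : w ∈ staysIn Kᶜ 0 n
      · by_cases h2 : x + w n ∈ K ∧ x + partialSum w (n + 1) ∈ K
        · have : (partialSum w n, w n) ∈ {p : ℝ × ℝ | x + p.2 ∈ K ∧ x + (p.1 + p.2) ∈ K} :=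
            ⟨h2.1, by rw [← partialSum_succ]; exact h2.2⟩
          simp only [F, e0]
          rw [Set.indicator_of_mem (show w ∈ E n from ⟨h1, h2⟩), Set.indicator_of_mem h1,
            Set.indicator_of_mem this]
          simp
        · have : (partialSum w n, w n) ∉ {p : ℝ × ℝ | x + p.2 ∈ K ∧ x + (p.1 + p.2) ∈ K} :=
            fun h => h2 ⟨h.1, by rw [partialSum_succ]; exact h.2⟩
          simp only [F, e0]
          rw [Set.indicator_of_notMem (fun h => h2 h.2), Set.indicator_of_notMem this, mul_zero]
      · simp only [F]
        rw [Set.indicator_of_notMem (fun h => h1 h.1), Set.indicator_of_notMem h1, zero_mul]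
    rw [e1]
    let X : (ℕ → ℝ) → (ℝ≥0∞ × ℝ) := fun w => ((staysIn Kᶜ 0 n).indicator 1 w, partialSum w n)
    have e2 := lintegral_shiftSeq_param ν n (X := X)
      (F := fun X w' => X.1 * {p : ℝ × ℝ | x + p.2 ∈ K ∧ x + (p.1 + p.2) ∈ K}.indicator 1
        (X.2, w' 0))
      ((measurable_one.indicator (measurableSet_staysIn hKm.compl 0 n)).prodMk
        (measurable_partialSum n))
      (Measurable.mul (by fun_prop) ((measurable_one.indicator hpm).comp (by fun_prop)))
      (by
        intro w w' h
        simp only [X]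
        rw [dependsOn_indicator (f := 1) (dependsOn_staysIn Kᶜ 0 n) (fun _ _ _ => rfl) h,
          partialSum_congr h le_rfl])
    have e3 : ∀ w, ∫⁻ w', F w (w' 0) ∂(iid ν) = ∫⁻ y, F w y ∂ν := fun w =>
      lintegral_eval ν 0 (hF.comp (by fun_prop : Measurable fun y : ℝ => (w, y)))
    calc _ = ∫⁻ y, ∫⁻ w, F w y ∂(iid ν) ∂ν := by
          refine lintegral_congr fun y => ?_
          have hm : MeasurableSet (staysIn Kᶜ 0 n ∩
              {w | partialSum w n ∈ {z | (x + y) + z ∈ K}}) :=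
            (measurableSet_staysIn hKm.compl _ _).inter
              (measurableSet_partialSum_mem (measurableSet_add_mem hKm _) _)
          by_cases hy : x + y ∈ K
          · rw [Set.indicator_of_mem (show y ∈ {y | x + y ∈ K} from hy),
              ← lintegral_indicator_one hm]
            refine lintegral_congr fun w => ?_
            have e : x + y + partialSum w n = x + (partialSum w n + y) := by ring
            by_cases h1 : w ∈ staysIn Kᶜ 0 n
            · by_cases h2 : x + y + partialSum w n ∈ K
              · have h3 : (partialSum w n, y) ∈
                    {p : ℝ × ℝ | x + p.2 ∈ K ∧ x + (p.1 + p.2) ∈ K} := ⟨hy, e ▸ h2⟩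
                simp only [F]
                rw [Set.indicator_of_mem h1, Set.indicator_of_mem h3,
                  Set.indicator_of_mem (Set.mem_inter h1 h2)]
                simp
              · have h3 : (partialSum w n, y) ∉
                    {p : ℝ × ℝ | x + p.2 ∈ K ∧ x + (p.1 + p.2) ∈ K} := fun h => h2 (e ▸ h.2)
                simp only [F]
                rw [Set.indicator_of_notMem h3, Set.indicator_of_notMem fun h => h2 h.2, mul_zero]
            · simp only [F]
              rw [Set.indicator_of_notMem h1, Set.indicator_of_notMem fun h => h1 h.1, zero_mul]
          · rw [Set.indicator_of_notMem (show y ∉ {y | x + y ∈ K} from hy)]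
            simp [F, hy]
      _ = ∫⁻ w, ∫⁻ y, F w y ∂ν ∂(iid ν) :=
          lintegral_lintegral_swap (hF.comp measurable_swap).aemeasurable
      _ = ∫⁻ w, F w (shiftSeq n w 0) ∂(iid ν) := by
          simp_rw [← e3]
          exact e2.symm
  have hpot : ∀ y, potential ν K y = 1 + ∑' n, iid ν (staysIn Kᶜ 0 (n + 1) ∩
      {w | partialSum w (n + 1) ∈ {z | y + z ∈ K}}) := by
    intro y
    rw [potential]
    congr 1
    exact tsum_congr fun n => (measure_staysIn_eq_ladder ν hKm.compl
      (measurableSet_add_mem hKm y) (n + 1)).symm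
  have hpot' : ∀ y, K.indicator (potential ν K) (x + y) = ∑' n, {y | x + y ∈ K}.indicator
      (fun y => iid ν (staysIn Kᶜ 0 n ∩ {w | partialSum w n ∈ {z | (x + y) + z ∈ K}})) y := by
    intro y
    by_cases hy : x + y ∈ K
    · simp only [Set.indicator_of_mem hy, Set.indicator_of_mem (show y ∈ {y | x + y ∈ K} from hy)]
      rw [hpot, tsum_eq_zero_add' (f := fun n => iid ν (staysIn Kᶜ 0 n ∩
        {w | partialSum w n ∈ {z | (x + y) + z ∈ K}})) ENNReal.summable]
      have : staysIn Kᶜ 0 0 ∩ {w | partialSum w 0 ∈ {z | x + y + z ∈ K}} = Set.univ := by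
        ext w
        simp only [staysIn, Set.mem_inter_iff, Set.mem_ofPred_eq, partialSum_zero, add_zero,
          hy, and_true, Set.mem_univ, iff_true]
        intro j h1 h2; omega
      rw [this, measure_univ]
    · simp [hy]
  simp_rw [hpot']
  rw [lintegral_tsum, tsum_congr hstep, hpot, add_comm, ← hD, ← ENNReal.tsum_add]
  · refine tsum_congr fun n => ?_
    rw [hEUD, measure_union (hUD n) (hDm n)]
  · intro n
    refine Measurable.aemeasurable (Measurable.indicator ?_ (measurableSet_add_mem hKm x))
    refine measurable_measure_prodMk_left (s := {p : ℝ × (ℕ → ℝ) | p.2 ∈ staysIn Kᶜ 0 n ∧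
      (x + p.1) + partialSum p.2 n ∈ K}) ?_
    have h1 : Measurable fun p : ℝ × (ℕ → ℝ) => (x + p.1) + partialSum p.2 n := by fun_prop
    exact (measurable_snd (measurableSet_staysIn hKm.compl 0 n)).inter (h1 hKm)

end

/-! ### Asymptotics of the probability to reach a high level -/

/-- Lower semicontinuity of series with nonnegative terms: a finite partial sum already exceeds `a`.
-/
lemma eventually_lt_tsum {α : Type*} {l : Filter α} {f : ℕ → α → ℝ≥0∞} {g : ℕ → ℝ≥0∞}
    (h : ∀ n, Tendsto (f n) l (𝓝 (g n))) {a : ℝ≥0∞} (ha : a < ∑' n, g n) :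
    ∀ᶠ x in l, a < ∑' n, f n x := by
  rw [ENNReal.tsum_eq_iSup_sum, lt_iSup_iff] at ha
  obtain ⟨s, hs⟩ := ha
  have : Tendsto (fun x => ∑ n ∈ s, f n x) l (𝓝 (∑ n ∈ s, g n)) :=
    tendsto_finsetSum s fun n _ => h n
  filter_upwards [this.eventually (lt_mem_nhds hs)] with x hx
  exact hx.trans_le (ENNReal.sum_le_tsum s)

section
variable (ν : Measure ℝ) [IsProbabilityMeasure ν]

lemma reachProb_anti (K : Set ℝ) (x : ℝ) : Antitone fun Γ => reachProb ν K Γ x :=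
  fun _ _ h => measure_mono (reach_anti h)

lemma reachProb_le_one (K : Set ℝ) (Γ x : ℝ) : reachProb ν K Γ x ≤ 1 := prob_le_one

lemma tsum_measure_hit {K : Set ℝ} (hK : IsHalfLine K) (Γ x : ℝ) :
    ∑' m, iid ν (hit K Γ x m) = reachProb ν K Γ x := by
  rw [reachProb, reach_eq_iUnion_hit,
    measure_iUnion (hit_disjoint K Γ x) (measurableSet_hit hK.measurableSet Γ x)]

/-- Upper bound by decomposition at the minimum of the path. -/
lemma reachProb_le_potential_mul {K : Set ℝ} (hK : IsHalfLine K) (Γ : ℝ) {x : ℝ}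
    (hx : x ∈ K ∨ x = 0) :
    reachProb ν K Γ x ≤ potential ν K x * reachProb ν K (Γ - x) 0 := by
  rcases hx with hx | rfl
  swap
  · rw [potential_zero, sub_zero, one_mul]
  have hKm := hK.measurableSet
  let G : ℕ → Set (ℕ → ℝ) := fun n => ladder Kᶜ n ∩ {w | partialSum w n ∈ {y | x + y ∈ K}}
  have hGm : ∀ n, MeasurableSet (G n) := fun n => (measurableSet_ladder hKm.compl n).inter
    (measurableSet_partialSum_mem (measurableSet_add_mem hKm x) n)
  -- Seen from its minimum, the rest of the path stays in `K`, and since the minimum is at most 0 it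
  -- climbs by at least Γ - x from there.
  have hsub : reach K Γ x ⊆ ⋃ n, G n ∩ shiftSeq n ⁻¹' reach K (Γ - x) 0 := by
    rintro w ⟨N, hN, hs⟩
    obtain ⟨n, hnN, h1, h2⟩ := hK.exists_argmin (partialSum w) N
    refine Set.mem_iUnion.2 ⟨n, ⟨h1, ?_⟩, N - n, ?_, fun j hj hjn => ?_⟩
    · show x + partialSum w n ∈ K
      rcases Nat.eq_zero_or_pos n with rfl | hn
      · simpa using hx
      · exact hs n hn hnN
    · rw [partialSum_shiftSeq, Nat.add_sub_cancel' hnN]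
      have : partialSum w n ≤ 0 := by
        rcases Nat.eq_zero_or_pos n with rfl | hn
        · simp
        · have := hK.nonpos (h1 0 hn)
          simpa using this
      linarith
    · rw [partialSum_shiftSeq, zero_add]
      exact h2 _ (by omega) (by omega)
  refine (measure_mono hsub).trans ((measure_iUnion_le _).trans ?_)
  rw [potential_eq_tsum ν hx, ← ENNReal.tsum_mul_right]
  refine ENNReal.tsum_le_tsum fun n => le_of_eq ?_
  rw [measure_inter_shiftSeq ν n (hGm n) (measurableSet_reach hKm _ _)]
  · rfl
  · refine dependsOn_of_partialSum fun w w' h => ?_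
    simp only [G, ladder, Set.mem_inter_iff, Set.mem_ofPred_eq]
    grind

/-- Lower bound by decomposition at the minimum of the path. -/
lemma tsum_mul_reachProb_le {K : Set ℝ} (hK : IsHalfLine K) (Γ : ℝ) (x : ℝ) :
    (∑' n, iid ν ((ladder Kᶜ n ∩ {w | partialSum w n ∈ {y | x + y ∈ K}}) ∩
      {w | ∀ j ≤ n, x + partialSum w j < Γ})) * reachProb ν K Γ 0 ≤ reachProb ν K Γ x := by
  have hKm := hK.measurableSet
  let G : ℕ → Set (ℕ → ℝ) := fun n => (ladder Kᶜ n ∩ {w | partialSum w n ∈ {y | x + y ∈ K}}) ∩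
      {w | ∀ j ≤ n, x + partialSum w j < Γ}
  have hGm : ∀ n, MeasurableSet (G n) := fun n => by
    refine ((measurableSet_ladder hKm.compl n).inter
      (measurableSet_partialSum_mem (measurableSet_add_mem hKm x) n)).inter ?_
    measurability
  let H : ℕ → Set (ℕ → ℝ) := fun n => G n ∩ shiftSeq n ⁻¹' reach K Γ 0
  have hHm : ∀ n, MeasurableSet (H n) := fun n =>
    (hGm n).inter (measurable_shiftSeq n (measurableSet_reach hKm _ _))
  have hH : ∀ n, iid ν (H n) = iid ν (G n) * reachProb ν K Γ 0 := by
    intro n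
    rw [measure_inter_shiftSeq ν n (hGm n) (measurableSet_reach hKm _ _)]
    · rfl
    · refine dependsOn_of_partialSum fun w w' h => ?_
      simp only [G, ladder, Set.mem_inter_iff, Set.mem_ofPred_eq]
      grind
  -- For two such times m < n, either the climb from m is still in progress at time n, so n is not a
  -- ladder time, or it has already passed Γ, against the constraint in `G n`.
  have hdisj : Pairwise (Function.onFun Disjoint H) := by
    have key : ∀ m n w, m < n → w ∈ H m → w ∈ H n → False := by
      rintro m n w hmn ⟨⟨⟨-, hm⟩, -⟩, k, hk, hs⟩ ⟨⟨⟨hl, -⟩, hlt⟩, -⟩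
      have hm : 0 ≤ x + partialSum w m := hK.nonneg hm
      simp only [partialSum_shiftSeq, zero_add, staysIn, Set.mem_ofPred_eq] at hk hs
      rcases Nat.lt_or_ge n (m + k) with h | h
      · have := hs (n - m) (by omega) (by omega)
        rw [Nat.add_sub_cancel' hmn.le] at this
        exact hl m hmn this
      · have h1 := hlt (m + k) h
        linarith
    intro m n hmn
    refine Set.disjoint_left.2 fun w hm hn => ?_
    rcases lt_or_gt_of_ne hmn with h | h
    · exact key m n w h hm hn
    · exact key n m w h hn hm
  have hsub : (⋃ n, H n) ⊆ reach K Γ x := by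
    intro w hw
    obtain ⟨n, ⟨⟨hl, hn⟩, -⟩, k, hk, hs⟩ := Set.mem_iUnion.1 hw
    have hn : x + partialSum w n ∈ K := hn
    rw [partialSum_shiftSeq] at hk
    have h0 := hK.nonneg hn
    refine ⟨n + k, by linarith, fun j hj hjn => ?_⟩
    rcases lt_trichotomy j n with h | rfl | h
    · exact hK.mem_of_le hn (by linarith [hK.nonpos (hl j h)])
    · exact hn
    · have := hs (j - n) (by omega) (by omega)
      rw [partialSum_shiftSeq, Nat.add_sub_cancel' h.le, zero_add] at this
      exact hK.mem_of_le this (by linarith)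
  calc _ = ∑' n, iid ν (H n) := by
        rw [← ENNReal.tsum_mul_right]
        exact tsum_congr fun n => (hH n).symm
    _ = iid ν (⋃ n, H n) := (measure_iUnion hdisj hHm).symm
    _ ≤ _ := measure_mono hsub

/-- The walk rises by `x` before it falls by `a`. -/
def riseBefore (a x : ℝ) : Set (ℕ → ℝ) :=
  {w | ∃ n, x ≤ partialSum w n ∧ ∀ j ≤ n, -a < partialSum w j}

lemma measurableSet_riseBefore (a x : ℝ) : MeasurableSet (riseBefore a x) := by
  unfold riseBefore; measurability

/-- After the first passage above a, a rise by x before a fall by a keeps the walk positive and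
brings it above a + x. -/
lemma reachProb_mul_riseBefore_le {K : Set ℝ} (hK : IsHalfLine K) (a x : ℝ) :
    reachProb ν K a 0 * iid ν (riseBefore a x) ≤ reachProb ν K (a + x) 0 := by
  have hKm := hK.measurableSet
  rw [← tsum_measure_hit ν hK, ← ENNReal.tsum_mul_right]
  have e : ∀ m, iid ν (hit K a 0 m) * iid ν (riseBefore a x) =
      iid ν (hit K a 0 m ∩ shiftSeq m ⁻¹' riseBefore a x) := fun m =>
    (measure_inter_shiftSeq ν m (measurableSet_hit hKm _ _ _) (measurableSet_riseBefore _ _)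
      (dependsOn_hit K a 0 m)).symm
  rw [tsum_congr e, ← measure_iUnion]
  · refine measure_mono fun w hw => ?_
    obtain ⟨m, ⟨h1, h2, h3⟩, n, h4, h5⟩ := Set.mem_iUnion.1 hw
    rw [zero_add] at h1
    rw [partialSum_shiftSeq] at h4
    refine ⟨m + n, by linarith, fun j hj hjn => ?_⟩
    rcases Nat.lt_or_ge m j with h | h
    · have := h5 (j - m) (by omega)
      rw [partialSum_shiftSeq, Nat.add_sub_cancel' h.le] at this
      exact hK.mem_of_pos (by linarith)
    · exact h3 j hj h
  · exact fun i j hij => (hit_disjoint K a 0 hij).mono Set.inter_subset_left Set.inter_subset_left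
  · exact fun m => (measurableSet_hit hKm _ _ _).inter
      (measurable_shiftSeq m (measurableSet_riseBefore _ _))

variable {ν}

/-- A path unbounded above makes the rise at a finite time, up to which its minimum is finite. -/
lemma tendsto_measure_riseBefore (ho : Oscillates ν) (x : ℝ) :
    Tendsto (fun a => iid ν (riseBefore a x)) atTop (𝓝 1) := by
  have h : iid ν (⋃ a, riseBefore a x) = 1 := by
    refine le_antisymm prob_le_one ?_
    rw [← measure_univ (μ := iid ν)]
    refine measure_mono_ae ?_
    filter_upwards [ho.1] with w hw _
    obtain ⟨n, hn⟩ := hw x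
    refine Set.mem_iUnion.2 ⟨∑ j ∈ Finset.range (n + 1), |partialSum w j| + 1, n, hn,
      fun j hj => ?_⟩
    have h1 : |partialSum w j| ≤ ∑ j ∈ Finset.range (n + 1), |partialSum w j| :=
      Finset.single_le_sum (f := fun j => |partialSum w j|) (fun _ _ => abs_nonneg _)
        (Finset.mem_range.2 (by omega))
    have := neg_abs_le (partialSum w j)
    linarith
  rw [← h]
  exact tendsto_measure_iUnion_atTop fun a b hab w ⟨n, h1, h2⟩ =>
    ⟨n, h1, fun j hj => by linarith [h2 j hj]⟩

/-- Steps of size at least some d > 0 have positive probability, and enough of them in a row climb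
to Γ inside `K`. -/
lemma reachProb_pos (ho : Oscillates ν) {K : Set ℝ} (hK : IsHalfLine K) (Γ : ℝ) :
    0 < reachProb ν K Γ 0 := by
  obtain ⟨d, hd, hν⟩ : ∃ d : ℝ, 0 < d ∧ 0 < ν (Set.Ici d) := by
    by_contra hcon
    push Not at hcon
    have : Set.Ioi (0 : ℝ) ⊆ ⋃ n : ℕ, Set.Ici (1 / ((n : ℝ) + 1)) := by
      intro x hx
      obtain ⟨n, hn⟩ := exists_nat_one_div_lt (Set.mem_Ioi.1 hx)
      exact Set.mem_iUnion.2 ⟨n, hn.le⟩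
    have h0 : ν (⋃ n : ℕ, Set.Ici (1 / ((n : ℝ) + 1))) = 0 :=
      measure_iUnion_null fun n => nonpos_iff_eq_zero.1 (hcon _ (by positivity))
    exact absurd ho.measure_Ioi_pos (not_lt.2 (by rw [measure_mono_null this h0]))
  obtain ⟨n, hn⟩ := exists_nat_ge (Γ / d)
  have hsub : Set.pi (↑(Finset.range n)) (fun _ => Set.Ici d) ⊆ reach K Γ 0 := by
    intro w hw
    have hw' : ∀ i < n, d ≤ w i := fun i hi => hw i (by simpa using hi)
    have hS : ∀ k ≤ n, k * d ≤ partialSum w k := by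
      intro k hk
      have := Finset.card_nsmul_le_sum (Finset.range k) w d fun i hi =>
        hw' i (by have := Finset.mem_range.1 hi; omega)
      simpa [partialSum] using this
    refine ⟨n, ?_, fun j hj hjn => hK.mem_of_pos ?_⟩
    · rw [zero_add]
      exact ((div_le_iff₀ hd).1 hn).trans (hS n le_rfl)
    · rw [zero_add]
      refine lt_of_lt_of_le ?_ (hS j hjn)
      have : (0 : ℝ) < j := by exact_mod_cast hj
      positivity
  refine lt_of_lt_of_le ?_ (measure_mono hsub)
  rw [Measure.infinitePi_pi _ fun _ _ => measurableSet_Ici, Finset.prod_const]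
  exact ENNReal.pow_pos hν _

lemma reachProb_ne_zero (ho : Oscillates ν) {K : Set ℝ} (hK : IsHalfLine K) (Γ : ℝ) :
    reachProb ν K Γ 0 ≠ 0 := (reachProb_pos ho hK Γ).ne'

lemma reachProb_ne_top (K : Set ℝ) (Γ x : ℝ) : reachProb ν K Γ x ≠ ∞ := measure_ne_top _ _

/-- A path unbounded below leaves `K` at some time, and a level above all its earlier values has not
been reached by then. -/
lemma tendsto_reachProb_zero (ho : Oscillates ν) {K : Set ℝ} (hK : IsHalfLine K) :
    Tendsto (fun Γ => reachProb ν K Γ 0) atTop (𝓝 0) := by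
  have hlim : Tendsto (fun k : ℕ => reachProb ν K k 0) atTop (𝓝 (iid ν (⋂ k : ℕ, reach K k 0))) :=
    tendsto_measure_iInter_atTop
      (fun k => (measurableSet_reach hK.measurableSet _ _).nullMeasurableSet)
      (fun i j hij => reach_anti (by exact_mod_cast hij)) ⟨0, measure_ne_top _ _⟩
  have h0 : iid ν (⋂ k : ℕ, reach K k 0) = 0 := by
    rw [measure_eq_zero_iff_ae_notMem]
    filter_upwards [ho.2] with w hw hmem
    obtain ⟨n, hn⟩ := hw (-1)
    have hn1 : 1 ≤ n := by
      refine Nat.one_le_iff_ne_zero.2 fun h => ?_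
      rw [h, partialSum_zero] at hn; linarith
    obtain ⟨k, hk⟩ := exists_nat_gt (∑ j ∈ Finset.range n, |partialSum w j|)
    obtain ⟨N, hN, hs⟩ := Set.mem_iInter.1 hmem k
    rcases Nat.lt_or_ge N n with h | h
    · have h1 : |partialSum w N| ≤ ∑ j ∈ Finset.range n, |partialSum w j| :=
        Finset.single_le_sum (f := fun j => |partialSum w j|) (fun _ _ => abs_nonneg _)
          (Finset.mem_range.2 h)
      have := le_abs_self (partialSum w N)
      linarith
    · have := hK.nonneg (hs n hn1 h)
      linarith
  rw [h0] at hlim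
  refine tendsto_order.2 ⟨fun a ha => absurd ha not_lt_zero, fun a ha => ?_⟩
  obtain ⟨k, hk⟩ := ((tendsto_order.1 hlim).2 a ha).exists
  filter_upwards [eventually_ge_atTop (k : ℝ)] with Γ hΓ
  exact (reachProb_anti ν K 0 hΓ).trans_lt hk

/-- The probability to reach a level varies subexponentially with the level. -/
lemma exists_reachProb_le_mul (ho : Oscillates ν) {K : Set ℝ} (hK : IsHalfLine K) :
    ∃ C : ℝ≥0∞, C ≠ ∞ ∧ ∀ c y, 0 ≤ y →
      reachProb ν K c 0 ≤ C * expE y * reachProb ν K (c + y) 0 := by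
  -- The rate e^{-1} per unit of level is a choice: later the resulting factor e^x only has to be
  -- beaten by e^{-2x}.
  obtain ⟨Γ₀, hΓ₀⟩ := ((tendsto_order.1 (tendsto_measure_riseBefore ho 1)).1 (expE (-1))
    (expE_lt_one (by norm_num))).exists_forall_of_atTop
  have hee : ∀ z, expE z * expE (-z) = 1 := fun z => by rw [← expE_add]; simp
  have hstep : ∀ Γ, Γ₀ ≤ Γ → reachProb ν K Γ 0 ≤ expE 1 * reachProb ν K (Γ + 1) 0 := by
    intro Γ hΓ
    have h := (mul_le_mul_right (hΓ₀ Γ hΓ).le _).trans (reachProb_mul_riseBefore_le ν hK Γ 1)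
    calc reachProb ν K Γ 0 = expE 1 * (reachProb ν K Γ 0 * expE (-1)) := by
          rw [mul_left_comm, hee, mul_one]
      _ ≤ _ := mul_le_mul_right h _
  have hiter : ∀ k : ℕ, ∀ Γ, Γ₀ ≤ Γ → reachProb ν K Γ 0 ≤ expE k * reachProb ν K (Γ + k) 0 := by
    intro k
    induction k with
    | zero => intro Γ _; simp
    | succ k ih =>
      intro Γ hΓ
      refine (ih Γ hΓ).trans ?_
      have := hstep (Γ + k) (by have : (0 : ℝ) ≤ k := Nat.cast_nonneg k; linarith)
      rw [Nat.cast_succ, expE_add, mul_assoc, ← add_assoc]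
      exact mul_le_mul_right this _
  have hreal : ∀ y, 0 ≤ y → ∀ Γ, Γ₀ ≤ Γ →
      reachProb ν K Γ 0 ≤ expE 1 * expE y * reachProb ν K (Γ + y) 0 := by
    intro y hy Γ hΓ
    refine (hiter ⌈y⌉₊ Γ hΓ).trans ?_
    rw [← expE_add]
    refine mul_le_mul' (expE_mono ?_) (reachProb_anti ν K 0 ?_)
    · have := Nat.ceil_lt_add_one hy; linarith
    · have := Nat.le_ceil y; linarith
  have hq0 := reachProb_ne_zero ho hK Γ₀
  have hq1 : 1 ≤ (reachProb ν K Γ₀ 0)⁻¹ := ENNReal.one_le_inv.2 (reachProb_le_one ν K _ _)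
  refine ⟨(reachProb ν K Γ₀ 0)⁻¹ * expE 1,
    ENNReal.mul_ne_top (ENNReal.inv_ne_top.2 hq0) (expE_ne_top _), fun c y hy => ?_⟩
  rcases le_total Γ₀ c with h | h
  · refine (hreal y hy c h).trans ?_
    gcongr
    simpa using mul_le_mul_left hq1 (expE 1)
  -- Levels below `Γ₀` are handled by the trivial bound 1; the inverse of the probability at level
  -- `Γ₀` goes into the constant.
  · calc reachProb ν K c 0 ≤ 1 := reachProb_le_one ν K _ _
      _ = (reachProb ν K Γ₀ 0)⁻¹ * reachProb ν K Γ₀ 0 :=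
          (ENNReal.inv_mul_cancel hq0 (reachProb_ne_top K _ _)).symm
      _ ≤ (reachProb ν K Γ₀ 0)⁻¹ * (expE 1 * expE y * reachProb ν K (Γ₀ + y) 0) := by
          gcongr; exact hreal y hy Γ₀ le_rfl
      _ = (reachProb ν K Γ₀ 0)⁻¹ * expE 1 * expE y * reachProb ν K (Γ₀ + y) 0 := by ring
      _ ≤ _ := by gcongr; exact reachProb_anti ν K 0 (by linarith)

/-- Level Γ - x is traded for Γ at the price e^x. This dominates, uniformly in Γ, the ratio whose
limit is computed next. -/
lemma exists_reachProb_le (ho : Oscillates ν) {K : Set ℝ} (hK : IsHalfLine K) :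
    ∃ C : ℝ≥0∞, C ≠ ∞ ∧ ∀ Γ x, 0 ≤ x → (x ∈ K ∨ x = 0) →
      reachProb ν K Γ x ≤ C * expE x * potential ν K x * reachProb ν K Γ 0 := by
  obtain ⟨C, hC, h⟩ := exists_reachProb_le_mul ho hK
  refine ⟨C, hC, fun Γ x hx hxK => (reachProb_le_potential_mul ν hK Γ hxK).trans ?_⟩
  have := h (Γ - x) x hx
  rw [sub_add_cancel] at this
  calc _ ≤ potential ν K x * (C * expE x * reachProb ν K Γ 0) := by gcongr
    _ = _ := by ring

/-- The normalised probability to reach a high level converges to the potential. -/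
lemma tendsto_reachProb_div (ho : Oscillates ν) {K : Set ℝ} (hK : IsHalfLine K) {x : ℝ}
    (hx : x ∈ K ∨ x = 0) :
    Tendsto (fun Γ => reachProb ν K Γ x / reachProb ν K Γ 0) atTop (𝓝 (potential ν K x)) := by
  have hq0 := reachProb_ne_zero ho hK
  have hqt : ∀ Γ, reachProb ν K Γ 0 ≠ ∞ := fun Γ => reachProb_ne_top K Γ 0
  rcases hx with hx | rfl
  swap
  · rw [potential_zero]
    refine tendsto_const_nhds.congr fun Γ => (ENNReal.div_self (hq0 Γ) (hqt Γ)).symm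
  refine tendsto_order.2 ⟨fun a ha => ?_, fun a ha => ?_⟩
  -- Lower bound: the extra constraint of staying below Γ disappears term by term as Γ grows.
  · have hm : ∀ n, Tendsto (fun Γ => iid ν ((ladder Kᶜ n ∩
        {w | partialSum w n ∈ {y | x + y ∈ K}}) ∩ {w | ∀ j ≤ n, x + partialSum w j < Γ})) atTop
        (𝓝 (iid ν (ladder Kᶜ n ∩ {w | partialSum w n ∈ {y | x + y ∈ K}}))) := by
      intro n
      have e : ladder Kᶜ n ∩ {w | partialSum w n ∈ {y | x + y ∈ K}} =
          ⋃ Γ : ℝ, (ladder Kᶜ n ∩ {w | partialSum w n ∈ {y | x + y ∈ K}}) ∩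
            {w | ∀ j ≤ n, x + partialSum w j < Γ} := by
        rw [← Set.inter_iUnion]
        refine (Set.inter_eq_left.2 fun w _ => Set.mem_iUnion.2
          ⟨∑ j ∈ Finset.range (n + 1), |x + partialSum w j| + 1, fun j hj => ?_⟩).symm
        have h1 : |x + partialSum w j| ≤ ∑ j ∈ Finset.range (n + 1), |x + partialSum w j| :=
          Finset.single_le_sum (f := fun j => |x + partialSum w j|) (fun _ _ => abs_nonneg _)
            (Finset.mem_range.2 (by omega))
        have := le_abs_self (x + partialSum w j)
        linarith
      conv_rhs => rw [e]
      exact tendsto_measure_iUnion_atTop fun a b hab => Set.inter_subset_inter_right _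
        fun w hw j hj => (hw j hj).trans_le hab
    rw [potential_eq_tsum ν hx] at ha
    filter_upwards [eventually_lt_tsum hm ha] with Γ hΓ
    refine hΓ.trans_le ?_
    rw [ENNReal.le_div_iff_mul_le (Or.inl (hq0 Γ)) (Or.inl (hqt Γ))]
    exact tsum_mul_reachProb_le ν hK Γ x
  -- Upper bound: level Γ - x is replaced by Γ at the cost of the probability of rising by x before
  -- falling by Γ - x, which tends to 1.
  · have h1 : Tendsto (fun Γ => potential ν K x * (iid ν (riseBefore (Γ - x) x))⁻¹) atTop
        (𝓝 (potential ν K x * 1⁻¹)) := by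
      refine ENNReal.Tendsto.const_mul ?_ (Or.inl (by simp))
      exact ((tendsto_measure_riseBefore ho x).comp
        (tendsto_atTop_add_const_right atTop (-x) tendsto_id)).inv
    rw [inv_one, mul_one] at h1
    filter_upwards [(tendsto_order.1 h1).2 a ha, (tendsto_order.1 ((tendsto_measure_riseBefore ho
      x).comp (tendsto_atTop_add_const_right atTop (-x) tendsto_id))).1 0 one_pos] with Γ hΓ hpos
    refine lt_of_le_of_lt ?_ hΓ
    rw [ENNReal.div_le_iff (hq0 Γ) (hqt Γ)]
    refine (reachProb_le_potential_mul ν hK Γ (Or.inl hx)).trans ?_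
    rw [mul_assoc]
    gcongr
    have h2 := reachProb_mul_riseBefore_le ν hK (Γ - x) x
    rw [sub_add_cancel] at h2
    have hpos' : 0 < iid ν (riseBefore (Γ - x) x) := hpos
    rw [← ENNReal.div_eq_inv_mul, ENNReal.le_div_iff_mul_le (Or.inl hpos'.ne')
      (Or.inl (measure_ne_top _ _))]
    exact h2

/-- Markov property at a fixed time, on the event that the level `Γ` is reached later. -/
lemma lintegral_reach {K : Set ℝ} (hK : IsHalfLine K) (Γ x : ℝ) (N : ℕ) {F : (ℕ → ℝ) → ℝ≥0∞}
    (hF : Measurable F) (hd : DependsOn F (Set.Iio N))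
    (hlt : ∀ w, F w ≠ 0 → ∀ j < N, x + partialSum w j < Γ) :
    ∫⁻ w in reach K Γ x, F w ∂(iid ν) =
      ∫⁻ w in staysIn K x N, F w * reachProb ν K Γ (x + partialSum w N) ∂(iid ν) := by
  have hKm := hK.measurableSet
  have hsm := measurableSet_staysIn hKm x N
  let X : (ℕ → ℝ) → ℝ≥0∞ × ℝ := fun w => ((staysIn K x N).indicator F w, x + partialSum w N)
  let G : ℝ≥0∞ × ℝ → (ℕ → ℝ) → ℝ≥0∞ := fun p w' => p.1 * (reach K Γ p.2).indicator 1 w'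
  have hX : Measurable X := (hF.indicator hsm).prodMk (by fun_prop)
  have hG : Measurable (Function.uncurry G) := by
    refine Measurable.mul (by fun_prop) ?_
    have h1 : MeasurableSet {q : (ℝ≥0∞ × ℝ) × (ℕ → ℝ) | q.2 ∈ reach K Γ q.1.2} :=
      (show Measurable fun q : (ℝ≥0∞ × ℝ) × (ℕ → ℝ) => (q.1.2, q.2) by fun_prop)
        (measurableSet_reach_prod hKm Γ)
    exact (measurable_one (α := ℝ≥0∞)).indicator h1
  have hXd : DependsOn X (Set.Iio N) := by
    intro w w' h
    simp only [X]
    rw [dependsOn_indicator (dependsOn_staysIn K x N) hd h, partialSum_congr h le_rfl]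
  have key := lintegral_shiftSeq_param ν N hX hG hXd
  rw [← lintegral_indicator (measurableSet_reach hKm _ _), ← lintegral_indicator hsm]
  calc _ = ∫⁻ w, G (X w) (shiftSeq N w) ∂(iid ν) := by
        refine lintegral_congr fun w => ?_
        simp only [G, X]
        by_cases hw : F w = 0
        · have e1 : (reach K Γ x).indicator F w = 0 := by
            by_cases h : w ∈ reach K Γ x <;> simp [h, hw]
          have e2 : (staysIn K x N).indicator F w = 0 := by
            by_cases h : w ∈ staysIn K x N <;> simp [h, hw]
          rw [e1, e2, zero_mul]
        · have hiff := mem_reach_iff (K := K) (hlt w hw)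
          by_cases h1 : w ∈ staysIn K x N
          · by_cases h2 : shiftSeq N w ∈ reach K Γ (x + partialSum w N)
            · rw [Set.indicator_of_mem (hiff.2 ⟨h1, h2⟩), Set.indicator_of_mem h1,
                Set.indicator_of_mem h2]
              simp
            · rw [Set.indicator_of_notMem fun h => h2 (hiff.1 h).2, Set.indicator_of_notMem h2,
                mul_zero]
          · rw [Set.indicator_of_notMem fun h => h1 (hiff.1 h).1, Set.indicator_of_notMem h1,
              zero_mul]
    _ = _ := by
        rw [key]
        refine lintegral_congr fun w => ?_
        have hm := measurableSet_reach hKm Γ (x + partialSum w N)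
        simp only [G, X]
        rw [lintegral_const_mul _ (measurable_one.indicator hm), lintegral_indicator_one hm]
        by_cases h1 : w ∈ staysIn K x N
        · rw [Set.indicator_of_mem h1, Set.indicator_of_mem h1]; rfl
        · rw [Set.indicator_of_notMem h1, Set.indicator_of_notMem h1, zero_mul]

end

/-! ### Finite-dimensional laws of the conditioned walks -/

/-- The sequence equal to `s` up to time `N` and to `y` afterwards. -/
def extendSeq (N : ℕ) (s : ℕ → ℝ) (y : ℝ) : ℕ → ℝ := fun i => if i ≤ N then s i else y

@[fun_prop]
lemma measurable_extendSeq (N : ℕ) :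
    Measurable fun p : (ℕ → ℝ) × ℝ => extendSeq N p.1 p.2 := by
  refine measurable_pi_iff.2 fun i => ?_
  unfold extendSeq; split_ifs <;> fun_prop

section
variable (ν : Measure ℝ) [IsProbabilityMeasure ν]

lemma doobChain_map_eval_zero (g : ℝ → ℝ≥0∞) (hg : Measurable g) :
    ∀ᵐ z ∂(doobChain ν g hg), z 0 = 0 := by
  have h : (doobChain ν g hg).map (Preorder.frestrictLe 0) =
      (Measure.dirac (0 : ℝ)).map (MeasurableEquiv.piUnique (fun i : Finset.Iic 0 => ℝ)).symm := by
    rw [doobChain, Kernel.trajMeasure, Measure.map_comp _ _ (by fun_prop),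
      Kernel.traj_map_frestrictLe, Kernel.partialTraj_self, Measure.id_comp]
  have hm : MeasurableSet {p : (i : Finset.Iic 0) → ℝ | p ⟨0, by simp⟩ = 0} :=
    measurableSet_eq_fun (by fun_prop) measurable_const
  have h2 : ∀ᵐ p ∂((doobChain ν g hg).map (Preorder.frestrictLe 0)), p ⟨0, by simp⟩ = 0 := by
    rw [h, ae_map_iff (by fun_prop) hm, ae_dirac_eq]
    rfl
  exact ae_of_ae_map (by fun_prop) h2

/-- Disintegration of the last relevant step. Since F sees only coordinates up to N + 1, the new
point may fill all later coordinates. -/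
lemma lintegral_doobChain_succ (g : ℝ → ℝ≥0∞) (hg : Measurable g) (N : ℕ)
    {F : (ℕ → ℝ) → ℝ≥0∞} (hF : Measurable F) (hd : DependsOn F (Set.Iic (N + 1))) :
    ∫⁻ z, F z ∂(doobChain ν g hg) =
      ∫⁻ z, ∫⁻ y, F (extendSeq N z y) ∂(doobKernel ν g hg (z N)) ∂(doobChain ν g hg) := by
  let κ : (n : ℕ) → Kernel ((i : Finset.Iic n) → ℝ) ℝ := fun n => (doobKernel ν g hg).comap
      (fun p : (i : Finset.Iic n) → ℝ => p ⟨n, Finset.mem_Iic.2 le_rfl⟩) (by fun_prop)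
  have key := Kernel.map_frestrictLe_trajMeasure_compProd_eq_map_trajMeasure
    (X := fun _ => ℝ) (κ := κ) (μ₀ := Measure.dirac 0) (a := N)
  change (doobChain ν g hg).map _ ⊗ₘ κ N = (doobChain ν g hg).map _ at key
  let e : (((i : Finset.Iic N) → ℝ) × ℝ) → ℕ → ℝ := fun p i =>
    if h : i ≤ N then p.1 ⟨i, Finset.mem_Iic.2 h⟩ else p.2
  have he : Measurable e := by
    refine measurable_pi_iff.2 fun i => ?_
    simp only [e]; split_ifs <;> fun_prop
  have h1 : ∀ z : ℕ → ℝ, F z = F (e (Preorder.frestrictLe (π := fun _ => ℝ) N z, z (N + 1))) := by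
    intro z
    refine hd fun i hi => ?_
    simp only [e]
    split_ifs with h
    · rfl
    · congr 1
      have : i ≤ N + 1 := hi
      omega
  have h2 : ∀ (z : ℕ → ℝ) (y : ℝ), e (Preorder.frestrictLe (π := fun _ => ℝ) N z, y) = extendSeq N z y := by
    intro z y
    funext i
    simp only [e, extendSeq]
    split_ifs <;> rfl
  have hFe : Measurable fun p => F (e p) := hF.comp he
  calc ∫⁻ z, F z ∂(doobChain ν g hg)
      = ∫⁻ p, F (e p) ∂((doobChain ν g hg).map
          (fun z => (Preorder.frestrictLe (π := fun _ => ℝ) N z, z (N + 1)))) := by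
        rw [lintegral_map hFe (by fun_prop)]
        exact lintegral_congr h1
    _ = _ := by
        rw [← key, Measure.lintegral_compProd hFe, lintegral_map
          (Measurable.lintegral_kernel_prod_right hFe) (by fun_prop)]
        refine lintegral_congr fun z => ?_
        simp_rw [h2]
        rfl

variable {ν}

/-- The law of the conditioned walk up to time `N` has density `potential K (S_N)` with respect to
the law of the walk killed outside `K`. -/
lemma lintegral_doobChain (ho : Oscillates ν) {K : Set ℝ} (hK : IsHalfLine K) {g : ℝ → ℝ≥0∞}
    (hg : Measurable g) (hgK : g = K.indicator (potential ν K)) (N : ℕ) :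
    ∀ {F : (ℕ → ℝ) → ℝ≥0∞}, Measurable F → DependsOn F (Set.Iic N) →
    ∫⁻ z, F z ∂(doobChain ν g hg) =
      ∫⁻ w in staysIn K 0 N, F (partialSum w) * potential ν K (partialSum w N) ∂(iid ν) := by
  have hKm := hK.measurableSet
  have hpm : Measurable (potential ν K) := (potential_mono ν hK).measurable
  induction N with
  | zero =>
    intro F hF hd
    have h0 : ∀ z : ℕ → ℝ, z 0 = 0 → F z = F 0 := fun z hz => hd fun i hi => by
      have : i = 0 := by simpa using hi
      rw [this, hz]; rfl
    have hs : staysIn K 0 0 = Set.univ := Set.eq_univ_of_forall fun w j h1 h2 => by omega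
    have h1 : ∀ w, F (partialSum w) * potential ν K (partialSum w 0) = F 0 := fun w => by
      rw [h0 (partialSum w) (partialSum_zero w), partialSum_zero, potential_zero, mul_one]
    have h2 : ∀ᵐ z ∂(doobChain ν g hg), F z = (fun _ => F 0) z :=
      (doobChain_map_eval_zero ν g hg).mono h0
    rw [lintegral_congr_ae h2, hs, Measure.restrict_univ, lintegral_congr h1]
    simp
  | succ N ih =>
    intro F hF hd
    have hF2 : Measurable fun z => ∫⁻ y, F (extendSeq N z y) ∂(doobKernel ν g hg (z N)) := by
      have : Measurable (Function.uncurry fun (z : ℕ → ℝ) (y : ℝ) => F (extendSeq N z y)) :=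
        hF.comp (measurable_extendSeq N)
      exact this.lintegral_kernel_prod_right' (κ := (doobKernel ν g hg).comap (fun z : ℕ → ℝ => z N)
        (by fun_prop))
    have hd2 : DependsOn (fun z : ℕ → ℝ => ∫⁻ y, F (extendSeq N z y) ∂(doobKernel ν g hg (z N)))
        (Set.Iic N) := by
      intro z z' h
      have h1 : z N = z' N := h N (Set.mem_Iic.2 le_rfl)
      have h2 : ∀ y, extendSeq N z y = extendSeq N z' y := by
        intro y; funext i
        unfold extendSeq
        split_ifs with hi
        · exact h i hi
        · rfl
      simp only [h1, h2]
    rw [lintegral_doobChain_succ ν g hg N hF hd, ih hF2 hd2]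
    have hsN := measurableSet_staysIn hKm 0 N
    have hsN1 := measurableSet_staysIn hKm 0 (N + 1)
    -- The path is frozen at time N so that `X` depends only on the first N increments.
    let X : (ℕ → ℝ) → ℝ≥0∞ × (ℕ → ℝ) := fun w =>
      ((staysIn K 0 N).indicator 1 w, fun i => partialSum w (min i N))
    let G : ℝ≥0∞ × (ℕ → ℝ) → (ℕ → ℝ) → ℝ≥0∞ := fun p w' =>
      p.1 * (F (extendSeq N p.2 (p.2 N + w' 0)) * g (p.2 N + w' 0))
    have hX : Measurable X := (measurable_one.indicator hsN).prodMk
      (measurable_pi_iff.2 fun i => by fun_prop)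
    have hG : Measurable (Function.uncurry G) := by
      refine Measurable.mul (by fun_prop) (Measurable.mul (hF.comp ?_) (hg.comp (by fun_prop)))
      exact (measurable_extendSeq N).comp
        (f := fun q : (ℝ≥0∞ × (ℕ → ℝ)) × (ℕ → ℝ) => (q.1.2, q.1.2 N + q.2 0)) (by fun_prop)
    have hXd : DependsOn X (Set.Iio N) := by
      intro w w' h
      simp only [X]
      rw [dependsOn_indicator (f := 1) (dependsOn_staysIn K 0 N) (fun _ _ _ => rfl) h]
      congr 1
      funext i
      exact partialSum_congr h (min_le_right _ _)
    have key := lintegral_shiftSeq_param ν N hX hG hXd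
    rw [← lintegral_indicator hsN, ← lintegral_indicator hsN1]
    have hext : ∀ w : ℕ → ℝ, ∀ y, extendSeq N (fun i => partialSum w (min i N)) y =
        extendSeq N (partialSum w) y := by
      intro w y; funext i
      unfold extendSeq
      split_ifs with hi
      · simp only [min_eq_left hi]
      · rfl
    calc _ = ∫⁻ w, ∫⁻ w', G (X w) w' ∂(iid ν) ∂(iid ν) := by
          refine lintegral_congr fun w => ?_
          by_cases hw : w ∈ staysIn K 0 N
          · have hx : 0 ≤ partialSum w N := by
              rcases Nat.eq_zero_or_pos N with rfl | hN
              · simp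
              · have := hw N hN le_rfl
                rw [zero_add] at this
                exact hK.nonneg this
            -- Harmonicity: the normalising mass of the kernel is the potential itself and cancels
            -- the density at time N.
            have hmass : stepMass ν g (partialSum w N) = potential ν K (partialSum w N) := by
              rw [stepMass, stepKernel_apply, lintegral_map hg (by fun_prop), hgK]
              exact lintegral_potential ho hK hx
            have hp0 : potential ν K (partialSum w N) ≠ 0 :=
              (one_pos.trans_le (one_le_potential ν K _)).ne'
            have hpt := potential_ne_top ho hK (partialSum w N)
            have hFy : Measurable fun y => F (extendSeq N (partialSum w) y) :=
              hF.comp ((measurable_extendSeq N).comp (by fun_prop : Measurable fun y : ℝ =>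
                (partialSum w, y)))
            simp only [Set.indicator_of_mem hw, G, X, Pi.one_apply, one_mul, hext, min_self]
            rw [doobKernel_apply ν g hg (by rw [hmass]; exact hp0) (by rw [hmass]; exact hpt),
              lintegral_withDensity_eq_lintegral_mul _ (by fun_prop) hFy,
              lintegral_map (by fun_prop) (by fun_prop), hmass,
              lintegral_eval ν 0 (f := fun y => F (extendSeq N (partialSum w)
                (partialSum w N + y)) * g (partialSum w N + y)) (by fun_prop),
              ← lintegral_mul_const _ (by fun_prop)]
            refine lintegral_congr fun y => ?_
            simp only [Pi.mul_apply]
            calc _ = (potential ν K (partialSum w N))⁻¹ * potential ν K (partialSum w N) *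
                  (F (extendSeq N (partialSum w) (partialSum w N + y)) *
                    g (partialSum w N + y)) := by ring
              _ = _ := by rw [ENNReal.inv_mul_cancel hp0 hpt, one_mul]
          · simp only [Set.indicator_of_notMem hw, G, X, zero_mul, lintegral_zero]
      _ = ∫⁻ w, G (X w) (shiftSeq N w) ∂(iid ν) := key.symm
      _ = _ := by
          refine lintegral_congr fun w => ?_
          have hsucc : partialSum w N + shiftSeq N w 0 = partialSum w (N + 1) := by
            rw [partialSum_succ]; rfl
          have hFe : F (extendSeq N (partialSum w) (partialSum w (N + 1))) = F (partialSum w) := by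
            refine hd fun i hi => ?_
            unfold extendSeq
            split_ifs with h
            · rfl
            · congr 1
              have : i ≤ N + 1 := hi
              omega
          simp only [G, X, hext, min_self, hsucc, hFe, hgK]
          by_cases hw : w ∈ staysIn K 0 (N + 1)
          · have h1 : w ∈ staysIn K 0 N := fun j hj hjn => hw j hj (by omega)
            have h2 : partialSum w (N + 1) ∈ K := by
              have := hw (N + 1) (by omega) le_rfl
              rwa [zero_add] at this
            rw [Set.indicator_of_mem hw, Set.indicator_of_mem h1, Set.indicator_of_mem h2]
            simp
          · rw [Set.indicator_of_notMem hw]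
            by_cases h1 : w ∈ staysIn K 0 N
            · have h2 : partialSum w (N + 1) ∉ K := by
                intro h2
                refine hw fun j hj hjn => ?_
                rcases Nat.lt_or_ge N j with h | h
                · rwa [show j = N + 1 by omega, zero_add]
                · exact h1 j hj h
              rw [Set.indicator_of_notMem h2, mul_zero, mul_zero]
            · rw [Set.indicator_of_notMem h1, zero_mul]

/-- The exponential moments along the conditioned walk, summed over time, are finite. -/
lemma tsum_lintegral_staysIn_lt_top (ho : Oscillates ν) {K : Set ℝ} (hK : IsHalfLine K) {c : ℝ}
    (hc : 0 < c) :
    ∑' n, ∫⁻ w in staysIn K 0 n, expE (-c * partialSum w n) * potential ν K (partialSum w n)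
      ∂(iid ν) < ∞ := by
  -- Half of the exponential decay absorbs the growth of the potential; the other half makes the
  -- ladder series converge after time reversal.
  obtain ⟨C, hC, h⟩ := exists_potential_le ho hK (half_pos hc)
  have hfin := tsum_lintegral_ladder_lt_top ν hK.measurableSet (-(c / 2))
    (fun x hx => mul_nonpos_of_nonpos_of_nonneg (by linarith) (hK.nonneg hx))
    (lt_of_lt_of_le ho.measure_Ioi_pos (measure_mono fun x hx =>
      ⟨hK.mem_of_pos hx, mul_neg_of_neg_of_pos (by linarith) hx⟩))
  refine lt_of_le_of_lt ?_ (ENNReal.mul_lt_top hC.lt_top hfin)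
  rw [← ENNReal.tsum_mul_left]
  refine ENNReal.tsum_le_tsum fun n => ?_
  rw [← lintegral_staysIn_eq_ladder ν hK.measurableSet n (F := fun x => expE (-(c / 2) * x))
    (by fun_prop), ← lintegral_const_mul _ (by fun_prop)]
  refine setLIntegral_mono_ae (by fun_prop) (ae_of_all _ fun w hw => ?_)
  have hx : 0 ≤ partialSum w n := by
    rcases Nat.eq_zero_or_pos n with rfl | hN
    · simp
    · have := hw n hN le_rfl
      rw [zero_add] at this
      exact hK.nonneg this
  calc _ ≤ expE (-c * partialSum w n) * (C * expE (c / 2 * partialSum w n)) := by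
        gcongr; exact h _ hx
    _ = C * (expE (-c * partialSum w n) * expE (c / 2 * partialSum w n)) := by ring
    _ = _ := by rw [← expE_add]; congr 2; ring

end

/-! ### The slopes of a trajectory -/

section Paths

variable {S : ℕ → ℝ} {Γ : ℝ}

lemma hasRise_iff_neg {m n : ℕ} : HasRise S Γ m n ↔ HasDrop (fun k => - S k) Γ m n := by
  simp only [HasRise, HasDrop, neg_sub_neg]

/-- The argmax set of a phase that ends with the first drop of size `Γ`. -/
structure DropPhase (S : ℕ → ℝ) (Γ : ℝ) (t t' a b : ℕ) : Prop where
  start_le : t ≤ a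
  le : a ≤ b
  lt_end : b < t'
  lt_first : ∀ j, t ≤ j → j < a → S j < S a
  lt_last : ∀ j, b < j → j ≤ t' → S j < S b
  le_max : ∀ j, t ≤ j → j ≤ t' → S j ≤ S a
  eq : S a = S b
  not_drop : ∀ n < t', ¬ HasDrop S Γ t n
  end_le : S t' ≤ S a - Γ

/-- The first drop of size Γ is completed exactly at the final time, so the path ends at least Γ
below its maximum and the argmax set lies strictly before the end. -/
lemma dropPhase_sInf (hΓ : 0 < Γ) (hbelow : ∀ a, ∃ n, S n ≤ a) (t : ℕ) :
    DropPhase S Γ t (sInf {n | t < n ∧ HasDrop S Γ t n})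
      (sInf {n | n ∈ Set.Icc t (sInf {n | t < n ∧ HasDrop S Γ t n}) ∧
        ∀ i ∈ Set.Icc t (sInf {n | t < n ∧ HasDrop S Γ t n}), S i ≤ S n})
      (sSup {n | n ∈ Set.Icc t (sInf {n | t < n ∧ HasDrop S Γ t n}) ∧
        ∀ i ∈ Set.Icc t (sInf {n | t < n ∧ HasDrop S Γ t n}), S i ≤ S n}) := by
  have hne : {n | t < n ∧ HasDrop S Γ t n}.Nonempty := by
    -- The subtracted sum excludes every n ≤ t.
    obtain ⟨n, hn⟩ := hbelow (S t - Γ - ∑ j ∈ Finset.range (t + 1), |S t - S j|)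
    have htn : t < n := by
      by_contra h
      have h1 : |S t - S n| ≤ ∑ j ∈ Finset.range (t + 1), |S t - S j| :=
        Finset.single_le_sum (f := fun j => |S t - S j|) (fun _ _ => abs_nonneg _)
          (Finset.mem_range.2 (by omega))
      have := le_abs_self (S t - S n)
      linarith
    have h2 : 0 ≤ ∑ j ∈ Finset.range (t + 1), |S t - S j| :=
      Finset.sum_nonneg fun _ _ => abs_nonneg _
    exact ⟨n, htn, t, n, le_rfl, htn.le, le_rfl, by linarith⟩
  have hspec := Nat.sInf_mem hne
  have hmin : ∀ n, n < sInf {n | t < n ∧ HasDrop S Γ t n} → ¬ HasDrop S Γ t n := by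
    intro n hn hd
    rcases Nat.lt_or_ge t n with h | h
    · exact Nat.notMem_of_lt_sInf hn ⟨h, hd⟩
    · obtain ⟨i, j, h1, h2, h3, h4⟩ := hd
      have : i = j := by omega
      subst this
      linarith
  set t' := sInf {n | t < n ∧ HasDrop S Γ t n} with ht'
  set E : Set ℕ := {n | n ∈ Set.Icc t t' ∧ ∀ i ∈ Set.Icc t t', S i ≤ S n} with hE
  obtain ⟨htt', hdrop⟩ := hspec
  have hEne : E.Nonempty := by
    obtain ⟨n, hn, hmax⟩ := (Set.finite_Icc t t').exists_maximalFor S _ ⟨t, le_rfl, htt'.le⟩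
    refine ⟨n, hn, fun i hi => ?_⟩
    rcases le_total (S i) (S n) with h | h
    · exact h
    · exact hmax hi h
  have hEbdd : BddAbove E := ⟨t', fun n hn => hn.1.2⟩
  have ha := Nat.sInf_mem hEne
  have hb := Nat.sSup_mem hEne hEbdd
  set a := sInf E
  set b := sSup E
  have hend : S t' ≤ S a - Γ := by
    obtain ⟨i, j, h1, h2, h3, h4⟩ := hdrop
    have hj : j = t' := by
      by_contra hne
      exact hmin j (by omega) ⟨i, j, h1, h2, le_rfl, h4⟩
    subst hj
    have := ha.2 i ⟨h1, h2⟩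
    linarith
  have hab : S a = S b := le_antisymm (hb.2 a ha.1) (ha.2 b hb.1)
  refine ⟨ha.1.1, Nat.sInf_le hb, ?_, ?_, ?_, fun j h1 h2 => ha.2 j ⟨h1, h2⟩, hab, hmin, hend⟩
  · refine lt_of_le_of_ne hb.1.2 fun h => ?_
    rw [← h] at hend
    linarith
  · intro j h1 h2
    by_contra h
    have : j ∈ E := ⟨⟨h1, h2.le.trans ha.1.2⟩, fun i hi => (ha.2 i hi).trans (not_lt.1 h)⟩
    exact absurd (Nat.sInf_le this) (not_le.2 h2)
  · intro j h1 h2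
    by_contra h
    have : j ∈ E := ⟨⟨hb.1.1.trans h1.le, h2⟩, fun i hi => (hb.2 i hi).trans (not_lt.1 h)⟩
    exact absurd (le_csSup hEbdd this) (not_le.2 h1)

lemma dropPhase_even (hΓ : 0 < Γ) (hbelow : ∀ a, ∃ n, S n ≤ a) {j : ℕ} (hj : Even j) :
    DropPhase S Γ (tTime S Γ j) (tTime S Γ (j + 1)) (uFirst S Γ (j + 1)) (uLast S Γ (j + 1)) := by
  have := dropPhase_sInf hΓ hbelow (tTime S Γ j)
  have e : tTime S Γ (j + 1) = sInf {n | tTime S Γ j < n ∧ HasDrop S Γ (tTime S Γ j) n} := by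
    rw [tTime]; simp [hj]
  unfold uFirst uLast extremalTimes
  simp only [Nat.add_sub_cancel, hj, if_true]
  rw [e]
  exact this

lemma dropPhase_odd (hΓ : 0 < Γ) (habove : ∀ a, ∃ n, a ≤ S n) {j : ℕ} (hj : ¬ Even j) :
    DropPhase (fun k => - S k) Γ (tTime S Γ j) (tTime S Γ (j + 1)) (uFirst S Γ (j + 1))
      (uLast S Γ (j + 1)) := by
  have := dropPhase_sInf (S := fun k => - S k) hΓ (fun a => by
    obtain ⟨n, hn⟩ := habove (-a)
    exact ⟨n, by linarith⟩) (tTime S Γ j)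
  have e : tTime S Γ (j + 1) = sInf {n | tTime S Γ j < n ∧
      HasDrop (fun k => - S k) Γ (tTime S Γ j) n} := by
    rw [tTime]; simp [hj, hasRise_iff_neg]
  simp only [neg_le_neg_iff] at this
  unfold uFirst uLast extremalTimes
  simp only [Nat.add_sub_cancel, hj, if_false]
  rw [e]
  exact this

/-- `M` and `N` are the ends of a descending slope: `M` is a `Γ`-maximum preceded only by smaller
values and no drop of size `Γ`, and `N` is the `Γ`-minimum that follows. -/
structure IsSlope (S : ℕ → ℝ) (Γ : ℝ) (M N : ℕ) : Prop where
  le : M ≤ N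
  lt_left : ∀ i < M, S i < S M
  not_drop : ¬ HasDrop S Γ 0 M
  lt_mid : ∀ j, M ≤ j → j < N → S N < S j
  not_rise : ¬ HasRise S Γ M N
  le_max : ∀ j, M ≤ j → j ≤ N → S j ≤ S M
  height : S N + Γ ≤ S M
  right : ∃ n, N ≤ n ∧ S N + Γ ≤ S n ∧ ∀ j, N ≤ j → j ≤ n → S N ≤ S j

/-- Let M < M'. As M' is a strict record it cannot lie before N, where values are at most S M; and
from N on, the drop from M to N is a forbidden drop before M'. For a common M and N < N', the rise
by Γ after N is either completed before N', which is excluded, or the path stays at or above S N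
until N', against S N' < S N. -/
lemma IsSlope.unique {M N M' N' : ℕ} (h : IsSlope S Γ M N) (h' : IsSlope S Γ M' N') :
    M = M' ∧ N = N' := by
  have key1 : ∀ {M N M' N' : ℕ}, IsSlope S Γ M N → IsSlope S Γ M' N' → ¬ M < M' := by
    intro M N M' N' h h' hlt
    rcases Nat.lt_or_ge M' N with hN | hN
    · exact absurd (h.le_max M' hlt.le hN.le) (not_le.2 (h'.lt_left M hlt))
    · exact h'.not_drop ⟨M, N, by omega, h.le, hN, by linarith [h.height]⟩
  have hM : M = M' := by
    have := key1 h h'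
    have := key1 h' h
    omega
  subst hM
  have key2 : ∀ {N N' : ℕ}, IsSlope S Γ M N → IsSlope S Γ M N' → ¬ N < N' := by
    intro N N' h h' hlt
    obtain ⟨n, hNn, hn, hs⟩ := h.right
    rcases Nat.lt_or_ge n N' with hN | hN
    · exact h'.not_rise ⟨N, n, h.le, hNn, hN.le, by linarith⟩
    · exact absurd (hs N' hlt.le hN) (not_le.2 (h'.lt_mid N h.le hlt))
  have := key2 h h'
  have := key2 h' h
  exact ⟨rfl, by omega⟩

/-- The separating time t_1 drops out of the description: before it the path exceeds S M - Γ, and S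
N ≤ S t_1 ≤ S M - Γ, so the minimum of the second phase is the minimum from M on. -/
lemma isSlope_uFirst (hΓ : 0 < Γ) (hbelow : ∀ a, ∃ n, S n ≤ a) (habove : ∀ a, ∃ n, a ≤ S n) :
    IsSlope S Γ (uFirst S Γ 1) (uFirst S Γ 2) := by
  have p1 := dropPhase_even hΓ hbelow (j := 0) (by simp)
  have p2 := dropPhase_odd hΓ habove (j := 1) (by decide)
  simp only [zero_add, Nat.reduceAdd] at p1 p2
  have ht0 : tTime S Γ 0 = 0 := rfl
  rw [ht0] at p1
  set M := uFirst S Γ 1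
  set N := uFirst S Γ 2
  set t1 := tTime S Γ 1
  set t2 := tTime S Γ 2
  have hMt : M < t1 := p1.le.trans_lt p1.lt_end
  have hNt : N < t2 := p2.le.trans_lt p2.lt_end
  have htN : t1 ≤ N := p2.start_le
  have hlow : ∀ j, M ≤ j → j < t1 → S M - Γ < S j := fun j h1 h2 => by
    by_contra h
    exact p1.not_drop j h2 ⟨M, j, Nat.zero_le _, h1, le_rfl, by linarith⟩
  have hrise : ∀ i j, t1 ≤ i → i ≤ j → j < t2 → S j < S i + Γ := fun i j h1 h2 h3 => by
    by_contra h
    exact p2.not_drop j h3 ⟨i, j, h1, h2, le_rfl, by linarith⟩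
  have hNmin : ∀ j, t1 ≤ j → j ≤ t2 → S N ≤ S j := fun j h1 h2 => by
    have := p2.le_max j h1 h2; linarith
  have hmax1 : ∀ j, j ≤ t1 → S j ≤ S M := fun j h => p1.le_max j (Nat.zero_le _) h
  have hend1 := p1.end_le
  have hend2 := p2.end_le
  refine ⟨by omega, fun i hi => p1.lt_first i (Nat.zero_le _) hi, p1.not_drop M hMt, ?_, ?_, ?_, ?_,
    t2, hNt.le, by linarith, fun j h1 h2 => hNmin j (by omega) h2⟩
  · intro j h1 h2
    rcases Nat.lt_or_ge j t1 with h | h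
    · have := hlow j h1 h
      have := hNmin t1 le_rfl (by omega)
      linarith
    · have := p2.lt_first j h h2; linarith
  · rintro ⟨i, j, h1, h2, h3, h4⟩
    rcases Nat.lt_or_ge i t1 with hi | hi
    · have h5 := hlow i h1 hi
      rcases Nat.lt_or_ge j t1 with hj | hj
      · have := hmax1 j hj.le; linarith
      · have := hrise t1 j le_rfl hj (by omega); linarith
    · have := hrise i j hi h2 (by omega); linarith
  · intro j h1 h2
    rcases Nat.lt_or_ge j t1 with hj | hj
    · exact hmax1 j hj.le
    · have := hrise t1 j le_rfl hj (by omega); linarith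
  · have := hNmin t1 le_rfl (by omega)
    linarith

/-- The times `t_2` and `u_3^+`. -/
lemma uLast_three_spec (hΓ : 0 < Γ) (hbelow : ∀ a, ∃ n, S n ≤ a) (habove : ∀ a, ∃ n, a ≤ S n) :
    ∃ t, uFirst S Γ 2 ≤ t ∧ t ≤ uLast S Γ 3 ∧ S (uFirst S Γ 2) + Γ ≤ S t ∧
      (∀ j, uFirst S Γ 2 ≤ j → j < t → S j < S (uFirst S Γ 2) + Γ) ∧
      (∀ j, uFirst S Γ 2 ≤ j → j ≤ t → S (uFirst S Γ 2) ≤ S j) ∧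
      (∀ j, t ≤ j → j ≤ uLast S Γ 3 → S j ≤ S (uLast S Γ 3)) ∧
      ¬ HasDrop S Γ t (uLast S Γ 3) ∧
      ∃ n, uLast S Γ 3 ≤ n ∧ S n ≤ S (uLast S Γ 3) - Γ ∧
        ∀ j, uLast S Γ 3 < j → j ≤ n → S j < S (uLast S Γ 3) := by
  have p2 := dropPhase_odd hΓ habove (j := 1) (by decide)
  have p3 := dropPhase_even hΓ hbelow (j := 2) (by decide)
  simp only [Nat.reduceAdd] at p2 p3
  refine ⟨tTime S Γ 2, (p2.le.trans_lt p2.lt_end).le, p3.start_le.trans p3.le, ?_, ?_, ?_, ?_,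
    p3.not_drop _ p3.lt_end, tTime S Γ 3, p3.lt_end.le, ?_, fun j h1 h2 => p3.lt_last j h1 h2⟩
  · have := p2.end_le; linarith
  · intro j h1 h2
    by_contra h
    exact p2.not_drop j h2 ⟨uFirst S Γ 2, j, p2.start_le, h1, le_rfl, by linarith⟩
  · intro j h1 h2
    have := p2.le_max j (p2.start_le.trans h1) h2
    linarith
  · intro j h1 h2
    rw [← p3.eq]
    exact p3.le_max j h1 (h2.trans p3.lt_end.le)
  · rw [← p3.eq]; exact p3.end_le

end Paths

/-! ### Bounds for the two sums along a trajectory -/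

lemma sum_Icc_neg_natCast (g : ℤ → ℝ) (a b : ℕ) :
    ∑ n ∈ Finset.Icc (-(a : ℤ)) b, g n =
      ∑ k ∈ Finset.range a, g (-((k + 1 : ℕ) : ℤ)) + ∑ k ∈ Finset.range (b + 1), g k := by
  classical
  have e : Finset.Icc (-(a : ℤ)) b = (Finset.range a).image (fun k : ℕ => -((k + 1 : ℕ) : ℤ)) ∪
      (Finset.range (b + 1)).image (fun k : ℕ => (k : ℤ)) := by
    ext n
    simp only [Finset.mem_Icc, Finset.mem_union, Finset.mem_image, Finset.mem_range]
    constructor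
    · rintro ⟨h1, h2⟩
      rcases lt_or_ge n 0 with h | h
      · exact Or.inl ⟨n.natAbs - 1, by omega, by omega⟩
      · exact Or.inr ⟨n.natAbs, by omega, by omega⟩
    · rintro (⟨k, h1, h2⟩ | ⟨k, h1, h2⟩) <;> omega
  rw [e, Finset.sum_union, Finset.sum_image, Finset.sum_image]
  · intro i _ j _ h
    simpa using h
  · intro i _ j _ h
    simpa using h
  · rw [Finset.disjoint_left]
    intro n h1 h2
    obtain ⟨k, -, hk⟩ := Finset.mem_image.1 h1
    obtain ⟨l, -, hl⟩ := Finset.mem_image.1 h2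
    omega

/-- The sum of `exp (-2 s)` over the window `⟦-n, n⟧`, for a two-sided path with halves `s` (at
negative times) and `s'`. -/
noncomputable def windowSum (n : ℕ) (s s' : ℕ → ℝ) : ℝ :=
  ∑ k ∈ Finset.range n, Real.exp (-2 * s (k + 1)) + ∑ k ∈ Finset.range (n + 1), Real.exp (-2 * s' k)

lemma one_le_windowSum (n : ℕ) (s s' : ℕ → ℝ) (h : s' 0 = 0) : 1 ≤ windowSum n s s' := by
  have h1 : 0 ≤ ∑ k ∈ Finset.range n, Real.exp (-2 * s (k + 1)) :=
    Finset.sum_nonneg fun _ _ => (Real.exp_pos _).le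
  have h2 : Real.exp (-2 * s' 0) ≤ ∑ k ∈ Finset.range (n + 1), Real.exp (-2 * s' k) :=
    Finset.single_le_sum (f := fun k => Real.exp (-2 * s' k)) (fun _ _ => (Real.exp_pos _).le)
      (Finset.mem_range.2 (by omega))
  rw [h] at h2
  simp only [mul_zero, Real.exp_zero] at h2
  unfold windowSum
  linarith

lemma windowSum_mono {n n' m m' : ℕ} (h : n ≤ n') (h' : m ≤ m') (s s' : ℕ → ℝ) :
    ∑ k ∈ Finset.range n, Real.exp (-2 * s (k + 1)) + ∑ k ∈ Finset.range m, Real.exp (-2 * s' k) ≤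
    ∑ k ∈ Finset.range n', Real.exp (-2 * s (k + 1)) +
      ∑ k ∈ Finset.range m', Real.exp (-2 * s' k) :=
  add_le_add
    (Finset.sum_le_sum_of_subset_of_nonneg (Finset.range_mono h) fun _ _ _ => (Real.exp_pos _).le)
    (Finset.sum_le_sum_of_subset_of_nonneg (Finset.range_mono h') fun _ _ _ => (Real.exp_pos _).le)

/-- Splitting of an exponential sum according to the time and to whether the level `Γ` has been
reached. -/
lemma sum_exp_eq_split (s : ℕ → ℝ) (Γ : ℝ) (n a : ℕ) :
    ∑ k ∈ Finset.range a, Real.exp (-2 * s k) =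
      (∑ k ∈ Finset.range a, if k ≤ n ∧ ∀ j ≤ k, s j < Γ then Real.exp (-2 * s k) else 0) +
      (∑ k ∈ Finset.range a, if n + 1 ≤ k ∧ ∀ j ≤ k, s j < Γ then Real.exp (-2 * s k) else 0) +
      ∑ k ∈ Finset.range a, if ¬ ∀ j ≤ k, s j < Γ then Real.exp (-2 * s k) else 0 := by
  classical
  rw [← Finset.sum_add_distrib, ← Finset.sum_add_distrib]
  refine Finset.sum_congr rfl fun k _ => ?_
  by_cases h : ∀ j ≤ k, s j < Γ
  · by_cases h' : k ≤ n
    · rw [if_pos ⟨h', h⟩, if_neg fun hh => by omega, if_neg (not_not.2 h)]; ring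
    · rw [if_neg fun hh => h' hh.1, if_pos ⟨by omega, h⟩, if_neg (not_not.2 h)]; ring
  · rw [if_neg fun hh => h hh.2, if_neg fun hh => h hh.2, if_pos h]; ring

/-- The walk is below `c` before time `n`. -/
def below (c : ℝ) (n : ℕ) : Set (ℕ → ℝ) := {w | ∀ j < n, partialSum w j < c}

/-- The walk started at `0` reaches `[Γ, ∞)` for the first time at time `m`. -/
def firstAbove (Γ : ℝ) (m : ℕ) : Set (ℕ → ℝ) :=
  {w | Γ ≤ partialSum w m ∧ ∀ j < m, partialSum w j < Γ}

/-- The walk is at its maximum at time `l`, with no drop of size `Γ` before. -/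
def peak (Γ : ℝ) (l : ℕ) : Set (ℕ → ℝ) :=
  {w | (∀ j ≤ l, partialSum w j ≤ partialSum w l) ∧ ¬ HasDrop (partialSum w) Γ 0 l}

/-- The walk falls by `Γ`, being negative from time `1` until then. -/
def fall (Γ : ℝ) : Set (ℕ → ℝ) :=
  {w | ∃ n, partialSum w n ≤ -Γ ∧ ∀ j, 1 ≤ j → j ≤ n → partialSum w j < 0}

/-- The sum of `exp (-2 (Γ + S_i))` over `i ≤ l`. -/
noncomputable def runSum (Γ : ℝ) (l : ℕ) (w : ℕ → ℝ) : ℝ≥0∞ :=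
  ∑ i ∈ Finset.range (l + 1), expE (-2 * (Γ + partialSum w i))

/-- The contribution of time `k > n` if the level `Γ` has not yet been reached. -/
noncomputable def midTerm (Γ : ℝ) (n k : ℕ) (w : ℕ → ℝ) : ℝ≥0∞ :=
  if n + 1 ≤ k then (below Γ (k + 1)).indicator (fun w => expE (-2 * partialSum w k)) w else 0

/-- A bound for the contribution of the times after the level `Γ` is reached, until time `d`. -/
noncomputable def outerLeft (Γ : ℝ) (d : ℕ) (w : ℕ → ℝ) : ℝ≥0∞ :=
  ∑ m ∈ Finset.range (d + 1),
    (firstAbove Γ m).indicator (fun w => runSum Γ (d - m) (shiftSeq m w)) w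

/-- A bound for the contribution of the times after the level `Γ` is reached, until the last
maximum before a drop of size `Γ`. -/
noncomputable def outerRight (Γ : ℝ) (w : ℕ → ℝ) : ℝ≥0∞ :=
  ∑' m, (firstAbove Γ m).indicator (fun w => ∑' l,
    (peak Γ l ∩ shiftSeq l ⁻¹' fall Γ).indicator (runSum Γ l) (shiftSeq m w)) w

/-- The increments before time `N`, seen backwards in time from `N`. -/
def backSeq (N : ℕ) (w : ℕ → ℝ) : ℕ → ℝ := fun i => - revSeq N w i

lemma partialSum_backSeq {N k : ℕ} (w : ℕ → ℝ) (hk : k ≤ N) :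
    partialSum (backSeq N w) k = partialSum w (N - k) - partialSum w N := by
  unfold backSeq
  rw [partialSum_neg, partialSum_revSeq w hk]; ring

/-- The environment seen from the minimum, for trajectories that oscillate. -/
structure SlopeData (w : ℕ → ℝ) (Γ : ℝ) (a b : ℕ) (s s' : ℕ → ℝ) : Prop where
  left_end : leftEnd (partialSum w) Γ = -(a : ℤ)
  right_end : rightEnd (partialSum w) Γ = b
  env_neg : ∀ k ≤ a, envWalk (partialSum w) Γ (-(k : ℤ)) = s k
  env_pos : ∀ k : ℕ, envWalk (partialSum w) Γ k = s' k
  nonneg_left : ∀ k ≤ a, 0 ≤ s k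
  nonneg_right : ∀ k ≤ b, 0 ≤ s' k
  zero_left : s 0 = 0
  zero_right : s' 0 = 0
  high_left : Γ ≤ s a
  high_right : ∃ k ≤ b, Γ ≤ s' k

namespace SlopeData

variable {w : ℕ → ℝ} {Γ : ℝ} {a b : ℕ} {s s' : ℕ → ℝ} (h : SlopeData w Γ a b s s')
include h

lemma sum_Icc {p q : ℕ} (hp : p ≤ a) :
    ∑ n ∈ Finset.Icc (-(p : ℤ)) q, Real.exp (-2 * envWalk (partialSum w) Γ n) =
      ∑ k ∈ Finset.range p, Real.exp (-2 * s (k + 1)) +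
        ∑ k ∈ Finset.range (q + 1), Real.exp (-2 * s' k) := by
  rw [sum_Icc_neg_natCast]
  congr 1
  · refine Finset.sum_congr rfl fun k hk => ?_
    have := Finset.mem_range.1 hk
    rw [h.env_neg (k + 1) (by omega)]
  · exact Finset.sum_congr rfl fun k _ => by rw [h.env_pos k]

lemma logSumFull_eq : logSumFull (partialSum w) Γ =
    Real.log (∑ k ∈ Finset.range a, Real.exp (-2 * s (k + 1)) +
        ∑ k ∈ Finset.range (b + 1), Real.exp (-2 * s' k)) := by
  rw [logSumFull, h.left_end, h.right_end, h.sum_Icc le_rfl]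

/-- The supremum is attained, since the left end has height at least Γ. It is not 0, where the
height is 0. -/
lemma tauMinus_spec (hΓ : 0 < Γ) : ∃ p : ℕ, 1 ≤ p ∧ p ≤ a ∧
    tauMinus (partialSum w) Γ = -(p : ℤ) ∧ Γ / 2 ≤ s p := by
  let E : Set ℤ := {n : ℤ | leftEnd (partialSum w) Γ ≤ n ∧ n ≤ 0 ∧
    Γ / 2 ≤ envWalk (partialSum w) Γ n}
  have hne : E.Nonempty := by
    refine ⟨-(a : ℤ), by rw [h.left_end], by omega, ?_⟩
    rw [h.env_neg a le_rfl]
    linarith [h.high_left]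
  have hmem : sSup E ∈ E := Int.csSup_mem hne ⟨0, fun n hn => hn.2.1⟩
  obtain ⟨h1, h2, h3⟩ := hmem
  rw [h.left_end] at h1
  have e : tauMinus (partialSum w) Γ = sSup E := rfl
  have hp : sSup E = -(((sSup E).natAbs : ℕ) : ℤ) := by omega
  rw [hp, h.env_neg _ (by omega)] at h3
  refine ⟨(sSup E).natAbs, ?_, by omega, e.trans hp, h3⟩
  refine Nat.one_le_iff_ne_zero.2 fun h0 => ?_
  rw [h0, h.zero_left] at h3
  linarith

lemma tauPlus_spec (hΓ : 0 < Γ) : ∃ q : ℕ, 1 ≤ q ∧ q ≤ b ∧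
    tauPlus (partialSum w) Γ = q ∧ Γ / 2 ≤ s' q := by
  let E : Set ℤ := {n : ℤ | 0 ≤ n ∧ n ≤ rightEnd (partialSum w) Γ ∧
    Γ / 2 ≤ envWalk (partialSum w) Γ n}
  have hne : E.Nonempty := by
    obtain ⟨k, hk, hk2⟩ := h.high_right
    refine ⟨k, by omega, by rw [h.right_end]; exact_mod_cast hk, ?_⟩
    rw [h.env_pos k]
    linarith
  have hmem : sInf E ∈ E := Int.csInf_mem hne ⟨0, fun n hn => hn.1⟩
  obtain ⟨h1, h2, h3⟩ := hmem
  rw [h.right_end] at h2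
  have e : tauPlus (partialSum w) Γ = sInf E := rfl
  have hp : sInf E = (((sInf E).natAbs : ℕ) : ℤ) := by omega
  rw [hp, h.env_pos] at h3
  refine ⟨(sInf E).natAbs, ?_, by omega, e.trans hp, h3⟩
  refine Nat.one_le_iff_ne_zero.2 fun h0 => ?_
  rw [h0, h.zero_right] at h3
  linarith

lemma logSumBelow_eq (hΓ : 0 < Γ) : ∃ p q : ℕ, p + 1 ≤ a ∧ q + 1 ≤ b ∧ Γ / 2 ≤ s (p + 1) ∧
    Γ / 2 ≤ s' (q + 1) ∧ logSumBelow (partialSum w) Γ =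
    Real.log (∑ k ∈ Finset.range p, Real.exp (-2 * s (k + 1)) +
        ∑ k ∈ Finset.range (q + 1), Real.exp (-2 * s' k)) := by
  obtain ⟨p, hp1, hpa, hp, hp2⟩ := h.tauMinus_spec hΓ
  obtain ⟨q, hq1, hqb, hq, hq2⟩ := h.tauPlus_spec hΓ
  obtain ⟨p, rfl⟩ := Nat.exists_eq_add_of_le' hp1
  obtain ⟨q, rfl⟩ := Nat.exists_eq_add_of_le' hq1
  refine ⟨p, q, hpa, hqb, hp2, hq2, ?_⟩
  rw [logSumBelow, hp, hq, ← h.sum_Icc (by omega)]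
  congr 2
  ext n
  simp only [Finset.mem_Ioo, Finset.mem_Icc]
  omega

lemma logSumBelow_nonneg (hΓ : 0 < Γ) : 0 ≤ logSumBelow (partialSum w) Γ := by
  obtain ⟨p, q, -, -, -, -, he⟩ := h.logSumBelow_eq hΓ
  rw [he]
  refine Real.log_nonneg ((one_le_windowSum 0 s s' h.zero_right).trans ?_)
  exact windowSum_mono (Nat.zero_le _) (by omega) s s'

lemma logSumBelow_le (hΓ : 0 < Γ) :
    logSumBelow (partialSum w) Γ ≤ logSumFull (partialSum w) Γ := by
  obtain ⟨p, q, hp, hq, -, -, he⟩ := h.logSumBelow_eq hΓ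
  rw [he, h.logSumFull_eq]
  refine Real.log_le_log (one_pos.trans_le ((one_le_windowSum 0 s s' h.zero_right).trans ?_))
    (windowSum_mono (by omega) (by omega) s s')
  exact windowSum_mono (Nat.zero_le _) (by omega) s s'

/-- When both halves stay below Γ/2 up to time n, the window lies strictly between the two passage
times. -/
lemma log_windowSum_le (hΓ : 0 < Γ) {n : ℕ} (h1 : ∀ j < n + 1, s j < Γ / 2)
    (h2 : ∀ j < n + 1, s' j < Γ / 2) :
    Real.log (windowSum n s s') ≤ logSumBelow (partialSum w) Γ := by
  obtain ⟨p, q, -, -, hp, hq, he⟩ := h.logSumBelow_eq hΓ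
  rw [he]
  refine Real.log_le_log (one_pos.trans_le (one_le_windowSum n s s' h.zero_right)) ?_
  refine windowSum_mono ?_ ?_ s s'
  · by_contra hlt
    exact absurd hp (not_le.2 (h1 (p + 1) (by omega)))
  · by_contra hlt
    exact absurd hq (not_le.2 (h2 (q + 1) (by omega)))

-- From log(Y + T) ≤ log Y + T for Y ≥ 1. Here Y collects the times up to n before Γ is passed;
-- outside the good event it is bounded by counting its at most 2n + 1 terms. The remainder T enters
-- linearly, so its first moment suffices.
open Classical in
lemma logSumFull_le (hΓ : 0 < Γ) (n : ℕ) :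
    logSumFull (partialSum w) Γ ≤
      (if (∀ j < n + 1, s j < Γ / 2) ∧ (∀ j < n + 1, s' j < Γ / 2)
        then Real.log (windowSum n s s') else Real.log (2 * n + 1)) +
      (∑ k ∈ Finset.range (a + 1),
        if n + 1 ≤ k ∧ ∀ j ≤ k, s j < Γ then Real.exp (-2 * s k) else 0) +
      (∑ k ∈ Finset.range (a + 1), if ¬ ∀ j ≤ k, s j < Γ then Real.exp (-2 * s k) else 0) +
      (∑ k ∈ Finset.range (b + 1),
        if n + 1 ≤ k ∧ ∀ j ≤ k, s' j < Γ then Real.exp (-2 * s' k) else 0) +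
      ∑ k ∈ Finset.range (b + 1), if ¬ ∀ j ≤ k, s' j < Γ then Real.exp (-2 * s' k) else 0 := by
  rw [h.logSumFull_eq]
  have e1 := sum_exp_eq_split s Γ n (a + 1)
  have e2 := sum_exp_eq_split s' Γ n (b + 1)
  have e0 : ∑ k ∈ Finset.range (a + 1), Real.exp (-2 * s k) =
      ∑ k ∈ Finset.range a, Real.exp (-2 * s (k + 1)) + 1 := by
    rw [Finset.sum_range_succ', h.zero_left]; simp
  set y1 := ∑ k ∈ Finset.range (a + 1),
    if k ≤ n ∧ ∀ j ≤ k, s j < Γ then Real.exp (-2 * s k) else 0 with hy1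
  set y2 := ∑ k ∈ Finset.range (b + 1),
    if k ≤ n ∧ ∀ j ≤ k, s' j < Γ then Real.exp (-2 * s' k) else 0 with hy2
  set t1 := ∑ k ∈ Finset.range (a + 1),
    if n + 1 ≤ k ∧ ∀ j ≤ k, s j < Γ then Real.exp (-2 * s k) else 0
  set t2 := ∑ k ∈ Finset.range (b + 1),
    if n + 1 ≤ k ∧ ∀ j ≤ k, s' j < Γ then Real.exp (-2 * s' k) else 0
  set o1 := ∑ k ∈ Finset.range (a + 1), if ¬ ∀ j ≤ k, s j < Γ then Real.exp (-2 * s k) else 0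
  set o2 := ∑ k ∈ Finset.range (b + 1), if ¬ ∀ j ≤ k, s' j < Γ then Real.exp (-2 * s' k) else 0
  have ht1 : 0 ≤ t1 := Finset.sum_nonneg fun k _ => by split_ifs <;> positivity
  have ht2 : 0 ≤ t2 := Finset.sum_nonneg fun k _ => by split_ifs <;> positivity
  have ho1 : 0 ≤ o1 := Finset.sum_nonneg fun k _ => by split_ifs <;> positivity
  have ho2 : 0 ≤ o2 := Finset.sum_nonneg fun k _ => by split_ifs <;> positivity
  have hle : ∀ (u : ℕ → ℝ) (c : ℕ), (∑ k ∈ Finset.range c,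
      if k ≤ n ∧ ∀ j ≤ k, u j < Γ then Real.exp (-2 * u k) else 0) ≤
      ∑ k ∈ Finset.range (n + 1), Real.exp (-2 * u k) := by
    intro u c
    rw [← Finset.sum_filter]
    refine Finset.sum_le_sum_of_subset_of_nonneg (fun k hk => ?_) fun _ _ _ => (Real.exp_pos _).le
    have := (Finset.mem_filter.1 hk).2.1
    exact Finset.mem_range.2 (by omega)
  have hle' : ∀ (u : ℕ → ℝ) (c : ℕ), (∀ k ≤ c, 0 ≤ u k) → (∑ k ∈ Finset.range (c + 1),
      if k ≤ n ∧ ∀ j ≤ k, u j < Γ then Real.exp (-2 * u k) else 0) ≤ n + 1 := by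
    intro u c hu
    rw [← Finset.sum_filter]
    have h1 : ∀ k ∈ (Finset.range (c + 1)).filter fun k => k ≤ n ∧ ∀ j ≤ k, u j < Γ,
        Real.exp (-2 * u k) ≤ 1 := fun k hk => by
      have := hu k (by have := Finset.mem_range.1 (Finset.mem_filter.1 hk).1; omega)
      exact Real.exp_le_one_iff.2 (by linarith)
    refine (Finset.sum_le_card_nsmul _ _ 1 h1).trans ?_
    have h2 : ((Finset.range (c + 1)).filter fun k => k ≤ n ∧ ∀ j ≤ k, u j < Γ) ⊆
        Finset.range (n + 1) := fun k hk => by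
      have := (Finset.mem_filter.1 hk).2.1
      exact Finset.mem_range.2 (by omega)
    have h3 := Finset.card_le_card h2
    rw [Finset.card_range] at h3
    rw [nsmul_eq_mul, mul_one]
    exact_mod_cast h3
  have hone : ∀ (u : ℕ → ℝ) (c : ℕ), u 0 = 0 → 1 ≤ ∑ k ∈ Finset.range (c + 1),
      if k ≤ n ∧ ∀ j ≤ k, u j < Γ then Real.exp (-2 * u k) else 0 := by
    intro u c hu
    have := Finset.single_le_sum (s := Finset.range (c + 1))
      (f := fun k => if k ≤ n ∧ ∀ j ≤ k, u j < Γ then Real.exp (-2 * u k) else 0)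
      (fun k _ => by split_ifs <;> positivity) (Finset.mem_range.2 (Nat.succ_pos c))
    refine le_trans ?_ this
    have h0 : (0 ≤ n ∧ ∀ j ≤ 0, u j < Γ) := ⟨Nat.zero_le _, fun j hj => by
      rw [Nat.le_zero.1 hj, hu]; exact hΓ⟩
    rw [if_pos h0, hu]; simp
  have h11 := hone s a h.zero_left
  have h12 := hone s' b h.zero_right
  -- Time 0 is counted in both halves, hence the -1.
  have hY : 1 ≤ y1 - 1 + y2 := by linarith
  have htot : ∑ k ∈ Finset.range a, Real.exp (-2 * s (k + 1)) +
      ∑ k ∈ Finset.range (b + 1), Real.exp (-2 * s' k) =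
      (y1 - 1 + y2) + (t1 + o1 + t2 + o2) := by linarith
  rw [htot]
  have hlog : Real.log ((y1 - 1 + y2) + (t1 + o1 + t2 + o2)) ≤
      Real.log (y1 - 1 + y2) + (t1 + o1 + t2 + o2) := by
    have h0 : 0 < y1 - 1 + y2 := by linarith
    have hT : 0 ≤ t1 + o1 + t2 + o2 := by linarith
    have : (y1 - 1 + y2) + (t1 + o1 + t2 + o2) =
        (y1 - 1 + y2) * (1 + (t1 + o1 + t2 + o2) / (y1 - 1 + y2)) := by field_simp
    rw [this, Real.log_mul h0.ne' (by positivity)]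
    have h3 := Real.log_le_sub_one_of_pos
      (show 0 < 1 + (t1 + o1 + t2 + o2) / (y1 - 1 + y2) by positivity)
    have h4 : (t1 + o1 + t2 + o2) / (y1 - 1 + y2) ≤ t1 + o1 + t2 + o2 := div_le_self hT hY
    linarith
  have hfin : Real.log (y1 - 1 + y2) ≤
      if (∀ j < n + 1, s j < Γ / 2) ∧ (∀ j < n + 1, s' j < Γ / 2)
        then Real.log (windowSum n s s') else Real.log (2 * n + 1) := by
    split_ifs with hc
    · refine Real.log_le_log (by linarith) ?_
      have h1 : y1 ≤ _ := hle s (a + 1)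
      have h2 : y2 ≤ _ := hle s' (b + 1)
      rw [Finset.sum_range_succ' (fun k => Real.exp (-2 * s k)) n, h.zero_left] at h1
      simp only [mul_zero, Real.exp_zero] at h1
      unfold windowSum
      linarith
    · refine Real.log_le_log (by linarith) ?_
      have h1 := hle' s a h.nonneg_left
      have h2 := hle' s' b h.nonneg_right
      linarith
  linarith

end SlopeData

/-! ### Slopes and the increments before, inside and after them -/

/-- The event that the part of the walk before time `M` ends with a `Γ`-maximum. -/
def beforeSlope (Γ : ℝ) (M : ℕ) : Set (ℕ → ℝ) :=
  {w | (∀ i < M, partialSum w i < partialSum w M) ∧ ¬ HasDrop (partialSum w) Γ 0 M}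

/-- The event that a slope, seen backwards from its minimum, has length `d`. -/
def insideSlope (Γ : ℝ) (d : ℕ) : Set (ℕ → ℝ) :=
  (staysIn (Set.Ioi 0) 0 d ∩ peak Γ d) ∩ {w | Γ ≤ partialSum w d}

section Paths

variable {w : ℕ → ℝ} {Γ : ℝ}

/-- Regroups the conditions by independent blocks of increments. Strict inequalities to the left of
the first minimum and weak ones to the right are the reason for the two half-lines `(0, ∞)` and `[0,
∞)`. -/
lemma isSlope_iff {M d : ℕ} : IsSlope (partialSum w) Γ M (M + d) ↔
    w ∈ beforeSlope Γ M ∧ backSeq (M + d) w ∈ insideSlope Γ d ∧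
      shiftSeq (M + d) w ∈ reach (Set.Ici 0) Γ 0 := by
  have hb : ∀ k ≤ d, partialSum (backSeq (M + d) w) k =
      partialSum w (M + d - k) - partialSum w (M + d) := fun k hk =>
    partialSum_backSeq w (by omega)
  have hbM : partialSum (backSeq (M + d) w) d = partialSum w M - partialSum w (M + d) := by
    rw [hb d le_rfl, Nat.add_sub_cancel]
  constructor
  · intro h
    refine ⟨⟨h.lt_left, h.not_drop⟩, ⟨⟨fun j h1 h2 => ?_, fun j hj => ?_, ?_⟩, ?_⟩, ?_⟩
    · rw [hb j h2]
      have := h.lt_mid (M + d - j) (by omega) (by omega)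
      simp only [zero_add, Set.mem_Ioi]; linarith
    · rw [hb j hj, hbM]
      have := h.le_max (M + d - j) (by omega) (by omega)
      linarith
    · rintro ⟨i, j, h1, h2, h3, h4⟩
      rw [hb i (by omega), hb j h3] at h4
      exact h.not_rise ⟨M + d - j, M + d - i, by omega, by omega, by omega, by linarith⟩
    · show Γ ≤ _
      rw [hbM]; linarith [h.height]
    · obtain ⟨n, h1, h2, h3⟩ := h.right
      refine ⟨n - (M + d), ?_, fun j h4 h5 => ?_⟩
      · rw [partialSum_shiftSeq, Nat.add_sub_cancel' h1]; linarith
      · rw [partialSum_shiftSeq]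
        have := h3 (M + d + j) (by omega) (by omega)
        simp only [zero_add, Set.mem_Ici]; linarith
  · rintro ⟨⟨h1, h2⟩, ⟨⟨h3, h4, h5⟩, h6⟩, n, h7, h8⟩
    have h6 : Γ ≤ partialSum (backSeq (M + d) w) d := h6
    refine ⟨by omega, h1, h2, fun j hj hjn => ?_, ?_, fun j hj hjn => ?_, ?_, M + d + n, by omega,
      ?_, fun j hj hjn => ?_⟩
    · have := h3 (M + d - j) (by omega) (by omega)
      rw [hb _ (by omega), show M + d - (M + d - j) = j by omega] at this
      simp only [zero_add, Set.mem_Ioi] at this; linarith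
    · rintro ⟨i, j, g1, g2, g3, g4⟩
      refine h5 ⟨M + d - j, M + d - i, by omega, by omega, by omega, ?_⟩
      rw [hb _ (by omega), hb _ (by omega), show M + d - (M + d - j) = j by omega,
        show M + d - (M + d - i) = i by omega]
      linarith
    · have := h4 (M + d - j) (by omega)
      rw [hb _ (by omega), hbM, show M + d - (M + d - j) = j by omega] at this
      linarith
    · rw [hbM] at h6; linarith
    · rw [partialSum_shiftSeq] at h7; linarith
    · rcases Nat.lt_or_ge (M + d) j with h | h
      · have := h8 (j - (M + d)) (by omega) (by omega)
        rw [partialSum_shiftSeq, Nat.add_sub_cancel' hj] at this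
        simp only [zero_add, Set.mem_Ici] at this; linarith
      · rw [show j = M + d by omega]

/-- The two-sided environment in terms of the increments on both sides of the minimum. -/
lemma slopeData (hΓ : 0 < Γ) (hbelow : ∀ a, ∃ n, partialSum w n ≤ a)
    (habove : ∀ a, ∃ n, a ≤ partialSum w n) :
    SlopeData w Γ (uFirst (partialSum w) Γ 2 - uFirst (partialSum w) Γ 1)
      (uLast (partialSum w) Γ 3 - uFirst (partialSum w) Γ 2)
      (partialSum (backSeq (uFirst (partialSum w) Γ 2) w))
      (partialSum (shiftSeq (uFirst (partialSum w) Γ 2) w)) := by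
  have h := isSlope_uFirst hΓ hbelow habove
  obtain ⟨t, g1, g2, g3, g4, g5, g6, g7, g8⟩ := uLast_three_spec hΓ hbelow habove
  have hle := h.le
  set M := uFirst (partialSum w) Γ 1 with hM
  set N := uFirst (partialSum w) Γ 2 with hN
  set L := uLast (partialSum w) Γ 3 with hL
  refine ⟨?_, ?_, fun k hk => ?_, fun k => ?_, fun k hk => ?_, fun k hk => ?_, by simp, by simp,
    ?_, t - N, by omega, ?_⟩
  · rw [leftEnd]; omega
  · rw [rightEnd]; omega
  · rw [envWalk, partialSum_backSeq w (by omega)]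
    congr 2
    omega
  · rw [envWalk, partialSum_shiftSeq]
    congr 2
  · rw [partialSum_backSeq w (by omega)]
    rcases Nat.eq_zero_or_pos k with rfl | hk0
    · simp
    · have := h.lt_mid (N - k) (by omega) (by omega)
      linarith
  · rw [partialSum_shiftSeq]
    rcases Nat.lt_or_ge t (N + k) with h' | h'
    -- At time t the path is at least Γ above the minimum, and from t to `L` it does not drop by Γ.
    · have h6 : partialSum w (N + k) > partialSum w t - Γ := by
        by_contra hc
        exact g7 ⟨t, N + k, le_rfl, h'.le, by omega, by linarith⟩
      linarith
    · have := g5 (N + k) (by omega) h'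
      linarith
  · rw [partialSum_backSeq w (by omega), show N - (N - M) = M by omega]
    linarith [h.height]
  · rw [partialSum_shiftSeq, show N + (t - N) = t by omega]; linarith

lemma ofReal_exp_neg_two (x : ℝ) : ENNReal.ofReal (Real.exp (-2 * x)) = expE (-2 * x) := rfl

open Classical in
lemma ofReal_sum_ite_mid {Γ : ℝ} {n a : ℕ} (v : ℕ → ℝ) :
    ENNReal.ofReal (∑ k ∈ Finset.range a, if n + 1 ≤ k ∧ ∀ j ≤ k, partialSum v j < Γ
      then Real.exp (-2 * partialSum v k) else 0) =
    ∑ k ∈ Finset.range a, midTerm Γ n k v := by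
  rw [ENNReal.ofReal_sum_of_nonneg fun k _ => by split_ifs <;> positivity]
  refine Finset.sum_congr rfl fun k _ => ?_
  unfold midTerm
  have e : v ∈ below Γ (k + 1) ↔ ∀ j ≤ k, partialSum v j < Γ := by
    simp only [below, Set.mem_ofPred_eq, Nat.lt_succ_iff]
  by_cases h1 : n + 1 ≤ k
  · by_cases h2 : ∀ j ≤ k, partialSum v j < Γ
    · rw [if_pos ⟨h1, h2⟩, if_pos h1, Set.indicator_of_mem (e.2 h2)]; rfl
    · rw [if_neg fun h => h2 h.2, if_pos h1, Set.indicator_of_notMem fun h => h2 (e.1 h)]; simp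
  · rw [if_neg fun h => h1 h.1, if_neg h1]; simp

-- Terms before the first passage vanish. Afterwards S_m ≥ Γ allows comparison with a walk restarted
-- at height exactly Γ.
open Classical in
lemma ofReal_sum_ite_outer {Γ : ℝ} {m a : ℕ} {v : ℕ → ℝ} (hm : v ∈ firstAbove Γ m) (hma : m ≤ a) :
    ENNReal.ofReal (∑ k ∈ Finset.range (a + 1), if ¬ ∀ j ≤ k, partialSum v j < Γ
      then Real.exp (-2 * partialSum v k) else 0) ≤ runSum Γ (a - m) (shiftSeq m v) := by
  rw [ENNReal.ofReal_sum_of_nonneg fun k _ => by split_ifs <;> positivity]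
  rw [runSum, show a + 1 = m + (a - m + 1) by omega, Finset.sum_range_add]
  have h0 : ∑ k ∈ Finset.range m, ENNReal.ofReal (if ¬ ∀ j ≤ k, partialSum v j < Γ
      then Real.exp (-2 * partialSum v k) else 0) = 0 := by
    refine Finset.sum_eq_zero fun k hk => ?_
    rw [if_neg, ENNReal.ofReal_zero]
    have := Finset.mem_range.1 hk
    exact not_not.2 fun j hj => hm.2 j (by omega)
  rw [h0, zero_add]
  refine Finset.sum_le_sum fun i _ => ?_
  have h1 : ¬ ∀ j ≤ m + i, partialSum v j < Γ := fun h =>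
    absurd hm.1 (not_le.2 (h m (by omega)))
  rw [if_pos h1, ofReal_exp_neg_two, partialSum_shiftSeq]
  refine expE_mono ?_
  have := hm.1
  linarith

open Classical in
/-- Pathwise upper bound for the logarithm of the full sum. -/
lemma ofReal_logSumFull_le (hΓ : 0 < Γ) (hbelow : ∀ a, ∃ n, partialSum w n ≤ a)
    (habove : ∀ a, ∃ n, a ≤ partialSum w n) (n : ℕ) {M d : ℕ}
    (hs : IsSlope (partialSum w) Γ M (M + d)) :
    ENNReal.ofReal (logSumFull (partialSum w) Γ) ≤
      (if backSeq (M + d) w ∈ below (Γ / 2) (n + 1) ∧ shiftSeq (M + d) w ∈ below (Γ / 2) (n + 1)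
        then ENNReal.ofReal (Real.log (windowSum n (partialSum (backSeq (M + d) w))
          (partialSum (shiftSeq (M + d) w))))
        else ENNReal.ofReal (Real.log (2 * n + 1))) +
      ((∑ k ∈ Finset.range (d + 1), midTerm Γ n k (backSeq (M + d) w)) +
        outerLeft Γ d (backSeq (M + d) w)) +
      ((∑' k, midTerm Γ n k (shiftSeq (M + d) w)) + outerRight Γ (shiftSeq (M + d) w)) := by
  have h := slopeData hΓ hbelow habove
  obtain ⟨rfl, hN⟩ := hs.unique (isSlope_uFirst hΓ hbelow habove)
  obtain ⟨t, g1, g2, g3, g4, g5, g6, g7, e, ge, g8, g9⟩ := uLast_three_spec hΓ hbelow habove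
  rw [← hN] at h g1 g3 g4 g5
  rw [Nat.add_sub_cancel_left] at h
  set M := uFirst (partialSum w) Γ 1
  set L := uLast (partialSum w) Γ 3
  set v := backSeq (M + d) w
  set w' := shiftSeq (M + d) w with hw'
  have h1 := ENNReal.ofReal_le_ofReal (h.logSumFull_le hΓ n)
  refine h1.trans ?_
  have hor : ENNReal.ofReal (∑ k ∈ Finset.range (d + 1), if ¬ ∀ j ≤ k, partialSum v j < Γ
      then Real.exp (-2 * partialSum v k) else 0) ≤ outerLeft Γ d v := by
    have hex : ∃ m, Γ ≤ partialSum v m := ⟨d, h.high_left⟩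
    have hmd : Nat.find hex ≤ d := Nat.find_min' hex h.high_left
    have hm : v ∈ firstAbove Γ (Nat.find hex) :=
      ⟨Nat.find_spec hex, fun j hj => not_le.1 (Nat.find_min hex hj)⟩
    refine (ofReal_sum_ite_outer hm hmd).trans ?_
    have := Finset.single_le_sum (s := Finset.range (d + 1)) (f := fun m =>
      (firstAbove Γ m).indicator (fun w => runSum Γ (d - m) (shiftSeq m w)) v)
      (fun _ _ => zero_le) (Finset.mem_range.2 (Nat.lt_succ_of_le hmd))
    refine le_trans (le_of_eq ?_) this
    rw [Set.indicator_of_mem hm]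
  have hol : ENNReal.ofReal (∑ k ∈ Finset.range (L - (M + d) + 1),
      if ¬ ∀ j ≤ k, partialSum w' j < Γ
      then Real.exp (-2 * partialSum w' k) else 0) ≤ outerRight Γ w' := by
    -- The phase boundary t is the first passage of the right half above Γ, and `L` is then a peak
    -- followed by a fall.
    have hm : w' ∈ firstAbove Γ (t - (M + d)) := by
      refine ⟨?_, fun j hj => ?_⟩
      · rw [partialSum_shiftSeq, show M + d + (t - (M + d)) = t by omega]; linarith
      · rw [partialSum_shiftSeq]
        have := g4 (M + d + j) (by omega) (by omega)
        linarith
    have hst : shiftSeq (t - (M + d)) w' = shiftSeq t w := by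
      rw [hw', shiftSeq_shiftSeq, show M + d + (t - (M + d)) = t by omega]
    refine (ofReal_sum_ite_outer hm (by omega)).trans ?_
    refine le_trans ?_ (ENNReal.le_tsum (t - (M + d)))
    rw [Set.indicator_of_mem hm, hst]
    refine le_trans ?_ (ENNReal.le_tsum (L - t))
    rw [Set.indicator_of_mem, show L - (M + d) - (t - (M + d)) = L - t by omega]
    refine ⟨⟨fun j hj => ?_, ?_⟩, e - L, ?_, fun j hj1 hj2 => ?_⟩
    · rw [partialSum_shiftSeq, partialSum_shiftSeq, show t + (L - t) = L by omega]
      have := g6 (t + j) (by omega) (by omega)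
      linarith
    · rintro ⟨i, j, q1, q2, q3, q4⟩
      rw [partialSum_shiftSeq, partialSum_shiftSeq] at q4
      exact g7 ⟨t + i, t + j, by omega, by omega, by omega, by linarith⟩
    · rw [shiftSeq_shiftSeq, partialSum_shiftSeq, show t + (L - t) = L by omega,
        show L + (e - L) = e by omega]
      linarith
    · rw [shiftSeq_shiftSeq, partialSum_shiftSeq, show t + (L - t) = L by omega]
      have := g9 (L + j) (by omega) (by omega)
      linarith
  refine (ENNReal.ofReal_add_le).trans ?_
  refine le_trans (add_le_add_left (ENNReal.ofReal_add_le.trans (add_le_add_left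
    (ENNReal.ofReal_add_le.trans (add_le_add_left ENNReal.ofReal_add_le _)) _)) _) ?_
  rw [ofReal_sum_ite_mid, ofReal_sum_ite_mid]
  have hmid : ∑ k ∈ Finset.range (L - (M + d) + 1), midTerm Γ n k w' ≤ ∑' k, midTerm Γ n k w' :=
    ENNReal.sum_le_tsum _
  have hif : ENNReal.ofReal (if (∀ j < n + 1, partialSum v j < Γ / 2) ∧
      (∀ j < n + 1, partialSum w' j < Γ / 2) then
      Real.log (windowSum n (partialSum v) (partialSum w')) else Real.log (2 * n + 1)) =
      if v ∈ below (Γ / 2) (n + 1) ∧ w' ∈ below (Γ / 2) (n + 1) then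
        ENNReal.ofReal (Real.log (windowSum n (partialSum v) (partialSum w')))
        else ENNReal.ofReal (Real.log (2 * n + 1)) := by
    by_cases hc : v ∈ below (Γ / 2) (n + 1) ∧ w' ∈ below (Γ / 2) (n + 1)
    · rw [if_pos hc]; exact congrArg _ (if_pos hc)
    · rw [if_neg hc]; exact congrArg _ (if_neg hc)
  rw [hif]
  simp only [← add_assoc]
  gcongr

end Paths

/-! ### The law of the environment around the minimum of a slope -/

lemma measurableSet_below (c : ℝ) (n : ℕ) : MeasurableSet (below c n) := by
  unfold below
  have := measurable_partialSum
  measurability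

lemma measurableSet_hasDrop (Γ : ℝ) (m n : ℕ) :
    MeasurableSet {w : ℕ → ℝ | HasDrop (partialSum w) Γ m n} := by
  have e : {w : ℕ → ℝ | HasDrop (partialSum w) Γ m n} = ⋃ i, ⋃ j, {w : ℕ → ℝ | m ≤ i ∧ i ≤ j ∧ j ≤ n ∧
      Γ ≤ partialSum w i - partialSum w j} := by
    ext w; simp [HasDrop]
  rw [e]
  have := measurable_partialSum
  measurability

lemma measurableSet_peak (Γ : ℝ) (l : ℕ) : MeasurableSet (peak Γ l) := by
  refine MeasurableSet.inter (s₁ := {w : ℕ → ℝ | ∀ j ≤ l, partialSum w j ≤ partialSum w l}) ?_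
    (measurableSet_hasDrop Γ 0 l).compl
  have := measurable_partialSum
  measurability

lemma measurableSet_fall (Γ : ℝ) : MeasurableSet (fall Γ) := by
  unfold fall
  have := measurable_partialSum
  measurability

lemma measurableSet_firstAbove (Γ : ℝ) (m : ℕ) : MeasurableSet (firstAbove Γ m) := by
  unfold firstAbove
  have := measurable_partialSum
  measurability

lemma measurableSet_beforeSlope (Γ : ℝ) (M : ℕ) : MeasurableSet (beforeSlope Γ M) := by
  refine MeasurableSet.inter (s₁ := {w : ℕ → ℝ | ∀ i < M, partialSum w i < partialSum w M}) ?_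
    (measurableSet_hasDrop Γ 0 M).compl
  have := measurable_partialSum
  measurability

lemma measurableSet_insideSlope (Γ : ℝ) (d : ℕ) : MeasurableSet (insideSlope Γ d) :=
  ((measurableSet_staysIn measurableSet_Ioi 0 d).inter (measurableSet_peak Γ d)).inter
    (measurableSet_le measurable_const (measurable_partialSum d))

lemma measurable_backSeq (N : ℕ) : Measurable (backSeq N) := by
  have := measurable_revSeq N
  exact measurable_pi_iff.2 fun i => ((measurable_pi_apply i).comp this).neg

lemma measurable_runSum (Γ : ℝ) (l : ℕ) : Measurable (runSum Γ l) := by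
  unfold runSum
  have := measurable_partialSum
  have := measurable_expE
  fun_prop

lemma measurable_midTerm (Γ : ℝ) (n k : ℕ) : Measurable (midTerm Γ n k) := by
  unfold midTerm
  split_ifs
  · refine Measurable.indicator ?_ (measurableSet_below _ _)
    have := measurable_partialSum
    have := measurable_expE
    fun_prop
  · exact measurable_const

lemma measurable_outerLeft (Γ : ℝ) (d : ℕ) : Measurable (outerLeft Γ d) := by
  unfold outerLeft
  refine Finset.measurable_fun_sum _ fun m _ => Measurable.indicator ?_ (measurableSet_firstAbove _ _)
  exact (measurable_runSum Γ _).comp (measurable_shiftSeq m)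

lemma measurable_outerRight (Γ : ℝ) : Measurable (outerRight Γ) := by
  unfold outerRight
  refine Measurable.tsum fun m => Measurable.indicator ?_ (measurableSet_firstAbove _ _)
  refine Measurable.tsum fun l => ?_
  exact ((measurable_runSum Γ l).indicator ((measurableSet_peak Γ l).inter
    (measurable_shiftSeq l (measurableSet_fall Γ)))).comp (measurable_shiftSeq m)

lemma dependsOn_below {c : ℝ} {n m : ℕ} (h : n ≤ m + 1) :
    DependsOn (fun w => w ∈ below c n) (Set.Iio m) := by
  refine dependsOn_of_partialSum fun w w' hw => ?_
  simp only [below, Set.mem_ofPred_eq]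
  grind

lemma dependsOn_hasDrop (Γ : ℝ) (m n : ℕ) :
    DependsOn (fun w => HasDrop (partialSum w) Γ m n) (Set.Iio n) := by
  refine dependsOn_of_partialSum fun w w' hw => ?_
  refine propext ⟨?_, ?_⟩ <;> rintro ⟨i, j, h1, h2, h3, h4⟩ <;>
    refine ⟨i, j, h1, h2, h3, ?_⟩ <;> have := hw i (by omega) <;> have := hw j (by omega) <;>
    linarith

lemma dependsOn_peak (Γ : ℝ) (l : ℕ) : DependsOn (fun w => w ∈ peak Γ l) (Set.Iio l) := by
  intro w w' hw
  have h1 : ∀ k ≤ l, partialSum w k = partialSum w' k := fun k hk => dependsOn_partialSum hk hw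
  have h2 : HasDrop (partialSum w) Γ 0 l = HasDrop (partialSum w') Γ 0 l := dependsOn_hasDrop Γ 0 l hw
  simp only [peak, Set.mem_ofPred_eq, h2]
  grind

lemma dependsOn_beforeSlope (Γ : ℝ) (M : ℕ) :
    DependsOn (fun w => w ∈ beforeSlope Γ M) (Set.Iio M) := by
  intro w w' hw
  have h1 : ∀ k ≤ M, partialSum w k = partialSum w' k := fun k hk => dependsOn_partialSum hk hw
  have h2 : HasDrop (partialSum w) Γ 0 M = HasDrop (partialSum w') Γ 0 M := dependsOn_hasDrop Γ 0 M hw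
  simp only [beforeSlope, Set.mem_ofPred_eq, h2]
  grind

lemma dependsOn_insideSlope (Γ : ℝ) (d : ℕ) :
    DependsOn (fun w => w ∈ insideSlope Γ d) (Set.Iio d) := by
  intro w w' hw
  have h1 : (w ∈ peak Γ d) = (w' ∈ peak Γ d) := dependsOn_peak Γ d hw
  have h2 : (w ∈ staysIn (Set.Ioi 0) 0 d) = (w' ∈ staysIn (Set.Ioi 0) 0 d) :=
    dependsOn_staysIn _ 0 d hw
  have h3 : partialSum w d = partialSum w' d := dependsOn_partialSum le_rfl hw
  show (_ ∧ _) = (_ ∧ _)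
  simp only [Set.mem_inter_iff, h1, h2, Set.mem_ofPred_eq, h3]

lemma dependsOn_runSum (Γ : ℝ) (l : ℕ) : DependsOn (runSum Γ l) (Set.Iio l) := by
  refine dependsOn_of_partialSum fun w w' hw => Finset.sum_congr rfl fun i hi => ?_
  rw [hw i (Nat.lt_succ_iff.1 (Finset.mem_range.1 hi))]

lemma dependsOn_midTerm (Γ : ℝ) (n k : ℕ) : DependsOn (midTerm Γ n k) (Set.Iio k) := by
  unfold midTerm
  split_ifs
  · refine dependsOn_indicator (dependsOn_below le_rfl) ?_
    exact dependsOn_of_partialSum fun w w' hw => by rw [hw k le_rfl]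
  · exact fun _ _ _ => rfl

lemma dependsOn_outerLeft (Γ : ℝ) (d : ℕ) : DependsOn (outerLeft Γ d) (Set.Iio d) := by
  intro w w' hw
  have h1 : ∀ k ≤ d, partialSum w k = partialSum w' k := fun k hk => dependsOn_partialSum hk hw
  refine Finset.sum_congr rfl fun m hm => ?_
  have hm := Nat.lt_succ_iff.1 (Finset.mem_range.1 hm)
  have e1 : w ∈ firstAbove Γ m ↔ w' ∈ firstAbove Γ m := by
    simp only [firstAbove, Set.mem_ofPred_eq]; grind
  have e2 : runSum Γ (d - m) (shiftSeq m w) = runSum Γ (d - m) (shiftSeq m w') := by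
    refine dependsOn_runSum Γ (d - m) fun i hi => ?_
    exact hw (m + i) (by have : i < d - m := hi; show m + i < d; omega)
  by_cases h : w ∈ firstAbove Γ m
  · rw [Set.indicator_of_mem h, Set.indicator_of_mem (e1.1 h), e2]
  · rw [Set.indicator_of_notMem h, Set.indicator_of_notMem fun hh => h (e1.2 hh)]

/-- The sum of `G` over all slopes, where `G` is a function of the length of the slope and of the
increments on both sides of its minimum. There is almost surely exactly one slope. -/
noncomputable def slopeSum (Γ : ℝ) (G : ℕ → (ℕ → ℝ) → (ℕ → ℝ) → ℝ≥0∞) (w : ℕ → ℝ) : ℝ≥0∞ :=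
  ∑' M, ∑' d, (beforeSlope Γ M).indicator 1 w *
    (insideSlope Γ d).indicator (fun v => (reach (Set.Ici 0) Γ 0).indicator (G d v)
      (shiftSeq d (shiftSeq M w))) (backSeq d (shiftSeq M w))

lemma backSeq_apply_shiftSeq (M d : ℕ) (w : ℕ → ℝ) {i : ℕ} (hi : i < d) :
    backSeq d (shiftSeq M w) i = backSeq (M + d) w i := by
  simp only [backSeq, revSeq, shiftSeq]
  grind

/-- Every nonzero term exhibits a slope, and slopes are unique. The dependence hypothesis is needed
because the reversed block of the shifted sequence agrees with that of w only in its first d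
entries. -/
lemma slopeSum_eq {Γ : ℝ} {G : ℕ → (ℕ → ℝ) → (ℕ → ℝ) → ℝ≥0∞}
    (hd : ∀ d w', DependsOn (fun v => G d v w') (Set.Iio d)) {w : ℕ → ℝ} {M d : ℕ}
    (h : IsSlope (partialSum w) Γ M (M + d)) :
    slopeSum Γ G w = G d (backSeq (M + d) w) (shiftSeq (M + d) w) := by
  have key : ∀ M' d', (beforeSlope Γ M').indicator 1 w *
      (insideSlope Γ d').indicator (fun v => (reach (Set.Ici 0) Γ 0).indicator (G d' v)
        (shiftSeq d' (shiftSeq M' w))) (backSeq d' (shiftSeq M' w)) =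
      (beforeSlope Γ M').indicator 1 w * (insideSlope Γ d').indicator (fun v =>
        (reach (Set.Ici 0) Γ 0).indicator (G d' v)
        (shiftSeq (M' + d') w)) (backSeq (M' + d') w) := by
    intro M' d'
    rw [shiftSeq_shiftSeq]
    congr 1
    refine dependsOn_indicator (dependsOn_insideSlope Γ d') (f := fun v =>
      (reach (Set.Ici 0) Γ 0).indicator (G d' v) (shiftSeq (M' + d') w)) ?_
      fun i hi => backSeq_apply_shiftSeq M' d' w hi
    intro v v' hv
    by_cases hr : shiftSeq (M' + d') w ∈ reach (Set.Ici 0) Γ 0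
    · simp only [Set.indicator_of_mem hr]; exact hd d' _ hv
    · simp only [Set.indicator_of_notMem hr]
  have hzero : ∀ M' d', ¬ (M' = M ∧ d' = d) → (beforeSlope Γ M').indicator 1 w *
      (insideSlope Γ d').indicator (fun v => (reach (Set.Ici 0) Γ 0).indicator (G d' v)
        (shiftSeq d' (shiftSeq M' w))) (backSeq d' (shiftSeq M' w)) = 0 := by
    intro M' d' hne
    rw [key]
    by_contra hc
    obtain ⟨h1, h2⟩ := mul_ne_zero_iff.1 hc
    have h1 := Set.mem_of_indicator_ne_zero h1
    have h3 := Set.mem_of_indicator_ne_zero h2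
    rw [Set.indicator_of_mem h3] at h2
    have h4 := Set.mem_of_indicator_ne_zero h2
    have := h.unique (isSlope_iff.2 ⟨h1, h3, h4⟩)
    omega
  obtain ⟨h1, h2, h3⟩ := isSlope_iff.1 h
  rw [slopeSum, tsum_eq_single M, tsum_eq_single d, key, Set.indicator_of_mem h1,
    Set.indicator_of_mem h2, Set.indicator_of_mem h3, Pi.one_apply, one_mul]
  · exact fun d' hd' => hzero M d' fun hh => hd' hh.2
  · intro M' hM'
    exact ENNReal.tsum_eq_zero.2 fun d' => hzero M' d' fun hh => hM' hh.1

section Law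

variable (μ : Measure ℝ) [IsProbabilityMeasure μ]

lemma measurePreserving_backSeq (d : ℕ) :
    MeasurePreserving (backSeq d) (iid μ) (iid (μ.map fun x => -x)) :=
  (measurePreserving_neg_seq μ).comp (measurePreserving_revSeq μ d)

/-- Summing over deterministic cuts at M and M + d makes the three blocks independent, so no strong
Markov property is needed. -/
lemma lintegral_slopeSum (Γ : ℝ) {G : ℕ → (ℕ → ℝ) → (ℕ → ℝ) → ℝ≥0∞}
    (hG : ∀ d, Measurable (Function.uncurry (G d)))
    (hd : ∀ d w', DependsOn (fun v => G d v w') (Set.Iio d)) :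
    ∫⁻ w, slopeSum Γ G w ∂(iid μ) = (∑' M, iid μ (beforeSlope Γ M)) *
      ∑' d, ∫⁻ v in insideSlope Γ d, ∫⁻ w' in reach (Set.Ici 0) Γ 0, G d v w' ∂(iid μ)
        ∂(iid (μ.map fun x => -x)) := by
  set H : ℕ → (ℕ → ℝ) → (ℕ → ℝ) → ℝ≥0∞ := fun d v w' => (insideSlope Γ d).indicator (fun v =>
    (reach (Set.Ici 0) Γ 0).indicator (G d v) w') v with hH
  have hr := measurableSet_reach (K := Set.Ici 0) measurableSet_Ici Γ 0
  have hHm : ∀ d, Measurable (Function.uncurry (H d)) := by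
    intro d
    have e : Function.uncurry (H d) = (insideSlope Γ d ×ˢ reach (Set.Ici 0) Γ 0).indicator
        (Function.uncurry (G d)) := by
      ext ⟨v, w'⟩
      by_cases h1 : v ∈ insideSlope Γ d <;> by_cases h2 : w' ∈ reach (Set.Ici 0) Γ 0 <;>
        simp [hH, Function.uncurry, h1, h2]
    rw [e]
    exact (hG d).indicator ((measurableSet_insideSlope Γ d).prod hr)
  have hHd : ∀ d w', DependsOn (fun v => H d v w') (Set.Iio d) := by
    intro d w'
    refine dependsOn_indicator (dependsOn_insideSlope Γ d) ?_
    intro v v' hv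
    by_cases hr : w' ∈ reach (Set.Ici 0) Γ 0
    · simp only [Set.indicator_of_mem hr]; exact hd d _ hv
    · simp only [Set.indicator_of_notMem hr]
  have hterm : ∀ d, Measurable fun u => H d (backSeq d u) (shiftSeq d u) := fun d =>
    (hHm d).comp ((measurable_backSeq d).prodMk (measurable_shiftSeq d))
  have hone : ∀ d, ∫⁻ u, H d (backSeq d u) (shiftSeq d u) ∂(iid μ) =
      ∫⁻ v in insideSlope Γ d, ∫⁻ w' in reach (Set.Ici 0) Γ 0, G d v w' ∂(iid μ)
        ∂(iid (μ.map fun x => -x)) := by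
    intro d
    rw [lintegral_concatSeq μ d (hterm d)]
    have e : ∀ u w', H d (backSeq d (concatSeq d u w')) (shiftSeq d (concatSeq d u w')) =
        H d (backSeq d u) w' := by
      intro u w'
      rw [shiftSeq_concatSeq]
      refine hHd d w' fun i hi => ?_
      have hi : i < d := hi
      simp only [backSeq, revSeq]
      rw [if_pos hi, if_pos hi, concatSeq_apply_lt _ _ _ (by omega)]
    simp only [e]
    rw [(measurePreserving_backSeq μ d).lintegral_comp (f := fun v => ∫⁻ w', H d v w' ∂(iid μ))
      (hHm d).lintegral_prod_right, ← lintegral_indicator (measurableSet_insideSlope Γ d)]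
    refine lintegral_congr fun v => ?_
    by_cases hv : v ∈ insideSlope Γ d
    · simp only [hH, Set.indicator_of_mem hv]
      rw [lintegral_indicator hr]
    · simp only [hH, Set.indicator_of_notMem hv, lintegral_zero]
  have hms : ∀ M d, Measurable fun w => (beforeSlope Γ M).indicator (1 : (ℕ → ℝ) → ℝ≥0∞) w *
      H d (backSeq d (shiftSeq M w)) (shiftSeq d (shiftSeq M w)) := fun M d =>
    (measurable_one.indicator (measurableSet_beforeSlope Γ M)).mul
      ((hterm d).comp (measurable_shiftSeq M))
  have e0 : ∀ w, slopeSum Γ G w = ∑' M, ∑' d, (beforeSlope Γ M).indicator (1 : (ℕ → ℝ) → ℝ≥0∞) w *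
      H d (backSeq d (shiftSeq M w)) (shiftSeq d (shiftSeq M w)) := fun w => rfl
  simp only [e0]
  rw [lintegral_tsum fun M => (Measurable.tsum fun d => hms M d).aemeasurable,
    ← ENNReal.tsum_mul_right]
  refine tsum_congr fun M => ?_
  rw [lintegral_tsum fun d => (hms M d).aemeasurable, ← ENNReal.tsum_mul_left]
  refine tsum_congr fun d => ?_
  rw [lintegral_mul_shiftSeq μ M (G := fun u => H d (backSeq d u) (shiftSeq d u))
    (measurable_one.indicator (measurableSet_beforeSlope Γ M)) (hterm d)
    (dependsOn_indicator (dependsOn_beforeSlope Γ M) fun _ _ _ => rfl), hone,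
    lintegral_indicator_one (measurableSet_beforeSlope Γ M)]

end Law

/-- From the first passage on, the path starts at height at least Γ, so forbidding drops of size Γ
keeps it positive. Earlier values lie in [0, Γ), hence never exceed the later maximum and never
start a drop of size Γ. -/
lemma mem_insideSlope_iff {Γ : ℝ} (hΓ : 0 < Γ) {m d : ℕ} (hmd : m ≤ d) {v : ℕ → ℝ}
    (hv : v ∈ hit (Set.Ioi 0) Γ 0 m) :
    v ∈ insideSlope Γ d ↔ shiftSeq m v ∈ peak Γ (d - m) := by
  obtain ⟨h1, h2, h3⟩ := hv
  simp only [zero_add] at h1 h2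
  have h3 : ∀ j, 1 ≤ j → j ≤ m → 0 < partialSum v j := fun j ha hb => by
    simpa using h3 j ha hb
  have h0 : partialSum v 0 = 0 := partialSum_zero v
  constructor
  · rintro ⟨⟨-, h4, h5⟩, -⟩
    refine ⟨fun j hj => ?_, ?_⟩
    · rw [partialSum_shiftSeq, partialSum_shiftSeq, Nat.add_sub_cancel' hmd]
      linarith [h4 (m + j) (by omega)]
    · rintro ⟨i, j, g1, g2, g3, g4⟩
      rw [partialSum_shiftSeq, partialSum_shiftSeq] at g4
      exact h5 ⟨m + i, m + j, by omega, by omega, by omega, by linarith⟩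
  · rintro ⟨h4, h5⟩
    have hmax : ∀ j, m ≤ j → j ≤ d → partialSum v j ≤ partialSum v d := fun j ha hb => by
      have := h4 (j - m) (by omega)
      rw [partialSum_shiftSeq, partialSum_shiftSeq, Nat.add_sub_cancel' hmd,
        Nat.add_sub_cancel' ha] at this
      linarith
    have hdrop : ∀ i j, m ≤ i → i ≤ j → j ≤ d → partialSum v i - partialSum v j < Γ :=
      fun i j ha hb hc => by
        by_contra hcon
        refine h5 ⟨i - m, j - m, by omega, by omega, by omega, ?_⟩
        rw [partialSum_shiftSeq, partialSum_shiftSeq, Nat.add_sub_cancel' ha,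
          Nat.add_sub_cancel' (ha.trans hb)]
        linarith
    have hpos : ∀ j, m ≤ j → j ≤ d → 0 < partialSum v j := fun j ha hb => by
      linarith [hdrop m j le_rfl ha hb]
    refine ⟨⟨fun j ha hb => ?_, fun j hj => ?_, ?_⟩, ?_⟩
    · rw [zero_add]
      rcases le_total j m with h | h
      · exact h3 j ha h
      · exact hpos j h hb
    · rcases Nat.lt_or_ge j m with h | h
      · linarith [h2 j h, hmax m le_rfl hmd]
      · exact hmax j h hj
    · rintro ⟨i, j, -, g2, g3, g4⟩
      rcases Nat.lt_or_ge i m with hi | hi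
      · rcases Nat.lt_or_ge j m with hj | hj
        · rcases Nat.eq_zero_or_pos j with rfl | hj0
          · rw [Nat.le_zero.1 g2] at g4; linarith
          · linarith [h2 i hi, h3 j hj0 hj.le]
        · linarith [h2 i hi, hdrop m j le_rfl hj g3]
      · linarith [hdrop i j hi g2 g3]
    · exact h1.trans (hmax m le_rfl hmd)

lemma exists_hit_of_insideSlope {Γ : ℝ} {d : ℕ} {v : ℕ → ℝ} (hv : v ∈ insideSlope Γ d) :
    ∃ m ≤ d, v ∈ hit (Set.Ioi 0) Γ 0 m := by
  obtain ⟨⟨h1, -⟩, h2⟩ := hv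
  have hex : ∃ m, Γ ≤ partialSum v m := ⟨d, h2⟩
  have hle : Nat.find hex ≤ d := Nat.find_min' hex h2
  refine ⟨Nat.find hex, hle, ?_, fun j hj => ?_, fun j ha hb => h1 j ha (hb.trans hle)⟩
  · rw [zero_add]; exact Nat.find_spec hex
  · rw [zero_add]; exact not_le.1 (Nat.find_min hex hj)

lemma sum_indicator_hit {K : Set ℝ} {Γ x : ℝ} {m d : ℕ} (hmd : m ≤ d) {v : ℕ → ℝ}
    (hv : v ∈ hit K Γ x m) (f : ℕ → (ℕ → ℝ) → ℝ≥0∞) :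
    ∑ k ∈ Finset.range (d + 1), (hit K Γ x k).indicator (f k) v = f m v := by
  rw [Finset.sum_eq_single m, Set.indicator_of_mem hv]
  · intro k _ hk
    exact Set.indicator_of_notMem (fun hh => Set.disjoint_left.1 (hit_disjoint K Γ x hk) hh hv) _
  · intro h
    exact absurd (Finset.mem_range.2 (Nat.lt_succ_of_le hmd)) h

/-! ### First-passage decomposition of the reversed slope -/

section Inside

variable (ν : Measure ℝ) [IsProbabilityMeasure ν]

lemma lintegral_reach_eq_tsum {K : Set ℝ} (hK : MeasurableSet K) (Γ x : ℝ) (F : (ℕ → ℝ) → ℝ≥0∞) :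
    ∫⁻ w in reach K Γ x, F w ∂(iid ν) = ∑' m, ∫⁻ w in hit K Γ x m, F w ∂(iid ν) := by
  rw [reach_eq_iUnion_hit, lintegral_iUnion (fun m => measurableSet_hit hK Γ x m)
    (hit_disjoint K Γ x)]

/-- Decomposition of a slope, seen backwards from its minimum, at the first time above `Γ`. -/
lemma tsum_lintegral_insideSlope {Γ : ℝ} (hΓ : 0 < Γ) {Φ F G : ℕ → (ℕ → ℝ) → ℝ≥0∞}
    (hF : ∀ m, Measurable (F m)) (hFd : ∀ m, DependsOn (F m) (Set.Iio m))
    (hG : ∀ k, Measurable (G k))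
    (hΦ : ∀ d m v, m ≤ d → v ∈ hit (Set.Ioi 0) Γ 0 m → Φ d v = F m v * G (d - m) (shiftSeq m v)) :
    ∑' d, ∫⁻ v in insideSlope Γ d, Φ d v ∂(iid ν) =
      (∑' m, ∫⁻ v in hit (Set.Ioi 0) Γ 0 m, F m v ∂(iid ν)) *
        ∑' k, ∫⁻ v in peak Γ k, G k v ∂(iid ν) := by
  have hhit := fun m => measurableSet_hit (K := Set.Ioi 0) measurableSet_Ioi Γ 0 m
  have hterm : ∀ d, ∫⁻ v in insideSlope Γ d, Φ d v ∂(iid ν) =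
      ∑' m, if m ≤ d then (∫⁻ v in hit (Set.Ioi 0) Γ 0 m, F m v ∂(iid ν)) *
        ∫⁻ v in peak Γ (d - m), G (d - m) v ∂(iid ν) else 0 := by
    intro d
    -- For each path at most one first-passage time contributes to the sum.
    have hpt : ∀ v, (insideSlope Γ d).indicator (Φ d) v = ∑ m ∈ Finset.range (d + 1),
        (hit (Set.Ioi 0) Γ 0 m).indicator (F m) v *
          (peak Γ (d - m)).indicator (G (d - m)) (shiftSeq m v) := by
      intro v
      have e : ∀ k, (hit (Set.Ioi 0) Γ 0 k).indicator (F k) v *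
          (peak Γ (d - k)).indicator (G (d - k)) (shiftSeq k v) = (hit (Set.Ioi 0) Γ 0 k).indicator
          (fun v => F k v * (peak Γ (d - k)).indicator (G (d - k)) (shiftSeq k v)) v := by
        intro k
        by_cases hk : v ∈ hit (Set.Ioi 0) Γ 0 k
        · rw [Set.indicator_of_mem hk, Set.indicator_of_mem hk]
        · rw [Set.indicator_of_notMem hk, Set.indicator_of_notMem hk, zero_mul]
      simp only [e]
      by_cases hv : v ∈ insideSlope Γ d
      · obtain ⟨m, hmd, hm⟩ := exists_hit_of_insideSlope hv
        rw [Set.indicator_of_mem hv, sum_indicator_hit hmd hm fun k v => F k v *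
          (peak Γ (d - k)).indicator (G (d - k)) (shiftSeq k v), hΦ d m v hmd hm,
          Set.indicator_of_mem ((mem_insideSlope_iff hΓ hmd hm).1 hv)]
      · rw [Set.indicator_of_notMem hv]
        refine (Finset.sum_eq_zero fun m hm => ?_).symm
        have hmd := Nat.lt_succ_iff.1 (Finset.mem_range.1 hm)
        by_cases hk : v ∈ hit (Set.Ioi 0) Γ 0 m
        · rw [Set.indicator_of_mem hk, Set.indicator_of_notMem, mul_zero]
          exact fun hh => hv ((mem_insideSlope_iff hΓ hmd hk).2 hh)
        · rw [Set.indicator_of_notMem hk]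
    rw [← lintegral_indicator (measurableSet_insideSlope Γ d)]
    simp only [hpt]
    rw [lintegral_finsetSum]
    · rw [tsum_eq_sum (s := Finset.range (d + 1))]
      · refine Finset.sum_congr rfl fun m hm => ?_
        rw [if_pos (Nat.lt_succ_iff.1 (Finset.mem_range.1 hm)), lintegral_mul_shiftSeq ν m
          ((hF m).indicator (hhit m)) ((hG _).indicator (measurableSet_peak Γ _))
          (dependsOn_indicator (dependsOn_hit _ _ _ m) (hFd m)), lintegral_indicator (hhit m),
          lintegral_indicator (measurableSet_peak Γ _)]
      · intro m hm
        rw [if_neg fun h => hm (Finset.mem_range.2 (Nat.lt_succ_of_le h))]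
    · intro m _
      exact ((hF m).indicator (hhit m)).mul
        (((hG _).indicator (measurableSet_peak Γ _)).comp (measurable_shiftSeq m))
  simp only [hterm]
  rw [ENNReal.tsum_comm, ← ENNReal.tsum_mul_right]
  refine tsum_congr fun m => ?_
  rw [← ENNReal.tsum_mul_left]
  exact tsum_shift m fun k => (∫⁻ v in hit (Set.Ioi 0) Γ 0 m, F m v ∂(iid ν)) *
        ∫⁻ v in peak Γ k, G k v ∂(iid ν)

end Inside

/-! ### Expectations of functionals of the slope -/

section Peaks

variable (ν : Measure ℝ) [IsProbabilityMeasure ν]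

/-- The expected number of times at which the walk is maximal, before its first drop of `Γ`. -/
noncomputable def peakCount (Γ : ℝ) : ℝ≥0∞ := ∑' k, iid ν (peak Γ k)

/-- The expectation of the sum over these times of the exponential sums up to them. -/
noncomputable def peakRun (Γ : ℝ) : ℝ≥0∞ := ∑' k, ∫⁻ v in peak Γ k, runSum Γ k v ∂(iid ν)

/-- After a peak followed by a fall, the path is strictly below that peak until it has lost Γ. A
later peak would be too low, or would be preceded by a forbidden drop. -/
lemma peak_fall_disjoint (Γ : ℝ) :
    Pairwise (Function.onFun Disjoint fun l => peak Γ l ∩ shiftSeq l ⁻¹' fall Γ) := by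
  have key : ∀ l l', l < l' → Disjoint (peak Γ l ∩ shiftSeq l ⁻¹' fall Γ)
      (peak Γ l' ∩ shiftSeq l' ⁻¹' fall Γ) := by
    intro l l' h
    refine Set.disjoint_left.2 ?_
    rintro w ⟨-, n, h1, h2⟩ ⟨⟨h3, h4⟩, -⟩
    rw [partialSum_shiftSeq] at h1
    rcases Nat.lt_or_ge (l + n) l' with h' | h'
    · exact h4 ⟨l, l + n, by omega, by omega, by omega, by linarith⟩
    · have h5 := h2 (l' - l) (by omega) (by omega)
      rw [partialSum_shiftSeq, Nat.add_sub_cancel' h.le] at h5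
      linarith [h3 l h.le]
  intro l l' hne
  rcases lt_or_gt_of_ne hne with h | h
  · exact key l l' h
  · exact (key l' l h).symm

/-- The products are probabilities of mutually exclusive events. This normalises the outer sum on
the right, as `measure_slope_eq_one` does on the left. -/
lemma peakCount_mul_fall_le (Γ : ℝ) : peakCount ν Γ * iid ν (fall Γ) ≤ 1 := by
  rw [peakCount, ← ENNReal.tsum_mul_right]
  have e : ∀ l, iid ν (peak Γ l) * iid ν (fall Γ) =
      iid ν (peak Γ l ∩ shiftSeq l ⁻¹' fall Γ) := fun l =>
    (measure_inter_shiftSeq ν l (measurableSet_peak Γ l) (measurableSet_fall Γ)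
      (dependsOn_peak Γ l)).symm
  simp only [e]
  rw [← measure_iUnion (peak_fall_disjoint Γ) fun l =>
    (measurableSet_peak Γ l).inter (measurable_shiftSeq l (measurableSet_fall Γ))]
  exact prob_le_one

lemma tsum_lintegral_peak_one (Γ : ℝ) :
    ∑' k, ∫⁻ _ in peak Γ k, 1 ∂(iid ν) = peakCount ν Γ := by
  simp [peakCount]

lemma tsum_lintegral_hit_one {K : Set ℝ} (hK : IsHalfLine K) (Γ x : ℝ) :
    ∑' k, ∫⁻ _ in hit K Γ x k, 1 ∂(iid ν) = reachProb ν K Γ x := by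
  simp [← tsum_measure_hit ν hK]

/-- The increments up to the first passage, from there to the peak, and after the peak form
independent blocks. -/
lemma lintegral_reach_outerRight {K : Set ℝ} (hK : IsHalfLine K) (Γ : ℝ) :
    ∫⁻ w in reach K Γ 0, outerRight Γ w ∂(iid ν) =
      reachProb ν K Γ 0 * (peakRun ν Γ * iid ν (fall Γ)) := by
  set X : (ℕ → ℝ) → ℝ≥0∞ := fun u => ∑' l,
    (peak Γ l ∩ shiftSeq l ⁻¹' fall Γ).indicator (runSum Γ l) u with hX
  have hXl : ∀ l, Measurable ((peak Γ l ∩ shiftSeq l ⁻¹' fall Γ).indicator (runSum Γ l)) :=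
    fun l => (measurable_runSum Γ l).indicator ((measurableSet_peak Γ l).inter
      (measurable_shiftSeq l (measurableSet_fall Γ)))
  have hXm : Measurable X := Measurable.tsum hXl
  have hXi : ∫⁻ u, X u ∂(iid ν) = peakRun ν Γ * iid ν (fall Γ) := by
    rw [lintegral_tsum fun l => (hXl l).aemeasurable, peakRun, ← ENNReal.tsum_mul_right]
    refine tsum_congr fun l => ?_
    have e : ∀ u, (peak Γ l ∩ shiftSeq l ⁻¹' fall Γ).indicator (runSum Γ l) u =
        (peak Γ l).indicator (runSum Γ l) u * (fall Γ).indicator 1 (shiftSeq l u) := by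
      intro u
      by_cases h1 : u ∈ peak Γ l <;> by_cases h2 : shiftSeq l u ∈ fall Γ <;> simp [h1, h2]
    simp only [e]
    rw [lintegral_mul_shiftSeq ν l ((measurable_runSum Γ l).indicator (measurableSet_peak Γ l))
      (measurable_one.indicator (measurableSet_fall Γ))
      (dependsOn_indicator (dependsOn_peak Γ l) (dependsOn_runSum Γ l)),
      lintegral_indicator (measurableSet_peak Γ l),
      lintegral_indicator_one (measurableSet_fall Γ)]
  rw [lintegral_reach_eq_tsum ν hK.measurableSet, ← tsum_measure_hit ν hK, ← ENNReal.tsum_mul_right]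
  refine tsum_congr fun m => ?_
  have hhit := measurableSet_hit hK.measurableSet Γ 0 m
  rw [← lintegral_indicator hhit]
  have e : ∀ w, (hit K Γ 0 m).indicator (outerRight Γ) w =
      (hit K Γ 0 m).indicator 1 w * X (shiftSeq m w) := by
    intro w
    by_cases h : w ∈ hit K Γ 0 m
    · rw [Set.indicator_of_mem h, Set.indicator_of_mem h, Pi.one_apply, one_mul, outerRight,
        tsum_eq_single m]
      · rw [Set.indicator_of_mem]
        obtain ⟨h1, h2, -⟩ := h
        simp only [zero_add] at h1 h2
        exact ⟨h1, h2⟩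
      · intro k hk
        rw [Set.indicator_of_notMem]
        rintro ⟨h3, h4⟩
        obtain ⟨h1, h2, -⟩ := h
        simp only [zero_add] at h1 h2
        rcases lt_or_gt_of_ne hk with h' | h'
        · linarith [h2 k h']
        · linarith [h4 m h']
    · rw [Set.indicator_of_notMem h, Set.indicator_of_notMem h, zero_mul]
  simp only [e]
  rw [lintegral_mul_shiftSeq ν m (measurable_one.indicator hhit) hXm
    (dependsOn_indicator (dependsOn_hit _ _ _ m) fun _ _ _ => rfl), hXi,
    lintegral_indicator_one hhit]

end Peaks

section SlopeLaw

variable (μ : Measure ℝ) [IsProbabilityMeasure μ]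

lemma lintegral_slopeSum_eq {Γ : ℝ} (hΓ : 0 < Γ) {G : ℕ → (ℕ → ℝ) → (ℕ → ℝ) → ℝ≥0∞}
    (hG : ∀ d, Measurable (Function.uncurry (G d)))
    (hd : ∀ d w', DependsOn (fun v => G d v w') (Set.Iio d)) {F R : ℕ → (ℕ → ℝ) → ℝ≥0∞}
    (hF : ∀ m, Measurable (F m)) (hFd : ∀ m, DependsOn (F m) (Set.Iio m))
    (hR : ∀ k, Measurable (R k))
    (hΦ : ∀ d m v, m ≤ d → v ∈ hit (Set.Ioi 0) Γ 0 m →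
      ∫⁻ w' in reach (Set.Ici 0) Γ 0, G d v w' ∂(iid μ) = F m v * R (d - m) (shiftSeq m v)) :
    ∫⁻ w, slopeSum Γ G w ∂(iid μ) = (∑' M, iid μ (beforeSlope Γ M)) *
      ((∑' m, ∫⁻ v in hit (Set.Ioi 0) Γ 0 m, F m v ∂(iid (μ.map fun x => -x))) *
        ∑' k, ∫⁻ v in peak Γ k, R k v ∂(iid (μ.map fun x => -x))) := by
  rw [lintegral_slopeSum μ Γ hG hd, tsum_lintegral_insideSlope _ hΓ hF hFd hR hΦ]

lemma isHalfLine_Ici : IsHalfLine (Set.Ici (0 : ℝ)) := Or.inl rfl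

lemma isHalfLine_Ioi : IsHalfLine (Set.Ioi (0 : ℝ)) := Or.inr rfl

lemma ae_isSlope (ho : Oscillates μ) {Γ : ℝ} (hΓ : 0 < Γ) : ∀ᵐ w ∂(iid μ),
    (∀ a, ∃ n, partialSum w n ≤ a) ∧ (∀ a, ∃ n, a ≤ partialSum w n) ∧
    ∃ M d, IsSlope (partialSum w) Γ M (M + d) := by
  filter_upwards [ho.1, ho.2] with w h1 h2
  have h := isSlope_uFirst hΓ h2 h1
  obtain ⟨d, hd⟩ := Nat.exists_eq_add_of_le h.le
  exact ⟨h2, h1, _, d, hd ▸ h⟩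

/-- There is almost surely exactly one slope, so the constant functional 1 has mean 1. This lets the
sum over M and the peak count cancel without being computed. -/
lemma measure_slope_eq_one (ho : Oscillates μ) {Γ : ℝ} (hΓ : 0 < Γ) :
    (∑' M, iid μ (beforeSlope Γ M)) * (reachProb (μ.map fun x => -x) (Set.Ioi 0) Γ 0 *
      reachProb μ (Set.Ici 0) Γ 0 * peakCount (μ.map fun x => -x) Γ) = 1 := by
  have h := lintegral_slopeSum_eq μ hΓ (G := fun _ _ _ => 1) (fun _ => measurable_const)
    (fun _ _ _ _ _ => rfl) (F := fun _ _ => reachProb μ (Set.Ici 0) Γ 0) (R := fun _ _ => 1)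
    (fun _ => measurable_const) (fun _ _ _ _ => rfl) (fun _ => measurable_const)
    (fun d m v _ _ => by simp [reachProb])
  have h1 : ∫⁻ w, slopeSum Γ (fun _ _ _ => 1) w ∂(iid μ) = 1 := by
    have : ∀ᵐ w ∂(iid μ), slopeSum Γ (fun _ _ _ => 1) w = 1 := by
      filter_upwards [ae_isSlope μ ho hΓ] with w hw
      obtain ⟨-, -, M, d, hs⟩ := hw
      exact slopeSum_eq (fun _ _ _ _ _ => rfl) hs
    rw [lintegral_congr_ae this]; simp
  rw [h1, tsum_lintegral_peak_one] at h
  rw [h]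
  congr 2
  simp only [lintegral_const, Measure.restrict_apply_univ, ENNReal.tsum_mul_left]
  rw [tsum_measure_hit _ isHalfLine_Ioi, mul_comm]

/-- Functionals of the walk before it leaves a neighbourhood of the minimum. -/
lemma lintegral_slopeSum_below (ho : Oscillates μ) {Γ : ℝ} (hΓ : 0 < Γ) (n : ℕ)
    {Ψ : (ℕ → ℝ) → (ℕ → ℝ) → ℝ≥0∞} (hΨ : Measurable (Function.uncurry Ψ))
    (hd : ∀ w', DependsOn (fun v => Ψ v w') (Set.Iio n))
    (hb : ∀ v w', v ∉ below Γ (n + 1) → Ψ v w' = 0) :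
    ∫⁻ w, slopeSum Γ (fun d v w' => if n < d then Ψ v w' else 0) w ∂(iid μ) =
      (reachProb (μ.map fun x => -x) (Set.Ioi 0) Γ 0 * reachProb μ (Set.Ici 0) Γ 0)⁻¹ *
      ∫⁻ v in reach (Set.Ioi 0) Γ 0, ∫⁻ w' in reach (Set.Ici 0) Γ 0, Ψ v w' ∂(iid μ)
        ∂(iid (μ.map fun x => -x)) := by
  have hmono : ∀ {m}, n < m → ∀ w', DependsOn (fun v => Ψ v w') (Set.Iio m) := fun hm w' v v' hv =>
    hd w' fun i hi => hv i (lt_trans hi hm)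
  have hInt : Measurable fun v => ∫⁻ w' in reach (Set.Ici 0) Γ 0, Ψ v w' ∂(iid μ) :=
    hΨ.lintegral_prod_right
  -- A first passage at a time m ≤ n occurs inside the window, where `Ψ` vanishes.
  have hzero : ∀ m v, ¬ n < m → v ∈ hit (Set.Ioi 0) Γ 0 m →
      ∫⁻ w' in reach (Set.Ici 0) Γ 0, Ψ v w' ∂(iid μ) = 0 := by
    intro m v hm hv
    have : v ∉ below Γ (n + 1) := fun h => by
      have h1 := hv.1
      rw [zero_add] at h1
      exact absurd (h m (by omega)) (not_lt.2 h1)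
    simp [hb v _ this]
  rw [lintegral_slopeSum_eq μ hΓ (F := fun m v => if n < m then
      ∫⁻ w' in reach (Set.Ici 0) Γ 0, Ψ v w' ∂(iid μ) else 0) (R := fun _ _ => 1),
    tsum_lintegral_peak_one, lintegral_reach_eq_tsum _ measurableSet_Ioi]
  · have e : ∀ m, ∫⁻ v in hit (Set.Ioi 0) Γ 0 m, (if n < m then
        ∫⁻ w' in reach (Set.Ici 0) Γ 0, Ψ v w' ∂(iid μ) else 0) ∂(iid (μ.map fun x => -x)) =
        ∫⁻ v in hit (Set.Ioi 0) Γ 0 m, ∫⁻ w' in reach (Set.Ici 0) Γ 0, Ψ v w' ∂(iid μ)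
          ∂(iid (μ.map fun x => -x)) := by
      intro m
      refine setLIntegral_congr_fun (measurableSet_hit measurableSet_Ioi Γ 0 m) fun v hv => ?_
      by_cases hm : n < m
      · simp only [if_pos hm]
      · simp only [if_neg hm, hzero m v hm hv]
    simp only [e]
    -- The factors from before the slope and from its part beyond the first passage combine into the
    -- inverse of the two reach probabilities.
    have h := measure_slope_eq_one μ ho hΓ
    rw [mul_comm (_ * _ : ℝ≥0∞) (peakCount _ _), ← mul_assoc] at h
    rw [← ENNReal.eq_inv_of_mul_eq_one_left h]
    ring
  · intro d
    split_ifs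
    · exact hΨ
    · exact measurable_const
  · intro d w'
    by_cases h : n < d
    · simp only [if_pos h]; exact hmono h w'
    · simp only [if_neg h]; exact fun _ _ _ => rfl
  · intro m
    split_ifs
    · exact hInt
    · exact measurable_const
  · intro m
    by_cases h : n < m
    · simp only [if_pos h]
      intro v v' hv
      exact lintegral_congr fun w' => hmono h w' hv
    · simp only [if_neg h]; exact fun _ _ _ => rfl
  · exact fun _ => measurable_const
  · intro d m v hmd hv
    rw [mul_one]
    by_cases hm : n < m
    · simp only [if_pos hm, if_pos (hm.trans_le hmd)]
    · rw [if_neg hm]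
      by_cases hd : n < d
      · simp only [if_pos hd]; exact hzero m v hm hv
      · simp [if_neg hd]

/-- The error terms have this form: a factor up to the first passage on the left, one from there to
the maximum, and one to the right of the minimum. -/
lemma lintegral_slopeSum_mul {Γ : ℝ} (hΓ : 0 < Γ) {Φ F R : ℕ → (ℕ → ℝ) → ℝ≥0∞}
    {H : (ℕ → ℝ) → ℝ≥0∞} (hΦ : ∀ d, Measurable (Φ d)) (hΦd : ∀ d, DependsOn (Φ d) (Set.Iio d))
    (hF : ∀ m, Measurable (F m)) (hFd : ∀ m, DependsOn (F m) (Set.Iio m))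
    (hR : ∀ k, Measurable (R k)) (hH : Measurable H)
    (heq : ∀ d m v, m ≤ d → v ∈ hit (Set.Ioi 0) Γ 0 m → Φ d v = F m v * R (d - m) (shiftSeq m v)) :
    ∫⁻ w, slopeSum Γ (fun d v w' => Φ d v * H w') w ∂(iid μ) =
      (∑' M, iid μ (beforeSlope Γ M)) *
      ((∑' m, ∫⁻ v in hit (Set.Ioi 0) Γ 0 m, F m v ∂(iid (μ.map fun x => -x))) *
        (∑' k, ∫⁻ v in peak Γ k, R k v ∂(iid (μ.map fun x => -x))) *
        ∫⁻ w' in reach (Set.Ici 0) Γ 0, H w' ∂(iid μ)) := by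
  have hm : ∀ d, Measurable (Function.uncurry fun v w' => Φ d v * H w') := fun d =>
    ((hΦ d).comp measurable_fst).mul (hH.comp measurable_snd)
  rw [lintegral_slopeSum_eq μ hΓ hm (F := fun m v =>
      (∫⁻ w' in reach (Set.Ici 0) Γ 0, H w' ∂(iid μ)) * F m v) (R := R)]
  · simp only [lintegral_const_mul _ (hF _), ENNReal.tsum_mul_left]
    ring
  · intro d w' v v' hv
    simp only [hΦd d hv]
  · exact fun m => (hF m).const_mul _
  · intro m v v' hv
    simp only [hFd m hv]
  · exact hR
  · intro d m v hmd hv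
    rw [lintegral_const_mul _ hH, heq d m v hmd hv]
    ring

lemma midTerm_eq_zero {K : Set ℝ} {Γ : ℝ} {n m k : ℕ} {v : ℕ → ℝ} (hv : v ∈ hit K Γ 0 m)
    (hk : m ≤ k) : midTerm Γ n k v = 0 := by
  unfold midTerm
  split_ifs
  · refine Set.indicator_of_notMem (fun h => ?_) _
    have h1 := hv.1
    rw [zero_add] at h1
    exact absurd (h m (by omega)) (not_lt.2 h1)
  · rfl

/-- Terms from the first passage above Γ on vanish, so the rest of the slope integrates out through
the normalisation. -/
lemma lintegral_slopeSum_midLeft (ho : Oscillates μ) {Γ : ℝ} (hΓ : 0 < Γ) (n : ℕ) :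
    ∫⁻ w, slopeSum Γ (fun d v _ => (∑ k ∈ Finset.range (d + 1), midTerm Γ n k v) * 1) w ∂(iid μ) ≤
      (reachProb (μ.map fun x => -x) (Set.Ioi 0) Γ 0)⁻¹ *
      ∑' k, ∫⁻ v in reach (Set.Ioi 0) Γ 0, midTerm Γ n k v ∂(iid (μ.map fun x => -x)) := by
  have hsm : ∀ d, Measurable fun v => ∑ k ∈ Finset.range d, midTerm Γ n k v := fun d =>
    Finset.measurable_fun_sum _ fun k _ => measurable_midTerm Γ n k
  have hsd : ∀ d m, d ≤ m + 1 →
      DependsOn (fun v => ∑ k ∈ Finset.range d, midTerm Γ n k v) (Set.Iio m) := by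
    intro d m hdm v v' hv
    refine Finset.sum_congr rfl fun k hk => dependsOn_midTerm Γ n k fun i hi => hv i ?_
    have := Finset.mem_range.1 hk
    have hi : i < k := hi
    show i < m
    omega
  rw [lintegral_slopeSum_mul μ hΓ (H := fun _ => 1)
    (Φ := fun d v => ∑ k ∈ Finset.range (d + 1), midTerm Γ n k v)
    (F := fun m v => ∑ k ∈ Finset.range m, midTerm Γ n k v) (R := fun _ _ => 1)
    (fun d => hsm _) (fun d => hsd _ _ le_rfl) (fun m => hsm m) (fun m => hsd _ _ (by omega))
    (fun _ => measurable_const) measurable_const, tsum_lintegral_peak_one]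
  · have h := measure_slope_eq_one μ ho hΓ
    have h1 : ∫⁻ w' in reach (Set.Ici 0) Γ 0, 1 ∂(iid μ) = reachProb μ (Set.Ici 0) Γ 0 := by
      simp [reachProb]
    have h2 : (∑' m, ∫⁻ v in hit (Set.Ioi 0) Γ 0 m, ∑ k ∈ Finset.range m, midTerm Γ n k v
        ∂(iid (μ.map fun x => -x))) ≤
        ∑' k, ∫⁻ v in reach (Set.Ioi 0) Γ 0, midTerm Γ n k v ∂(iid (μ.map fun x => -x)) := by
      rw [← lintegral_tsum fun k => (measurable_midTerm Γ n k).aemeasurable,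
        lintegral_reach_eq_tsum _ measurableSet_Ioi]
      exact ENNReal.tsum_le_tsum fun m => lintegral_mono fun v => ENNReal.sum_le_tsum _
    rw [h1, ← ENNReal.eq_inv_of_mul_eq_one_left (a := (∑' M, iid μ (beforeSlope Γ M)) *
      (peakCount (μ.map fun x => -x) Γ * reachProb μ (Set.Ici 0) Γ 0)) (by rw [← h]; ring)]
    refine (mul_le_mul_right (mul_le_mul_left (mul_le_mul_left h2 _) _) _).trans (le_of_eq ?_)
    ring
  · intro d m v hmd hv
    rw [mul_one]
    refine (Finset.sum_subset (Finset.range_mono (by omega)) fun k _ hk => ?_).symm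
    exact midTerm_eq_zero hv (not_lt.1 fun h => hk (Finset.mem_range.2 h))

lemma lintegral_slopeSum_right (ho : Oscillates μ) {Γ : ℝ} (hΓ : 0 < Γ) {H : (ℕ → ℝ) → ℝ≥0∞}
    (hH : Measurable H) :
    ∫⁻ w, slopeSum Γ (fun _ _ w' => 1 * H w') w ∂(iid μ) =
      (reachProb μ (Set.Ici 0) Γ 0)⁻¹ * ∫⁻ w' in reach (Set.Ici 0) Γ 0, H w' ∂(iid μ) := by
  rw [lintegral_slopeSum_mul μ hΓ (Φ := fun _ _ => 1) (F := fun _ _ => 1) (R := fun _ _ => 1)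
    (fun _ => measurable_const) (fun _ _ _ _ => rfl) (fun _ => measurable_const)
    (fun _ _ _ _ => rfl) (fun _ => measurable_const) hH (fun _ _ _ _ _ => by simp),
    tsum_lintegral_peak_one, tsum_lintegral_hit_one _ isHalfLine_Ioi]
  have h := measure_slope_eq_one μ ho hΓ
  rw [← ENNReal.eq_inv_of_mul_eq_one_left (a := (∑' M, iid μ (beforeSlope Γ M)) *
      (reachProb (μ.map fun x => -x) (Set.Ioi 0) Γ 0 * peakCount (μ.map fun x => -x) Γ))
      (by rw [← h]; ring)]
  ring

lemma lintegral_slopeSum_outerRight (ho : Oscillates μ) {Γ : ℝ} (hΓ : 0 < Γ) {ε : ℝ≥0∞}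
    (hε : peakRun μ Γ ≤ ε * peakCount μ Γ) :
    ∫⁻ w, slopeSum Γ (fun _ _ w' => 1 * outerRight Γ w') w ∂(iid μ) ≤ ε := by
  rw [lintegral_slopeSum_right μ ho hΓ (measurable_outerRight Γ),
    lintegral_reach_outerRight μ isHalfLine_Ici, ← mul_assoc,
    ENNReal.inv_mul_cancel (reachProb_ne_zero ho isHalfLine_Ici Γ) (reachProb_ne_top _ _ _),
    one_mul]
  calc peakRun μ Γ * iid μ (fall Γ) ≤ ε * peakCount μ Γ * iid μ (fall Γ) := by gcongr
    _ = ε * (peakCount μ Γ * iid μ (fall Γ)) := mul_assoc _ _ _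
    _ ≤ ε * 1 := by gcongr; exact peakCount_mul_fall_le μ Γ
    _ = ε := mul_one _

/-- The left outer sum runs from the first passage to the maximum, so its mean is the normalisation
identity with `peakCount` replaced by `peakRun`. -/
lemma lintegral_slopeSum_outerLeft (ho : Oscillates μ) {Γ : ℝ} (hΓ : 0 < Γ) {ε : ℝ≥0∞}
    (hε : peakRun (μ.map fun x => -x) Γ ≤ ε * peakCount (μ.map fun x => -x) Γ) :
    ∫⁻ w, slopeSum Γ (fun d v _ => outerLeft Γ d v * 1) w ∂(iid μ) ≤ ε := by
  rw [lintegral_slopeSum_mul μ hΓ (Φ := outerLeft Γ) (F := fun _ _ => 1) (R := runSum Γ)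
    (H := fun _ => 1) (fun d => measurable_outerLeft Γ d) (dependsOn_outerLeft Γ)
    (fun _ => measurable_const) (fun _ _ _ _ => rfl) (measurable_runSum Γ) measurable_const,
    tsum_lintegral_hit_one _ isHalfLine_Ioi]
  · have h1 : ∫⁻ w' in reach (Set.Ici 0) Γ 0, 1 ∂(iid μ) = reachProb μ (Set.Ici 0) Γ 0 := by
      simp [reachProb]
    rw [h1]
    change _ * (_ * peakRun (μ.map fun x => -x) Γ * _) ≤ _
    refine (mul_le_mul_right (mul_le_mul_left (mul_le_mul_right hε _) _) _).trans (le_of_eq ?_)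
    conv_rhs => rw [← mul_one ε, ← measure_slope_eq_one μ ho hΓ]
    ring
  · intro d m v hmd hv
    obtain ⟨h1, h2, -⟩ := hv
    simp only [zero_add] at h1 h2
    rw [one_mul, outerLeft, Finset.sum_eq_single m]
    · rw [Set.indicator_of_mem]
      exact ⟨h1, h2⟩
    · intro k _ hk
      rw [Set.indicator_of_notMem]
      rintro ⟨h3, h4⟩
      rcases lt_or_gt_of_ne hk with h' | h'
      · linarith [h2 k h']
      · linarith [h4 m h']
    · intro h
      exact absurd (Finset.mem_range.2 (Nat.lt_succ_of_le hmd)) h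

end SlopeLaw

/-! ### The contribution of the walk beyond the level `Γ` -/

/-- A time i before the peak is located by the last new record m, the excursion below it, and the
return to its level, which must happen since the peak is a maximum. The absence of drops of size Γ
keeps the path above the record level minus Γ; in coordinates shifted by Γ, the return takes place
before the walk leaves `(0, ∞)`. -/
lemma exists_decomposition_of_peak {Γ : ℝ} {i q : ℕ} {w : ℕ → ℝ}
    (hw : w ∈ peak Γ (i + q)) : ∃ m ≤ i, ∃ r ≤ q, w ∈ ladder (Set.Ioi 0) m ∧
      shiftSeq m w ∈ staysIn (Set.Iic 0) 0 (i - m) ∧ -Γ < partialSum (shiftSeq m w) (i - m) ∧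
      shiftSeq i w ∈ hit (Set.Ioi 0) Γ (Γ + partialSum (shiftSeq m w) (i - m)) r ∧
      shiftSeq (i + r) w ∈ peak Γ (q - r) := by
  obtain ⟨h1, h2⟩ := hw
  have hdrop : ∀ a b, a ≤ b → b ≤ i + q → partialSum w a - partialSum w b < Γ := fun a b ha hb => by
    by_contra hc
    exact h2 ⟨a, b, Nat.zero_le _, ha, hb, not_lt.1 hc⟩
  -- the first maximum before time `i`
  have hex : ∃ m, m ≤ i ∧ ∀ j ≤ i, partialSum w j ≤ partialSum w m := by
    obtain ⟨m, hm, hm'⟩ := Finset.exists_max_image (Finset.range (i + 1)) (partialSum w) ⟨0, by simp⟩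
    exact ⟨m, Nat.lt_succ_iff.1 (Finset.mem_range.1 hm),
      fun j hj => hm' j (Finset.mem_range.2 (Nat.lt_succ_of_le hj))⟩
  set m := Nat.find hex with hm
  obtain ⟨hmi, hmax⟩ := Nat.find_spec hex
  have hfirst : ∀ j < m, partialSum w j < partialSum w m := by
    intro j hj
    by_contra hc
    exact Nat.find_min hex hj ⟨by omega, fun k hk => (hmax k hk).trans (not_lt.1 hc)⟩
  -- the first time after `i` at which this maximum is reached again
  have hex2 : ∃ r, partialSum w m ≤ partialSum w (i + r) := ⟨q, h1 m (by omega)⟩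
  set r := Nat.find hex2 with hr
  have hrq : r ≤ q := Nat.find_min' hex2 (h1 m (by omega))
  have e : partialSum (shiftSeq m w) (i - m) = partialSum w i - partialSum w m := by
    rw [partialSum_shiftSeq, Nat.add_sub_cancel' hmi]
  refine ⟨m, hmi, r, hrq, fun j hj => sub_pos.2 (hfirst j hj), fun j _ hj => ?_, ?_,
    ⟨?_, fun j hj => ?_, fun j hj1 hj2 => ?_⟩, fun j hj => ?_, ?_⟩
  · rw [partialSum_shiftSeq, zero_add]
    exact sub_nonpos.2 (hmax _ (by omega))
  · rw [e]
    linarith [hdrop m i hmi (by omega)]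
  · rw [e, partialSum_shiftSeq]
    linarith [Nat.find_spec hex2]
  · rw [e, partialSum_shiftSeq]
    linarith [not_le.1 (Nat.find_min hex2 hj)]
  · rw [e, partialSum_shiftSeq]
    refine Set.mem_Ioi.2 ?_
    linarith [hdrop m (i + j) (by omega) (by omega)]
  · rw [partialSum_shiftSeq, partialSum_shiftSeq, show i + r + (q - r) = i + q by omega]
    linarith [h1 (i + r + j) (by omega)]
  · rintro ⟨a, b, -, g2, g3, g4⟩
    rw [partialSum_shiftSeq, partialSum_shiftSeq] at g4
    linarith [hdrop (i + r + a) (i + r + b) (by omega) (by omega)]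

lemma measurableSet_hit_prod {K : Set ℝ} (hK : MeasurableSet K) (Γ : ℝ) (m : ℕ) :
    MeasurableSet {p : ℝ × (ℕ → ℝ) | p.2 ∈ hit K Γ p.1 m} := by
  have h : ∀ j, Measurable fun p : ℝ × (ℕ → ℝ) => p.1 + partialSum p.2 j := fun j => by fun_prop
  have : {p : ℝ × (ℕ → ℝ) | p.2 ∈ hit K Γ p.1 m} = {p | Γ ≤ p.1 + partialSum p.2 m} ∩
      ((⋂ j, ⋂ (_ : j < m), {p | p.1 + partialSum p.2 j < Γ}) ∩
      ⋂ j, ⋂ (_ : 1 ≤ j), ⋂ (_ : j ≤ m), {p | p.1 + partialSum p.2 j ∈ K}) := by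
    ext p; simp [hit, staysIn]
  rw [this]
  refine (measurableSet_le measurable_const (h m)).inter (MeasurableSet.inter ?_ ?_)
  · exact MeasurableSet.iInter fun j => MeasurableSet.iInter fun _ =>
      measurableSet_lt (h j) measurable_const
  · exact MeasurableSet.iInter fun j => MeasurableSet.iInter fun _ => MeasurableSet.iInter fun _ =>
      h j hK

/-- The walk stays below its starting point, and does not drop by `Γ`. -/
def excursion (Γ : ℝ) (k : ℕ) : Set (ℕ → ℝ) :=
  staysIn (Set.Iic 0) 0 k ∩ {u | -Γ < partialSum u k}

lemma measurableSet_excursion (Γ : ℝ) (k : ℕ) : MeasurableSet (excursion Γ k) :=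
  (measurableSet_staysIn measurableSet_Iic 0 k).inter
    (measurableSet_lt measurable_const (measurable_partialSum k))

lemma dependsOn_excursion (Γ : ℝ) (k : ℕ) :
    DependsOn (fun u => u ∈ excursion Γ k) (Set.Iio k) := by
  refine dependsOn_of_partialSum fun w w' h => ?_
  simp only [excursion, staysIn, Set.mem_inter_iff, Set.mem_ofPred_eq]
  grind

/-- The weight of an excursion below the maximum, of length `k`, followed by a return to the
maximum in time `r`. -/
noncomputable def excursionTerm (Γ : ℝ) (k r : ℕ) (u : ℕ → ℝ) : ℝ≥0∞ :=
  (excursion Γ k).indicator (fun u => expE (-2 * (Γ + partialSum u k))) u *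
    (hit (Set.Ioi 0) Γ (Γ + partialSum u k) r).indicator 1 (shiftSeq k u)

lemma measurable_excursionTerm (Γ : ℝ) (k r : ℕ) : Measurable (excursionTerm Γ k r) := by
  have := measurable_partialSum
  have := measurable_expE
  refine Measurable.mul (Measurable.indicator (by fun_prop) (measurableSet_excursion Γ k)) ?_
  have h : Measurable ({p : ℝ × (ℕ → ℝ) | p.2 ∈ hit (Set.Ioi 0) Γ p.1 r}.indicator
      (1 : ℝ × (ℕ → ℝ) → ℝ≥0∞)) := measurable_one.indicator (measurableSet_hit_prod measurableSet_Ioi Γ r)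
  have hX : Measurable fun u : ℕ → ℝ => (Γ + partialSum u k, shiftSeq k u) :=
    (measurable_const.add (measurable_partialSum k)).prodMk (measurable_shiftSeq k)
  exact h.comp hX

lemma dependsOn_excursionTerm (Γ : ℝ) (k r : ℕ) :
    DependsOn (excursionTerm Γ k r) (Set.Iio (k + r)) := by
  intro u u' h
  have h0 : partialSum u k = partialSum u' k := dependsOn_partialSum (Nat.le_add_right k r) h
  have h1 : (u ∈ excursion Γ k) = (u' ∈ excursion Γ k) := dependsOn_excursion Γ k fun i hi =>
    h i (lt_of_lt_of_le hi (Nat.le_add_right k r))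
  have h2 : (shiftSeq k u ∈ hit (Set.Ioi 0) Γ (Γ + partialSum u k) r) =
      (shiftSeq k u' ∈ hit (Set.Ioi 0) Γ (Γ + partialSum u k) r) :=
    dependsOn_hit _ _ _ r fun i hi => h (k + i) (by have : i < r := hi; show k + i < k + r; omega)
  classical
  simp only [excursionTerm, Set.indicator_apply, h1, ← h0, h2, Pi.one_apply]

/-! ### Cost of excursions below the running maximum -/

section Outer

variable (ν : Measure ℝ) [IsProbabilityMeasure ν]

lemma lintegral_excursionTerm (Γ : ℝ) (k : ℕ) :
    ∑' r, ∫⁻ u, excursionTerm Γ k r u ∂(iid ν) = ∫⁻ u in excursion Γ k,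
      expE (-2 * (Γ + partialSum u k)) *
        reachProb ν (Set.Ioi 0) Γ (Γ + partialSum u k) ∂(iid ν) := by
  have hps := measurable_partialSum
  have hexp := measurable_expE
  have hmeas : Measurable fun u => (excursion Γ k).indicator
      (fun u => expE (-2 * (Γ + partialSum u k))) u :=
    Measurable.indicator (by fun_prop) (measurableSet_excursion Γ k)
  have h1 : ∀ r, ∫⁻ u, excursionTerm Γ k r u ∂(iid ν) = ∫⁻ u, (excursion Γ k).indicator
      (fun u => expE (-2 * (Γ + partialSum u k))) u *
        iid ν (hit (Set.Ioi 0) Γ (Γ + partialSum u k) r) ∂(iid ν) := by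
    intro r
    have hF : Measurable (Function.uncurry fun (p : ℝ≥0∞ × ℝ) (v : ℕ → ℝ) =>
        p.1 * (hit (Set.Ioi 0) Γ (Γ + p.2) r).indicator 1 v) := by
      have h : Measurable ({p : ℝ × (ℕ → ℝ) | p.2 ∈ hit (Set.Ioi 0) Γ p.1 r}.indicator
        (1 : ℝ × (ℕ → ℝ) → ℝ≥0∞)) :=
        measurable_one.indicator (measurableSet_hit_prod measurableSet_Ioi Γ r)
      have hX : Measurable fun q : (ℝ≥0∞ × ℝ) × (ℕ → ℝ) => (Γ + q.1.2, q.2) := by fun_prop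
      exact (measurable_fst.comp measurable_fst).mul (h.comp hX)
    have := lintegral_shiftSeq_param ν k (X := fun u => ((excursion Γ k).indicator
      (fun u => expE (-2 * (Γ + partialSum u k))) u, partialSum u k))
      (hmeas.prodMk (hps k)) hF (by
        intro u u' h
        have h0 : partialSum u k = partialSum u' k := dependsOn_partialSum le_rfl h
        have h1 : (u ∈ excursion Γ k) = (u' ∈ excursion Γ k) := dependsOn_excursion Γ k h
        classical
        simp only [Set.indicator_apply, h1, h0])
    refine this.trans (lintegral_congr fun u => ?_)
    have hm := measurableSet_hit (K := Set.Ioi 0) measurableSet_Ioi Γ (Γ + partialSum u k) r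
    rw [lintegral_const_mul _ (measurable_one.indicator hm), lintegral_indicator_one hm]
  simp only [h1]
  have hmr : ∀ r, Measurable fun u : ℕ → ℝ => iid ν (hit (Set.Ioi 0) Γ (Γ + partialSum u k) r) := by
    intro r
    have := measurable_measure_prodMk_left (ν := iid ν)
      (measurableSet_hit_prod (K := Set.Ioi 0) measurableSet_Ioi Γ r)
    exact this.comp (measurable_const.add (hps k))
  rw [← lintegral_tsum (f := fun r u => (excursion Γ k).indicator
    (fun u => expE (-2 * (Γ + partialSum u k))) u *
      iid ν (hit (Set.Ioi 0) Γ (Γ + partialSum u k) r)) fun r => (hmeas.mul (hmr r)).aemeasurable,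
    ← lintegral_indicator (measurableSet_excursion Γ k)]
  refine lintegral_congr fun u => ?_
  rw [ENNReal.tsum_mul_left, tsum_measure_hit ν isHalfLine_Ioi]
  by_cases h : u ∈ excursion Γ k
  · rw [Set.indicator_of_mem h, Set.indicator_of_mem h]
  · rw [Set.indicator_of_notMem h, Set.indicator_of_notMem h, zero_mul]

/-- The weight at time i splits into exp(-2 S_m) at the record and exp(-2 (Γ + S_i - S_m)) for the
excursion. The record part, the excursion with its return, and the final peak are independent
blocks, and the sums over their lengths factor. -/
lemma peakRun_le (Γ : ℝ) :
    peakRun ν Γ ≤ (∑' m, ∫⁻ w in ladder (Set.Ioi 0) m, expE (-2 * partialSum w m) ∂(iid ν)) *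
      (∑' k, ∫⁻ u in excursion Γ k, expE (-2 * (Γ + partialSum u k)) *
        reachProb ν (Set.Ioi 0) Γ (Γ + partialSum u k) ∂(iid ν)) * peakCount ν Γ := by
  classical
  have hps := measurable_partialSum
  have hexp := measurable_expE
  set a : ℕ → ℝ≥0∞ := fun m => ∫⁻ w in ladder (Set.Ioi 0) m, expE (-2 * partialSum w m) ∂(iid ν)
    with ha
  set b : ℕ → ℕ → ℝ≥0∞ := fun k r => ∫⁻ u, excursionTerm Γ k r u ∂(iid ν) with hb
  have hlm := fun m => measurableSet_ladder (A := Set.Ioi 0) measurableSet_Ioi m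
  have hL : ∀ m, Measurable ((ladder (Set.Ioi 0) m).indicator
      fun w => expE (-2 * partialSum w m)) := fun m =>
    Measurable.indicator (by fun_prop) (hlm m)
  have hP : ∀ p, Measurable ((peak Γ p).indicator (1 : (ℕ → ℝ) → ℝ≥0∞)) := fun p =>
    measurable_one.indicator (measurableSet_peak Γ p)
  set T : ℕ → ℕ → ℕ → ℕ → (ℕ → ℝ) → ℝ≥0∞ := fun m k r p w =>
    (ladder (Set.Ioi 0) m).indicator (fun w => expE (-2 * partialSum w m)) w *
      (excursionTerm Γ k r (shiftSeq m w) * (peak Γ p).indicator 1 (shiftSeq (k + r) (shiftSeq m w)))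
    with hT
  have hTm2 : ∀ k r p, Measurable fun u => excursionTerm Γ k r u *
      (peak Γ p).indicator (1 : (ℕ → ℝ) → ℝ≥0∞) (shiftSeq (k + r) u) := fun k r p =>
    (measurable_excursionTerm Γ k r).mul ((hP p).comp (measurable_shiftSeq _))
  have hTm : ∀ m k r p, Measurable (T m k r p) := fun m k r p =>
    (hL m).mul ((hTm2 k r p).comp (measurable_shiftSeq m))
  have hTi : ∀ m k r p, ∫⁻ w, T m k r p w ∂(iid ν) = a m * (b k r * iid ν (peak Γ p)) := by
    intro m k r p
    rw [lintegral_mul_shiftSeq ν m (hL m) (hTm2 k r p), lintegral_mul_shiftSeq ν (k + r)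
      (measurable_excursionTerm Γ k r) (hP p) (dependsOn_excursionTerm Γ k r),
      lintegral_indicator (hlm m), lintegral_indicator_one (measurableSet_peak Γ p)]
    refine dependsOn_indicator (dependsOn_ladder _ m) ?_
    exact dependsOn_of_partialSum fun w w' h => by rw [h m le_rfl]
  have hpt : ∀ i q w, (peak Γ (i + q)).indicator (fun w => expE (-2 * (Γ + partialSum w i))) w ≤
      ∑' m, ∑' r, if m ≤ i then (if r ≤ q then T m (i - m) r (q - r) w else 0) else 0 := by
    intro i q w
    by_cases hw : w ∈ peak Γ (i + q)
    · obtain ⟨m, hm, r, hr, h1, h2, h3, h4, h5⟩ := exists_decomposition_of_peak hw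
      refine le_trans ?_ (ENNReal.le_tsum m)
      refine le_trans ?_ (ENNReal.le_tsum r)
      have hex : shiftSeq m w ∈ excursion Γ (i - m) := ⟨h2, h3⟩
      rw [if_pos hm, if_pos hr, Set.indicator_of_mem hw]
      simp only [hT, excursionTerm]
      rw [shiftSeq_shiftSeq, shiftSeq_shiftSeq, show m + (i - m + r) = i + r by omega,
        Nat.add_sub_cancel' hm, Set.indicator_of_mem h1, Set.indicator_of_mem hex,
        Set.indicator_of_mem h4, Set.indicator_of_mem h5, Pi.one_apply, Pi.one_apply, mul_one,
        mul_one, ← expE_add, partialSum_shiftSeq, Nat.add_sub_cancel' hm]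
      exact expE_mono (by linarith)
    · rw [Set.indicator_of_notMem hw]; exact zero_le
  have hrun : peakRun ν Γ = ∑' i, ∑' q, ∫⁻ w, (peak Γ (i + q)).indicator
      (fun w => expE (-2 * (Γ + partialSum w i))) w ∂(iid ν) := by
    have e1 : ∀ l, ∫⁻ v in peak Γ l, runSum Γ l v ∂(iid ν) = ∑' i, if i ≤ l then
        ∫⁻ w, (peak Γ (i + (l - i))).indicator (fun w => expE (-2 * (Γ + partialSum w i))) w ∂(iid ν)
        else 0 := by
      intro l
      rw [tsum_eq_sum (s := Finset.range (l + 1))]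
      · unfold runSum
        rw [lintegral_finsetSum _ fun i _ => by fun_prop]
        refine Finset.sum_congr rfl fun i hi => ?_
        have hi := Nat.lt_succ_iff.1 (Finset.mem_range.1 hi)
        rw [if_pos hi, Nat.add_sub_cancel' hi, lintegral_indicator (measurableSet_peak Γ l)]
      · intro i hi
        rw [if_neg fun h => hi (Finset.mem_range.2 (Nat.lt_succ_of_le h))]
    rw [peakRun]
    simp only [e1]
    rw [ENNReal.tsum_comm]
    refine tsum_congr fun i => ?_
    exact tsum_shift i fun q => ∫⁻ w, (peak Γ (i + q)).indicator
      (fun w => expE (-2 * (Γ + partialSum w i))) w ∂(iid ν)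
  rw [hrun]
  have hle : ∀ i q, ∫⁻ w, (peak Γ (i + q)).indicator
      (fun w => expE (-2 * (Γ + partialSum w i))) w ∂(iid ν) ≤
      ∑' m, ∑' r, if m ≤ i then (if r ≤ q then a m * (b (i - m) r * iid ν (peak Γ (q - r))) else 0)
        else 0 := by
    intro i q
    refine (lintegral_mono (hpt i q)).trans (le_of_eq ?_)
    have hTm' : ∀ m r, Measurable fun w => if m ≤ i then
        (if r ≤ q then T m (i - m) r (q - r) w else 0) else 0 := fun m r => by
      split_ifs
      · exact hTm _ _ _ _
      · exact measurable_const
      · exact measurable_const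
    rw [lintegral_tsum fun m => (Measurable.tsum fun r => hTm' m r).aemeasurable]
    refine tsum_congr fun m => ?_
    rw [lintegral_tsum fun r => (hTm' m r).aemeasurable]
    refine tsum_congr fun r => ?_
    split_ifs
    · exact hTi _ _ _ _
    · simp
    · simp
  refine (ENNReal.tsum_le_tsum fun i => ENNReal.tsum_le_tsum fun q => hle i q).trans (le_of_eq ?_)
  have hq : ∀ i, ∑' q, ∑' m, ∑' r, (if m ≤ i then (if r ≤ q then
      a m * (b (i - m) r * iid ν (peak Γ (q - r))) else 0) else 0) =
      ∑' m, if m ≤ i then a m * ((∑' r, b (i - m) r) * peakCount ν Γ) else 0 := by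
    intro i
    rw [ENNReal.tsum_comm]
    refine tsum_congr fun m => ?_
    split_ifs with hm
    · rw [ENNReal.tsum_comm, ← ENNReal.tsum_mul_right, ← ENNReal.tsum_mul_left]
      refine tsum_congr fun r => ?_
      rw [tsum_shift r fun p => a m * (b (i - m) r * iid ν (peak Γ p)), ENNReal.tsum_mul_left,
        ENNReal.tsum_mul_left, peakCount]
    · simp
  simp only [hq]
  rw [ENNReal.tsum_comm]
  have hi : ∀ m, ∑' i, (if m ≤ i then a m * ((∑' r, b (i - m) r) * peakCount ν Γ) else 0) =
      a m * ((∑' k, ∑' r, b k r) * peakCount ν Γ) := by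
    intro m
    rw [tsum_shift m fun k => a m * ((∑' r, b k r) * peakCount ν Γ), ENNReal.tsum_mul_left,
      ENNReal.tsum_mul_right]
  simp only [hi]
  rw [ENNReal.tsum_mul_right, ← mul_assoc]
  simp only [hb, lintegral_excursionTerm]

variable {ν}

/-- By time reversal, endpoints of excursions correspond to weak descending ladder points. The mean
number of those with Γ + S_k in [j, j + 1) is at most the mean number in (-1, 1), whatever Γ and j
are, and the weights exp(-j/2) are summable. -/
lemma exists_tsum_lintegral_excursion_le (ho : Oscillates ν) : ∃ C : ℝ≥0∞, C ≠ ∞ ∧ ∀ Γ : ℝ,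
    ∑' k, ∫⁻ u in excursion Γ k, expE (-(Γ + partialSum u k) / 2) ∂(iid ν) ≤ C := by
  have hps := measurable_partialSum
  have hexp := measurable_expE
  have hfin := tsum_lintegral_ladder_lt_top ν (A := Set.Iic 0) measurableSet_Iic 1
    (fun x hx => by simpa using hx) (by
      refine lt_of_lt_of_le ho.measure_Iio_pos (measure_mono fun x hx => ?_)
      have hx : x < 0 := hx
      exact ⟨hx.le, by simpa using hx⟩)
  set c := ∑' n, ∫⁻ w in ladder (Set.Iic 0) n, expE (1 * partialSum w n) ∂(iid ν) with hc
  have hwin : ∑' n, iid ν (ladder (Set.Iic 0) n ∩ {w | partialSum w n ∈ Set.Ioo (-1) 1}) ≤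
      expE 1 * c := by
    rw [hc, ← ENNReal.tsum_mul_left]
    refine ENNReal.tsum_le_tsum fun n => ?_
    rw [← lintegral_const_mul _ (by fun_prop), ← lintegral_indicator_one
      ((measurableSet_ladder measurableSet_Iic n).inter
        (measurableSet_partialSum_mem measurableSet_Ioo n)),
      ← lintegral_indicator (measurableSet_ladder measurableSet_Iic n)]
    refine lintegral_mono fun w => ?_
    by_cases h1 : w ∈ ladder (Set.Iic 0) n
    · rw [Set.indicator_of_mem h1]
      by_cases h2 : w ∈ {w | partialSum w n ∈ Set.Ioo (-1) 1}
      · rw [Set.indicator_of_mem (Set.mem_inter h1 h2), ← expE_add]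
        have h3 : -1 < partialSum w n := h2.1
        exact one_le_expE (by linarith)
      · rw [Set.indicator_of_notMem fun hh => h2 hh.2]; exact zero_le
    · rw [Set.indicator_of_notMem fun hh => h1 hh.1]; exact zero_le
  refine ⟨(∑' j : ℕ, expE (-(j : ℝ) / 2)) * (expE 1 * c), ?_, fun Γ => ?_⟩
  · refine ENNReal.mul_ne_top ?_ (ENNReal.mul_ne_top (expE_ne_top _) hfin.ne)
    have e : ∀ j : ℕ, expE (-(j : ℝ) / 2) = expE (-1 / 2) ^ j := by
      intro j
      unfold expE
      rw [← ENNReal.ofReal_pow (Real.exp_pos _).le, ← Real.exp_nat_mul]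
      congr 2; ring
    simp only [e, ENNReal.tsum_geometric]
    exact ENNReal.inv_ne_top.2 (tsub_pos_of_lt (expE_lt_one (by norm_num))).ne'
  · set I : ℕ → Set ℝ := fun j => {y | Γ + y ∈ Set.Ico (j : ℝ) (j + 1)} with hI
    have hIm : ∀ j, MeasurableSet (I j) := fun j =>
      (measurable_const.add measurable_id) measurableSet_Ico
    set f : ℝ → ℝ≥0∞ := {y | -Γ < y}.indicator fun y => expE (-(Γ + y) / 2) with hf
    have hfm : Measurable f := Measurable.indicator (by fun_prop) measurableSet_Ioi
    have hfle : ∀ y, f y ≤ ∑' j : ℕ, expE (-(j : ℝ) / 2) * (I j).indicator 1 y := by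
      intro y
      by_cases hy : -Γ < y
      · have h0 : 0 ≤ Γ + y := by linarith
        refine le_trans ?_ (ENNReal.le_tsum ⌊Γ + y⌋₊)
        rw [hf, Set.indicator_of_mem (show y ∈ {y | -Γ < y} from hy), Set.indicator_of_mem (show y ∈ I _ from
          ⟨Nat.floor_le h0, Nat.lt_floor_add_one _⟩), Pi.one_apply, mul_one]
        refine expE_mono ?_
        linarith [Nat.floor_le h0]
      · rw [hf, Set.indicator_of_notMem (show y ∉ {y | -Γ < y} from hy)]; exact zero_le
    have h1 : ∀ k, ∫⁻ u in excursion Γ k, expE (-(Γ + partialSum u k) / 2) ∂(iid ν) ≤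
        ∑' j : ℕ, expE (-(j : ℝ) / 2) * iid ν (ladder (Set.Iic 0) k ∩ {w | partialSum w k ∈ I j}) := by
      intro k
      have hst := measurableSet_staysIn (A := Set.Iic 0) measurableSet_Iic 0 k
      have hla := measurableSet_ladder (A := Set.Iic 0) measurableSet_Iic k
      have e : ∫⁻ u in excursion Γ k, expE (-(Γ + partialSum u k) / 2) ∂(iid ν) =
          ∫⁻ u in staysIn (Set.Iic 0) 0 k, f (partialSum u k) ∂(iid ν) := by
        rw [← lintegral_indicator (measurableSet_excursion Γ k), ← lintegral_indicator hst]
        refine lintegral_congr fun u => ?_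
        by_cases g1 : u ∈ staysIn (Set.Iic 0) 0 k <;> by_cases g2 : -Γ < partialSum u k <;>
          simp [excursion, hf, g1, g2]
      rw [e, lintegral_staysIn_eq_ladder ν measurableSet_Iic k hfm]
      refine (lintegral_mono fun u => hfle _).trans (le_of_eq ?_)
      have hIj : ∀ j, Measurable fun u : ℕ → ℝ => (I j).indicator (1 : ℝ → ℝ≥0∞) (partialSum u k) :=
        fun j => (measurable_one.indicator (hIm j)).comp (hps k)
      rw [lintegral_tsum fun j => ((hIj j).const_mul _).aemeasurable]
      refine tsum_congr fun j => ?_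
      rw [lintegral_const_mul _ (hIj j)]
      congr 1
      have e2 : ∀ u : ℕ → ℝ, (I j).indicator (1 : ℝ → ℝ≥0∞) (partialSum u k) =
          {w | partialSum w k ∈ I j}.indicator 1 u := fun u => rfl
      simp only [e2]
      rw [lintegral_indicator_one (measurableSet_partialSum_mem (hIm j) k),
        Measure.restrict_apply (measurableSet_partialSum_mem (hIm j) k), Set.inter_comm]
    refine (ENNReal.tsum_le_tsum h1).trans ?_
    rw [ENNReal.tsum_comm, ← ENNReal.tsum_mul_right]
    refine ENNReal.tsum_le_tsum fun j => ?_
    rw [ENNReal.tsum_mul_left]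
    refine mul_le_mul_right ((tsum_measure_ladder_window ν measurableSet_Iic (hIm j)
      (measurableSet_Ioo (a := (-1 : ℝ)) (b := 1)) ?_).trans hwin) _
    rintro x ⟨hx1, hx2⟩ y ⟨hy1, hy2⟩
    exact ⟨by linarith, by linarith⟩

/-- The mean contribution of the walk above the level `Γ` is small. -/
lemma exists_peakRun_le (ho : Oscillates ν) : ∃ C : ℝ≥0∞, C ≠ ∞ ∧ ∀ Γ : ℝ,
    peakRun ν Γ ≤ C * reachProb ν (Set.Ioi 0) Γ 0 * peakCount ν Γ := by
  have hps := measurable_partialSum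
  have hexp := measurable_expE
  obtain ⟨C1, hC1, h1⟩ := exists_reachProb_le ho isHalfLine_Ioi
  obtain ⟨C2, hC2, h2⟩ := exists_potential_le ho isHalfLine_Ioi (l := 1 / 2) (by norm_num)
  obtain ⟨C3, hC3, h3⟩ := exists_tsum_lintegral_excursion_le ho
  have hfin := tsum_lintegral_ladder_lt_top ν (A := Set.Ioi 0) measurableSet_Ioi (-2)
    (fun x hx => by have : 0 < x := hx; linarith) (by
      refine lt_of_lt_of_le ho.measure_Ioi_pos (measure_mono fun x hx => ?_)
      have hx' : 0 < x := hx
      exact ⟨hx, by linarith⟩)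
  refine ⟨(∑' m, ∫⁻ w in ladder (Set.Ioi 0) m, expE (-2 * partialSum w m) ∂(iid ν)) *
    (C1 * C2 * C3), ENNReal.mul_ne_top hfin.ne
      (ENNReal.mul_ne_top (ENNReal.mul_ne_top hC1 hC2) hC3), fun Γ => ?_⟩
  refine (peakRun_le ν Γ).trans (mul_le_mul_left ?_ _)
  rw [mul_assoc]
  refine mul_le_mul_right ?_ _
  -- Exponents: -2 from the weight, +1 from the change of level, +1/2 from the potential; -1/2
  -- remains.
  have hk : ∀ k, ∫⁻ u in excursion Γ k, expE (-2 * (Γ + partialSum u k)) *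
      reachProb ν (Set.Ioi 0) Γ (Γ + partialSum u k) ∂(iid ν) ≤
      C1 * C2 * reachProb ν (Set.Ioi 0) Γ 0 *
        ∫⁻ u in excursion Γ k, expE (-(Γ + partialSum u k) / 2) ∂(iid ν) := by
    intro k
    rw [← lintegral_const_mul _ (by fun_prop)]
    refine setLIntegral_mono (by fun_prop) fun u hu => ?_
    have hx : 0 < Γ + partialSum u k := by
      have : -Γ < partialSum u k := hu.2
      linarith
    set x := Γ + partialSum u k
    calc expE (-2 * x) * reachProb ν (Set.Ioi 0) Γ x
        ≤ expE (-2 * x) * (C1 * expE x * (C2 * expE (1 / 2 * x)) * reachProb ν (Set.Ioi 0) Γ 0) := by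
          gcongr
          refine (h1 Γ x hx.le (Or.inl hx)).trans ?_
          gcongr
          exact h2 x hx.le
      _ = C1 * C2 * reachProb ν (Set.Ioi 0) Γ 0 *
          (expE (-2 * x) * expE x * expE (1 / 2 * x)) := by ring
      _ = C1 * C2 * reachProb ν (Set.Ioi 0) Γ 0 * expE (-x / 2) := by
          rw [← expE_add, ← expE_add]; congr 2; ring
  refine (ENNReal.tsum_le_tsum hk).trans ?_
  rw [ENNReal.tsum_mul_left]
  calc C1 * C2 * reachProb ν (Set.Ioi 0) Γ 0 * _ ≤ C1 * C2 * reachProb ν (Set.Ioi 0) Γ 0 * C3 :=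
        mul_le_mul_right (h3 Γ) _
    _ = _ := by ring

end Outer

/-! ### Convergence of bounded functionals of finitely many steps around the minimum -/

/-- Convergence of integrals of a bounded function against probability densities that converge
pointwise to a probability density. -/
lemma tendsto_lintegral_mul_of_density {α ι : Type*} [MeasurableSpace α] {ρ : Measure α}
    {l : Filter ι} [l.NeBot] [l.IsCountablyGenerated] {g : ι → α → ℝ≥0∞} {g' f : α → ℝ≥0∞}
    {B : ℝ≥0∞} (hB : B ≠ ∞) (hf : AEMeasurable f ρ) (hg : ∀ i, AEMeasurable (g i) ρ)
    (hle : ∀ᵐ x ∂ρ, f x ≤ B) (hlim : ∀ᵐ x ∂ρ, Tendsto (fun i => g i x) l (𝓝 (g' x)))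
    (hint : ∀ᶠ i in l, ∫⁻ x, g i x ∂ρ ≤ 1) (hone : ∫⁻ x, g' x ∂ρ = 1) :
    Tendsto (fun i => ∫⁻ x, f x * g i x ∂ρ) l (𝓝 (∫⁻ x, f x * g' x ∂ρ)) := by
  have hfin : ∀ᵐ x ∂ρ, f x ≠ ∞ := by filter_upwards [hle] with x hx using ne_top_of_le_ne_top hB hx
  -- Scheffé's argument: Fatou for f gives the lower bound. Fatou for B - f gives the upper bound,
  -- because the masses are at most 1 along the way and equal to 1 in the limit.
  have fatou : ∀ f : α → ℝ≥0∞, AEMeasurable f ρ → (∀ᵐ x ∂ρ, f x ≠ ∞) →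
      ∫⁻ x, f x * g' x ∂ρ ≤ liminf (fun i => ∫⁻ x, f x * g i x ∂ρ) l := by
    intro f hf hfin
    refine le_trans (le_of_eq ?_) (lintegral_liminf_le' fun i => hf.mul (hg i))
    refine lintegral_congr_ae ?_
    filter_upwards [hlim, hfin] with x hx hfx
    exact (Tendsto.liminf_eq (ENNReal.Tendsto.const_mul hx (Or.inr hfx))).symm
  have hsplit : ∀ k : α → ℝ≥0∞, AEMeasurable k ρ →
      ∫⁻ x, f x * k x ∂ρ + ∫⁻ x, (B - f x) * k x ∂ρ = B * ∫⁻ x, k x ∂ρ := by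
    intro k hk
    rw [← lintegral_add_left' (f := fun x => f x * k x) (hf.mul hk), ← lintegral_const_mul' _ _ hB]
    refine lintegral_congr_ae ?_
    filter_upwards [hle] with x hx
    rw [← add_mul, add_tsub_cancel_of_le hx]
  have hlow := fatou f hf hfin
  have hlow' := fatou (fun x => B - f x) (aemeasurable_const.sub hf)
    (Eventually.of_forall fun x => ne_top_of_le_ne_top hB tsub_le_self)
  refine tendsto_of_le_liminf_of_limsup_le hlow ?_
  have h1 : ∀ᶠ i in l, ∫⁻ x, f x * g i x ∂ρ ≤ B - ∫⁻ x, (B - f x) * g i x ∂ρ := by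
    filter_upwards [hint] with i hi
    have h := hsplit (g i) (hg i)
    have h2 : ∫⁻ x, f x * g i x ∂ρ + ∫⁻ x, (B - f x) * g i x ∂ρ ≤ B := by
      rw [h]; exact (mul_le_mul_right hi B).trans_eq (mul_one B)
    exact ENNReal.le_sub_of_add_le_right
      (ne_top_of_le_ne_top hB ((le_add_self).trans h2)) h2
  refine (limsup_le_limsup h1).trans ?_
  rw [ENNReal.limsup_const_sub _ _ hB]
  refine (tsub_le_tsub_left hlow' B).trans ?_
  have hg' : AEMeasurable g' ρ := aemeasurable_of_tendsto_metrizable_ae l hg hlim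
  have h := hsplit g' hg'
  rw [hone, mul_one] at h
  rw [tsub_le_iff_right, h]

lemma dependsOn_comp_partialSum {n : ℕ} {f : (ℕ → ℝ) → ℝ≥0∞} (hf : DependsOn f (Set.Iic n)) :
    DependsOn (fun w => f (partialSum w)) (Set.Iio n) :=
  dependsOn_of_partialSum fun _ _ h => hf fun i hi => h i hi

/-- A function of the first steps on both sides, on the event that they stay below `Γ / 2`. -/
noncomputable def belowTerm (Γ : ℝ) (n : ℕ) (f : (ℕ → ℝ) → (ℕ → ℝ) → ℝ≥0∞) (v w' : ℕ → ℝ) :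
    ℝ≥0∞ :=
  (below (Γ / 2) (n + 1)).indicator 1 v * ((below (Γ / 2) (n + 1)).indicator 1 w' *
    f (partialSum v) (partialSum w'))

lemma measurable_belowTerm (Γ : ℝ) (n : ℕ) {f : (ℕ → ℝ) → (ℕ → ℝ) → ℝ≥0∞}
    (hf : Measurable (Function.uncurry f)) : Measurable (Function.uncurry (belowTerm Γ n f)) := by
  have hb := (measurable_one (α := ℝ≥0∞)).indicator (measurableSet_below (Γ / 2) (n + 1))
  have hS := measurable_partialSum_seq
  exact (hb.comp measurable_fst).mul ((hb.comp measurable_snd).mul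
    (hf.comp ((hS.comp measurable_fst).prodMk (hS.comp measurable_snd))))

lemma dependsOn_belowTerm_left (Γ : ℝ) (n : ℕ) {f : (ℕ → ℝ) → (ℕ → ℝ) → ℝ≥0∞}
    (hf : ∀ z, DependsOn (fun z' => f z' z) (Set.Iic n)) (w' : ℕ → ℝ) :
    DependsOn (fun v => belowTerm Γ n f v w') (Set.Iio n) := by
  intro v v' h
  have h1 := dependsOn_indicator (f := 1) (dependsOn_below (c := Γ / 2) (le_refl (n + 1)))
    (fun _ _ _ => rfl) h
  have h2 := dependsOn_comp_partialSum (hf (partialSum w')) h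
  simp only [belowTerm, h1, h2]

lemma dependsOn_belowTerm_right (Γ : ℝ) (n : ℕ) {f : (ℕ → ℝ) → (ℕ → ℝ) → ℝ≥0∞}
    (hf : ∀ z', DependsOn (fun z => f z' z) (Set.Iic n)) (v : ℕ → ℝ) :
    DependsOn (fun w' => belowTerm Γ n f v w') (Set.Iio n) := by
  intro w w' h
  have h1 := dependsOn_indicator (f := 1) (dependsOn_below (c := Γ / 2) (le_refl (n + 1)))
    (fun _ _ _ => rfl) h
  have h2 := dependsOn_comp_partialSum (hf (partialSum v)) h
  simp only [belowTerm, h1, h2]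

lemma tendsto_indicator_below (n : ℕ) (w : ℕ → ℝ) :
    Tendsto (fun Γ : ℝ => (below (Γ / 2) (n + 1)).indicator (1 : (ℕ → ℝ) → ℝ≥0∞) w) atTop (𝓝 1) := by
  refine tendsto_const_nhds.congr' ?_
  have h : ∀ᶠ Γ : ℝ in atTop, ∀ j ∈ Finset.range (n + 1), partialSum w j < Γ / 2 := by
    rw [eventually_all_finset]
    intro j _
    filter_upwards [eventually_gt_atTop (2 * partialSum w j)] with Γ hΓ
    linarith
  filter_upwards [h] with Γ hΓ
  rw [Set.indicator_of_mem (show w ∈ below (Γ / 2) (n + 1) from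
    fun j hj => hΓ j (Finset.mem_range.2 hj)), Pi.one_apply]

lemma mem_or_eq_zero_of_staysIn {K : Set ℝ} {n : ℕ} {w : ℕ → ℝ} (hw : w ∈ staysIn K 0 n) :
    partialSum w n ∈ K ∨ partialSum w n = 0 := by
  rcases Nat.eq_zero_or_pos n with rfl | hn
  · exact Or.inr (partialSum_zero w)
  · have := hw n hn le_rfl
    rw [zero_add] at this
    exact Or.inl this

/-! ### Density of the window around the minimum -/

section Limit

variable (μ : Measure ℝ) [IsProbabilityMeasure μ]

/-- The expectation of the restriction of `f` to the event that the walk stays below `Γ / 2`. -/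
noncomputable def belowMean (Γ : ℝ) (n : ℕ) (f : (ℕ → ℝ) → (ℕ → ℝ) → ℝ≥0∞) : ℝ≥0∞ :=
  (reachProb (μ.map fun x => -x) (Set.Ioi 0) Γ 0 * reachProb μ (Set.Ici 0) Γ 0)⁻¹ *
    ∫⁻ v in reach (Set.Ioi 0) Γ 0, ∫⁻ w' in reach (Set.Ici 0) Γ 0, belowTerm Γ n f v w' ∂(iid μ)
      ∂(iid (μ.map fun x => -x))

variable {μ}

lemma lintegral_condNonnegLaw (ho : Oscillates μ) {n : ℕ} {F : (ℕ → ℝ) → ℝ≥0∞} (hF : Measurable F)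
    (hd : DependsOn F (Set.Iic n)) :
    ∫⁻ z, F z ∂(condNonnegLaw μ) = ∫⁻ w in staysIn (Set.Ici 0) 0 n,
      F (partialSum w) * potential μ (Set.Ici 0) (partialSum w n) ∂(iid μ) := by
  refine lintegral_doobChain ho isHalfLine_Ici _ ?_ n hF hd
  ext x
  by_cases hx : x ∈ Set.Ici (0 : ℝ)
  · rw [Set.indicator_of_mem hx, Set.indicator_of_mem hx, renewalStrict_eq μ hx]
  · rw [Set.indicator_of_notMem hx, Set.indicator_of_notMem hx]

lemma lintegral_condPosLaw (ho : Oscillates μ) {n : ℕ} {F : (ℕ → ℝ) → ℝ≥0∞} (hF : Measurable F)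
    (hd : DependsOn F (Set.Iic n)) :
    ∫⁻ z, F z ∂(condPosLaw μ) = ∫⁻ w in staysIn (Set.Ioi 0) 0 n,
      F (partialSum w) * potential μ (Set.Ioi 0) (partialSum w n) ∂(iid μ) := by
  refine lintegral_doobChain ho isHalfLine_Ioi _ ?_ n hF hd
  ext x
  by_cases hx : x ∈ Set.Ioi (0 : ℝ)
  · rw [Set.indicator_of_mem hx, Set.indicator_of_mem hx, renewalWeak_eq μ hx]
  · rw [Set.indicator_of_notMem hx, Set.indicator_of_notMem hx]

variable (μ) in
/-- The increments on both sides of the minimum, on the event that they stay in the half lines. -/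
noncomputable def twoSided (n : ℕ) : Measure ((ℕ → ℝ) × (ℕ → ℝ)) :=
  ((iid (μ.map fun x => -x)).restrict (staysIn (Set.Ioi 0) 0 n)).prod
    ((iid μ).restrict (staysIn (Set.Ici 0) 0 n))

lemma ae_twoSided (n : ℕ) : ∀ᵐ p ∂(twoSided μ n),
    p.1 ∈ staysIn (Set.Ioi 0) 0 n ∧ p.2 ∈ staysIn (Set.Ici 0) 0 n := by
  rw [twoSided, Measure.prod_restrict]
  exact ae_restrict_mem ((measurableSet_staysIn measurableSet_Ioi 0 n).prod
    (measurableSet_staysIn measurableSet_Ici 0 n))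

/-- Puts the limit law on the same reference measure, that of the killed increments, as the laws at
finite Γ. -/
lemma lintegral_cond_eq (ho : Oscillates μ) {n : ℕ} {f : (ℕ → ℝ) → (ℕ → ℝ) → ℝ≥0∞}
    (hf : Measurable (Function.uncurry f)) (hl : ∀ z, DependsOn (fun z' => f z' z) (Set.Iic n))
    (hr : ∀ z', DependsOn (fun z => f z' z) (Set.Iic n)) :
    ∫⁻ z', ∫⁻ z, f z' z ∂(condNonnegLaw μ) ∂(condPosLaw (μ.map fun x => -x)) =
      ∫⁻ p, f (partialSum p.1) (partialSum p.2) *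
        (potential (μ.map fun x => -x) (Set.Ioi 0) (partialSum p.1 n) *
          potential μ (Set.Ici 0) (partialSum p.2 n)) ∂(twoSided μ n) := by
  have hS := measurable_partialSum_seq
  have hps := measurable_partialSum
  have hp1 := (potential_mono (μ.map fun x => -x) isHalfLine_Ioi).measurable
  have hp2 := (potential_mono μ isHalfLine_Ici).measurable
  have h1 : ∀ z', ∫⁻ z, f z' z ∂(condNonnegLaw μ) = ∫⁻ w in staysIn (Set.Ici 0) 0 n,
      f z' (partialSum w) * potential μ (Set.Ici 0) (partialSum w n) ∂(iid μ) := fun z' =>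
    lintegral_condNonnegLaw ho (hf.comp measurable_prodMk_left) (hr z')
  simp only [h1]
  have hm : Measurable fun q : (ℕ → ℝ) × (ℕ → ℝ) => f q.1 (partialSum q.2) *
      potential μ (Set.Ici 0) (partialSum q.2 n) :=
    (hf.comp (measurable_fst.prodMk (hS.comp measurable_snd))).mul
      (hp2.comp ((hps n).comp measurable_snd))
  rw [lintegral_condPosLaw ho.neg (n := n)]
  · have hm2 : Measurable fun p : (ℕ → ℝ) × (ℕ → ℝ) => f (partialSum p.1) (partialSum p.2) *
        (potential (μ.map fun x => -x) (Set.Ioi 0) (partialSum p.1 n) *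
          potential μ (Set.Ici 0) (partialSum p.2 n)) :=
      (hf.comp ((hS.comp measurable_fst).prodMk (hS.comp measurable_snd))).mul
        ((hp1.comp ((hps n).comp measurable_fst)).mul (hp2.comp ((hps n).comp measurable_snd)))
    rw [twoSided, lintegral_prod _ hm2.aemeasurable]
    refine lintegral_congr fun v => ?_
    rw [← lintegral_mul_const]
    · exact lintegral_congr fun w => by ring
    · exact hm.comp measurable_prodMk_left
  · exact hm.lintegral_prod_right
  · intro z z' h
    refine lintegral_congr fun w => ?_
    have := hl (partialSum w) h
    simp only at this
    rw [this]

/-- Markov property at time n on each side: the requirement to reach Γ becomes the reach probability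
from the current height. This is legitimate because `belowTerm` vanishes if Γ is reached before time
n. -/
lemma belowMean_eq {Γ : ℝ} (hΓ : 0 < Γ) {n : ℕ}
    {f : (ℕ → ℝ) → (ℕ → ℝ) → ℝ≥0∞} (hf : Measurable (Function.uncurry f))
    (hl : ∀ z, DependsOn (fun z' => f z' z) (Set.Iic n))
    (hr : ∀ z', DependsOn (fun z => f z' z) (Set.Iic n)) :
    belowMean μ Γ n f = ∫⁻ p, f (partialSum p.1) (partialSum p.2) *
      (((below (Γ / 2) (n + 1)).indicator 1 p.1 * (below (Γ / 2) (n + 1)).indicator 1 p.2) *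
      ((reachProb (μ.map fun x => -x) (Set.Ioi 0) Γ (partialSum p.1 n) /
        reachProb (μ.map fun x => -x) (Set.Ioi 0) Γ 0) *
      (reachProb μ (Set.Ici 0) Γ (partialSum p.2 n) / reachProb μ (Set.Ici 0) Γ 0)))
        ∂(twoSided μ n) := by
  have hS := measurable_partialSum_seq
  have hps := measurable_partialSum
  have hq1 := measurable_reachProb (μ.map fun x => -x) (K := Set.Ioi 0) measurableSet_Ioi Γ
  have hq2 := measurable_reachProb μ (K := Set.Ici 0) measurableSet_Ici Γ
  have hb := (measurable_one (α := ℝ≥0∞)).indicator (measurableSet_below (Γ / 2) (n + 1))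
  have hT := measurable_belowTerm Γ n hf
  have hin : ∀ v w' : ℕ → ℝ, belowTerm Γ n f v w' ≠ 0 →
      (∀ j < n, 0 + partialSum v j < Γ) ∧ ∀ j < n, 0 + partialSum w' j < Γ := by
    intro v w' h
    obtain ⟨h1, h2⟩ := mul_ne_zero_iff.1 h
    have h1 := Set.mem_of_indicator_ne_zero h1
    have h2 := Set.mem_of_indicator_ne_zero (mul_ne_zero_iff.1 h2).1
    refine ⟨fun j hj => ?_, fun j hj => ?_⟩
    · linarith [h1 j (by omega)]
    · linarith [h2 j (by omega)]
  have h1 : ∀ v, ∫⁻ w' in reach (Set.Ici 0) Γ 0, belowTerm Γ n f v w' ∂(iid μ) =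
      ∫⁻ w' in staysIn (Set.Ici 0) 0 n, belowTerm Γ n f v w' *
        reachProb μ (Set.Ici 0) Γ (0 + partialSum w' n) ∂(iid μ) := fun v =>
    lintegral_reach isHalfLine_Ici Γ 0 n (hT.comp measurable_prodMk_left)
      (dependsOn_belowTerm_right Γ n hr v) fun w' h => (hin v w' h).2
  rw [belowMean]
  simp only [h1]
  have hm : Measurable fun q : (ℕ → ℝ) × (ℕ → ℝ) => belowTerm Γ n f q.1 q.2 *
      reachProb μ (Set.Ici 0) Γ (0 + partialSum q.2 n) :=
    hT.mul (hq2.comp (measurable_const.add ((hps n).comp measurable_snd)))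
  rw [lintegral_reach isHalfLine_Ioi Γ 0 n hm.lintegral_prod_right]
  · have hm2 : Measurable fun p : (ℕ → ℝ) × (ℕ → ℝ) => f (partialSum p.1) (partialSum p.2) *
      (((below (Γ / 2) (n + 1)).indicator 1 p.1 * (below (Γ / 2) (n + 1)).indicator 1 p.2) *
      ((reachProb (μ.map fun x => -x) (Set.Ioi 0) Γ (partialSum p.1 n) /
        reachProb (μ.map fun x => -x) (Set.Ioi 0) Γ 0) *
      (reachProb μ (Set.Ici 0) Γ (partialSum p.2 n) / reachProb μ (Set.Ici 0) Γ 0))) :=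
      (hf.comp ((hS.comp measurable_fst).prodMk (hS.comp measurable_snd))).mul
        (((hb.comp measurable_fst).mul (hb.comp measurable_snd)).mul
        (((hq1.comp ((hps n).comp measurable_fst)).div_const _).mul
          ((hq2.comp ((hps n).comp measurable_snd)).div_const _)))
    rw [twoSided, lintegral_prod _ hm2.aemeasurable, ← lintegral_const_mul]
    · refine lintegral_congr fun v => ?_
      have hmv : Measurable fun w' => belowTerm Γ n f v w' *
        reachProb μ (Set.Ici 0) Γ (0 + partialSum w' n) := hm.comp measurable_prodMk_left
      rw [← lintegral_mul_const _ hmv, ← lintegral_const_mul _ (hmv.mul_const _)]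
      refine lintegral_congr fun w => ?_
      rw [ENNReal.mul_inv (Or.inr (reachProb_ne_top _ _ _)) (Or.inl (reachProb_ne_top _ _ _)),
        belowTerm, ENNReal.div_eq_inv_mul, ENNReal.div_eq_inv_mul, zero_add, zero_add]
      ring
    · exact hm.lintegral_prod_right.mul (hq1.comp (measurable_const.add (hps n)))
  · intro v v' h
    refine lintegral_congr fun w => ?_
    have := dependsOn_belowTerm_left Γ n hl w h
    simp only at this
    rw [this]
  · intro v hv
    by_contra hc
    refine hv ?_
    have : ∀ w', belowTerm Γ n f v w' = 0 := fun w' => by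
      by_contra h
      exact hc (hin v w' h).1
    simp [this]

variable (μ) in
lemma belowMean_one_le (Γ : ℝ) (n : ℕ) :
    belowMean μ Γ n (fun _ _ => 1) ≤ 1 := by
  have h1 : ∀ v w', belowTerm Γ n (fun _ _ => 1) v w' ≤ 1 := fun v w' => by
    unfold belowTerm
    refine mul_le_one' (Set.indicator_le_self' (fun _ _ => zero_le) _) ?_
    rw [mul_one]
    exact Set.indicator_le_self' (fun _ _ => zero_le) _
  rw [belowMean]
  refine (mul_le_mul_right (lintegral_mono fun v => lintegral_mono fun w' => h1 v w') _).trans ?_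
  simp only [lintegral_one, lintegral_const, Measure.restrict_apply_univ, reachProb]
  rw [mul_comm (iid μ _)]
  exact ENNReal.inv_mul_le_one _

/-- Convergence in law of the walk seen from the minimum. -/
lemma tendsto_belowMean (ho : Oscillates μ) {n : ℕ} {f : (ℕ → ℝ) → (ℕ → ℝ) → ℝ≥0∞}
    (hf : Measurable (Function.uncurry f)) (hl : ∀ z, DependsOn (fun z' => f z' z) (Set.Iic n))
    (hr : ∀ z', DependsOn (fun z => f z' z) (Set.Iic n)) {B : ℝ≥0∞} (hB : B ≠ ∞)
    (hle : ∀ v ∈ staysIn (Set.Ioi 0) 0 n, ∀ w' ∈ staysIn (Set.Ici 0) 0 n,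
      f (partialSum v) (partialSum w') ≤ B) :
    Tendsto (fun Γ => belowMean μ Γ n f) atTop
      (𝓝 (∫⁻ z', ∫⁻ z, f z' z ∂(condNonnegLaw μ) ∂(condPosLaw (μ.map fun x => -x)))) := by
  have hS := measurable_partialSum_seq
  have hps := measurable_partialSum
  rw [lintegral_cond_eq ho hf hl hr]
  refine Tendsto.congr' (f₁ := fun Γ => ∫⁻ p, f (partialSum p.1) (partialSum p.2) *
      (((below (Γ / 2) (n + 1)).indicator 1 p.1 * (below (Γ / 2) (n + 1)).indicator 1 p.2) *
      ((reachProb (μ.map fun x => -x) (Set.Ioi 0) Γ (partialSum p.1 n) /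
        reachProb (μ.map fun x => -x) (Set.Ioi 0) Γ 0) *
      (reachProb μ (Set.Ici 0) Γ (partialSum p.2 n) / reachProb μ (Set.Ici 0) Γ 0)))
        ∂(twoSided μ n)) ?_ ?_
  · filter_upwards [eventually_gt_atTop 0] with Γ hΓ
    exact (belowMean_eq hΓ hf hl hr).symm
  · have hc := lintegral_cond_eq ho (n := n) (f := fun _ _ => 1) measurable_const
      (fun _ _ _ _ => rfl) (fun _ _ _ _ => rfl)
    refine tendsto_lintegral_mul_of_density hB ?_ (fun Γ => ?_) ?_ ?_ ?_ ?_
    · exact (hf.comp ((hS.comp measurable_fst).prodMk (hS.comp measurable_snd))).aemeasurable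
    · have hq1 := measurable_reachProb (μ.map fun x => -x) (K := Set.Ioi 0) measurableSet_Ioi Γ
      have hq2 := measurable_reachProb μ (K := Set.Ici 0) measurableSet_Ici Γ
      have hb := (measurable_one (α := ℝ≥0∞)).indicator (measurableSet_below (Γ / 2) (n + 1))
      exact (((hb.comp measurable_fst).mul (hb.comp measurable_snd)).mul
        (((hq1.comp ((hps n).comp measurable_fst)).div_const _).mul
          ((hq2.comp ((hps n).comp measurable_snd)).div_const _))).aemeasurable
    · filter_upwards [ae_twoSided n] with p hp using hle p.1 hp.1 p.2 hp.2
    · filter_upwards [ae_twoSided n] with p hp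
      have h1 := tendsto_reachProb_div ho.neg isHalfLine_Ioi (mem_or_eq_zero_of_staysIn hp.1)
      have h2 := tendsto_reachProb_div ho isHalfLine_Ici (mem_or_eq_zero_of_staysIn hp.2)
      have h3 := ENNReal.Tendsto.mul (tendsto_indicator_below n p.1) (Or.inl one_ne_zero)
        (tendsto_indicator_below n p.2) (Or.inl one_ne_zero)
      have h4 := ENNReal.Tendsto.mul h1 (Or.inr (potential_ne_top ho isHalfLine_Ici _)) h2
        (Or.inr (potential_ne_top ho.neg isHalfLine_Ioi _))
      have h5 := ENNReal.Tendsto.mul h3 (Or.inl (by simp)) h4 (Or.inr (by simp))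
      simpa using h5
    · filter_upwards [eventually_gt_atTop 0] with Γ hΓ
      have h := belowMean_eq (μ := μ) hΓ (n := n) (f := fun _ _ => 1) measurable_const
        (fun _ _ _ _ => rfl) (fun _ _ _ _ => rfl)
      simp only [one_mul] at h
      rw [← h]
      exact belowMean_one_le μ Γ n
    -- The limiting density has mass 1 because the two Doob chains are probability laws; harmonicity
    -- of the potential is what enters here.
    · simp only [one_mul] at hc
      rw [← hc]
      have : IsProbabilityMeasure (condNonnegLaw μ) := by unfold condNonnegLaw; infer_instance
      have : IsProbabilityMeasure (condPosLaw (μ.map fun x => -x)) := by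
        unfold condPosLaw; infer_instance
      simp

end Limit

/-! ### Bounds for the expectations of the two sums -/

section MidTerm

variable (ν : Measure ℝ) [IsProbabilityMeasure ν]

/-- The mean of the exponential sum over the times greater than `n`, for the conditioned walk. -/
noncomputable def tailMean (K : Set ℝ) (n : ℕ) : ℝ≥0∞ :=
  ∑' k, ∫⁻ w in staysIn K 0 (k + (n + 1)), expE (-1 * partialSum w (k + (n + 1))) *
    potential ν K (partialSum w (k + (n + 1))) ∂(iid ν)

variable {ν}

lemma tendsto_tailMean (ho : Oscillates ν) {K : Set ℝ} (hK : IsHalfLine K) :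
    Tendsto (tailMean ν K) atTop (𝓝 0) := by
  have h := ENNReal.tendsto_sum_nat_add _
    (tsum_lintegral_staysIn_lt_top ho hK (c := 1) one_pos).ne
  exact h.comp (tendsto_add_atTop_nat 1)

lemma tailMean_ne_top (ho : Oscillates ν) {K : Set ℝ} (hK : IsHalfLine K) (n : ℕ) :
    tailMean ν K n ≠ ∞ :=
  ne_top_of_le_ne_top (tsum_lintegral_staysIn_lt_top ho hK (c := 1) one_pos).ne
    (ENNReal.tsum_comp_le_tsum_of_injective (add_left_injective (n + 1))
      (fun k => ∫⁻ w in staysIn K 0 k, expE (-1 * partialSum w k) *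
        potential ν K (partialSum w k) ∂(iid ν)))

/-- Exchanging the conditioning for the potential costs e^x. Together with the weight e^{-2x} this
leaves e^{-x} times the potential, with a constant that does not depend on Γ. -/
lemma exists_midTerm_le (ho : Oscillates ν) {K : Set ℝ} (hK : IsHalfLine K) :
    ∃ C : ℝ≥0∞, C ≠ ∞ ∧ ∀ (Γ : ℝ) (n : ℕ), (reachProb ν K Γ 0)⁻¹ *
      ∑' k, ∫⁻ w in reach K Γ 0, midTerm Γ n k w ∂(iid ν) ≤ C * tailMean ν K n := by
  have hps := measurable_partialSum
  have hexp := measurable_expE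
  have hpot := (potential_mono ν hK).measurable
  obtain ⟨C, hC, h⟩ := exists_reachProb_le ho hK
  refine ⟨C, hC, fun Γ n => ?_⟩
  have hterm : ∀ k, ∫⁻ w in reach K Γ 0, midTerm Γ n k w ∂(iid ν) ≤ reachProb ν K Γ 0 *
      (C * if n + 1 ≤ k then ∫⁻ w in staysIn K 0 k, expE (-1 * partialSum w k) *
        potential ν K (partialSum w k) ∂(iid ν) else 0) := by
    intro k
    by_cases hk : n + 1 ≤ k
    · rw [if_pos hk, lintegral_reach hK Γ 0 k (measurable_midTerm Γ n k) (dependsOn_midTerm Γ n k),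
        ← lintegral_const_mul _ (by fun_prop), ← lintegral_const_mul _ (by fun_prop)]
      · refine setLIntegral_mono' (measurableSet_staysIn hK.measurableSet 0 k) fun w hw => ?_
        have hmem := mem_or_eq_zero_of_staysIn hw
        have h0 : 0 ≤ partialSum w k := by
          rcases hmem with h' | h'
          · exact hK.nonneg h'
          · exact h'.ge
        have hmid : midTerm Γ n k w ≤ expE (-2 * partialSum w k) := by
          rw [midTerm, if_pos hk]
          exact Set.indicator_le_self' (fun _ _ => zero_le) w
        rw [zero_add]
        calc midTerm Γ n k w * reachProb ν K Γ (partialSum w k)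
            ≤ expE (-2 * partialSum w k) * (C * expE (partialSum w k) *
              potential ν K (partialSum w k) * reachProb ν K Γ 0) :=
              mul_le_mul' hmid (h Γ _ h0 hmem)
          _ = reachProb ν K Γ 0 * (C * (expE (-2 * partialSum w k) * expE (partialSum w k) *
              potential ν K (partialSum w k))) := by ring
          _ = _ := by
              rw [← expE_add, show -2 * partialSum w k + partialSum w k = -1 * partialSum w k by ring]
      · intro w hw j hj
        rw [midTerm, if_pos hk] at hw
        have := Set.mem_of_indicator_ne_zero hw j (by omega)
        linarith
    · simp [midTerm, hk]
  refine (mul_le_mul_right (ENNReal.tsum_le_tsum hterm) _).trans ?_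
  rw [ENNReal.tsum_mul_left, ← mul_assoc, ENNReal.inv_mul_cancel (reachProb_ne_zero ho hK Γ)
    (reachProb_ne_top _ _ _), one_mul, ENNReal.tsum_mul_left, tailMean]
  refine mul_le_mul_right (le_of_eq ?_) _
  refine Eq.trans (tsum_congr fun k => ?_) (tsum_shift (n + 1) fun k =>
    ∫⁻ w in staysIn K 0 (k + (n + 1)), expE (-1 * partialSum w (k + (n + 1))) *
      potential ν K (partialSum w (k + (n + 1))) ∂(iid ν))
  split_ifs with hk
  · rw [Nat.sub_add_cancel hk]
  · rfl

end MidTerm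

lemma measurable_slopeSum (Γ : ℝ) {G : ℕ → (ℕ → ℝ) → (ℕ → ℝ) → ℝ≥0∞}
    (hG : ∀ d, Measurable (Function.uncurry (G d))) : Measurable (slopeSum Γ G) := by
  refine Measurable.tsum fun M => Measurable.tsum fun d => ?_
  refine (measurable_one.indicator (measurableSet_beforeSlope Γ M)).mul ?_
  have hr := measurableSet_reach (K := Set.Ici 0) measurableSet_Ici Γ 0
  have h1 : Measurable ((insideSlope Γ d ×ˢ reach (Set.Ici 0) Γ 0).indicator
      (Function.uncurry (G d))) := (hG d).indicator ((measurableSet_insideSlope Γ d).prod hr)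
  have h2 : Measurable fun w => (backSeq d (shiftSeq M w), shiftSeq d (shiftSeq M w)) :=
    ((measurable_backSeq d).comp (measurable_shiftSeq M)).prodMk
      ((measurable_shiftSeq d).comp (measurable_shiftSeq M))
  convert h1.comp h2 using 1
  ext w
  by_cases g1 : backSeq d (shiftSeq M w) ∈ insideSlope Γ d <;>
    by_cases g2 : shiftSeq d (shiftSeq M w) ∈ reach (Set.Ici 0) Γ 0 <;>
    simp [Function.uncurry, g1, g2]

/-- The logarithm of the exponential sum over a finite window. -/
noncomputable def logWindow (n : ℕ) (s s' : ℕ → ℝ) : ℝ≥0∞ :=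
  ENNReal.ofReal (Real.log (windowSum n s s'))

lemma measurable_logWindow (n : ℕ) : Measurable (Function.uncurry (logWindow n)) := by
  unfold logWindow windowSum Function.uncurry
  fun_prop

lemma dependsOn_logWindow_left (n : ℕ) (s' : ℕ → ℝ) :
    DependsOn (fun s => logWindow n s s') (Set.Iic n) := by
  intro s t h
  simp only [logWindow, windowSum]
  congr 3
  refine Finset.sum_congr rfl fun k hk => ?_
  rw [h (k + 1) (Finset.mem_range.1 hk)]

lemma dependsOn_logWindow_right (n : ℕ) (s : ℕ → ℝ) :
    DependsOn (fun s' => logWindow n s s') (Set.Iic n) := by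
  intro s t h
  simp only [logWindow, windowSum]
  congr 3
  refine Finset.sum_congr rfl fun k hk => ?_
  rw [h k (Nat.lt_succ_iff.1 (Finset.mem_range.1 hk))]

lemma logWindow_le {n : ℕ} {v w' : ℕ → ℝ} (hv : v ∈ staysIn (Set.Ioi 0) 0 n)
    (hw : w' ∈ staysIn (Set.Ici 0) 0 n) :
    logWindow n (partialSum v) (partialSum w') ≤ ENNReal.ofReal (Real.log (2 * n + 1)) := by
  refine ENNReal.ofReal_le_ofReal (Real.log_le_log
    (one_pos.trans_le (one_le_windowSum n _ _ (partialSum_zero w'))) ?_)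
  have h1 : ∑ k ∈ Finset.range n, Real.exp (-2 * partialSum v (k + 1)) ≤ n := by
    refine (Finset.sum_le_card_nsmul _ _ 1 fun k hk => ?_).trans (by simp)
    have := hv (k + 1) (by omega) (Finset.mem_range.1 hk)
    simp only [zero_add, Set.mem_Ioi] at this
    exact Real.exp_le_one_iff.2 (by linarith)
  have h2 : ∑ k ∈ Finset.range (n + 1), Real.exp (-2 * partialSum w' k) ≤ (n + 1 : ℕ) := by
    refine (Finset.sum_le_card_nsmul _ _ 1 fun k hk => ?_).trans (by simp)
    have h0 : 0 ≤ partialSum w' k := by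
      rcases Nat.eq_zero_or_pos k with rfl | hk0
      · simp
      · simpa using hw k hk0 (Nat.lt_succ_iff.1 (Finset.mem_range.1 hk))
    exact Real.exp_le_one_iff.2 (by linarith)
  push_cast at h2
  unfold windowSum
  linarith

section Bounds

variable {μ : Measure ℝ} [IsProbabilityMeasure μ]

/-- The functional of slopes given by a function of the first steps on both sides. -/
noncomputable def belowSlope (Γ : ℝ) (n : ℕ) (f : (ℕ → ℝ) → (ℕ → ℝ) → ℝ≥0∞) :
    ℕ → (ℕ → ℝ) → (ℕ → ℝ) → ℝ≥0∞ :=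
  fun d v w' => if n < d then belowTerm Γ n f v w' else 0

section

variable {Γ : ℝ} {n : ℕ} {f : (ℕ → ℝ) → (ℕ → ℝ) → ℝ≥0∞}

lemma measurable_belowSlope (hf : Measurable (Function.uncurry f)) (d : ℕ) :
    Measurable (Function.uncurry (belowSlope Γ n f d)) := by
  by_cases h : n < d
  · rw [show belowSlope Γ n f d = belowTerm Γ n f by ext v w'; simp [belowSlope, h]]
    exact measurable_belowTerm Γ n hf
  · rw [show belowSlope Γ n f d = fun _ _ => 0 by ext v w'; simp [belowSlope, h]]
    exact measurable_const

lemma dependsOn_belowSlope (hl : ∀ z, DependsOn (fun z' => f z' z) (Set.Iic n)) (d : ℕ)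
    (w' : ℕ → ℝ) : DependsOn (fun v => belowSlope Γ n f d v w') (Set.Iio d) := by
  by_cases h : n < d
  · simp only [belowSlope, if_pos h]
    exact fun v v' hv => dependsOn_belowTerm_left Γ n hl w' fun i hi => hv i (lt_trans hi h)
  · simp only [belowSlope, if_neg h]; exact fun _ _ _ => rfl

lemma lintegral_belowSlope (ho : Oscillates μ) (hΓ : 0 < Γ) (hf : Measurable (Function.uncurry f))
    (hl : ∀ z, DependsOn (fun z' => f z' z) (Set.Iic n)) :
    ∫⁻ w, slopeSum Γ (belowSlope Γ n f) w ∂(iid μ) = belowMean μ Γ n f := by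
  refine lintegral_slopeSum_below μ ho hΓ n (measurable_belowTerm Γ n hf)
    (dependsOn_belowTerm_left Γ n hl) fun v w' hv => ?_
  rw [belowTerm, Set.indicator_of_notMem, zero_mul]
  exact fun h => hv fun j hj => (h j hj).trans (by linarith)

/-- The restriction n < d loses nothing: for d ≤ n the window contains the maximum, at height at
least Γ, and `belowTerm` vanishes. -/
lemma slopeSum_belowSlope (hΓ : 0 < Γ) (hl : ∀ z, DependsOn (fun z' => f z' z) (Set.Iic n))
    {w : ℕ → ℝ} {M d : ℕ} (h : IsSlope (partialSum w) Γ M (M + d)) :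
    slopeSum Γ (belowSlope Γ n f) w =
      belowTerm Γ n f (backSeq (M + d) w) (shiftSeq (M + d) w) := by
  rw [slopeSum_eq (dependsOn_belowSlope hl) h, belowSlope]
  split_ifs with hn
  · rfl
  · rw [belowTerm, Set.indicator_of_notMem, zero_mul]
    intro hb
    have h1 : Γ ≤ partialSum (backSeq (M + d) w) d := (isSlope_iff.1 h).2.1.2
    have h2 := hb d (by omega)
    linarith

end

/-- The lower bound for the smaller expectation. -/
lemma belowMean_le_lintegral_logSumBelow (ho : Oscillates μ) {Γ : ℝ} (hΓ : 0 < Γ) (n : ℕ) :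
    belowMean μ Γ n (logWindow n) ≤
      ∫⁻ w, ENNReal.ofReal (logSumBelow (partialSum w) Γ) ∂(iid μ) := by
  rw [← lintegral_belowSlope ho hΓ (measurable_logWindow n) (dependsOn_logWindow_left n)]
  refine lintegral_mono_ae ?_
  filter_upwards [ae_isSlope μ ho hΓ] with w hw
  obtain ⟨hb, ha, M, d, hs⟩ := hw
  rw [slopeSum_belowSlope hΓ (dependsOn_logWindow_left n) hs]
  have hd := slopeData hΓ hb ha
  rw [← (hs.unique (isSlope_uFirst hΓ hb ha)).2] at hd
  by_cases h1 : backSeq (M + d) w ∈ below (Γ / 2) (n + 1)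
  · by_cases h2 : shiftSeq (M + d) w ∈ below (Γ / 2) (n + 1)
    · rw [belowTerm, Set.indicator_of_mem h1, Set.indicator_of_mem h2, Pi.one_apply, Pi.one_apply,
        one_mul, one_mul]
      exact ENNReal.ofReal_le_ofReal (hd.log_windowSum_le hΓ h1 h2)
    · rw [belowTerm, Set.indicator_of_notMem h2, zero_mul, mul_zero]; exact zero_le
  · rw [belowTerm, Set.indicator_of_notMem h1, zero_mul]; exact zero_le

/-- The upper bound for the larger expectation. -/
lemma exists_lintegral_logSumFull_le (ho : Oscillates μ) : ∃ C : ℝ≥0∞, C ≠ ∞ ∧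
    ∀ (Γ : ℝ), 0 < Γ → ∀ n : ℕ,
    ∫⁻ w, ENNReal.ofReal (logSumFull (partialSum w) Γ) ∂(iid μ) ≤
      belowMean μ Γ n (logWindow n) +
      ENNReal.ofReal (Real.log (2 * n + 1)) * (1 - belowMean μ Γ n fun _ _ => 1) +
      C * (tailMean (μ.map fun x => -x) (Set.Ioi 0) n + tailMean μ (Set.Ici 0) n +
        reachProb (μ.map fun x => -x) (Set.Ioi 0) Γ 0 + reachProb μ (Set.Ioi 0) Γ 0) := by
  obtain ⟨C1, hC1, h1⟩ := exists_midTerm_le ho.neg isHalfLine_Ioi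
  obtain ⟨C2, hC2, h2⟩ := exists_midTerm_le ho isHalfLine_Ici
  obtain ⟨C3, hC3, h3⟩ := exists_peakRun_le ho.neg
  obtain ⟨C4, hC4, h4⟩ := exists_peakRun_le ho
  refine ⟨C1 + C2 + C3 + C4, by simp [hC1, hC2, hC3, hC4], fun Γ hΓ n => ?_⟩
  set c := ENNReal.ofReal (Real.log (2 * n + 1))
  set GW := belowSlope Γ n (logWindow n) with hGW
  set GO := belowSlope Γ n (fun _ _ => 1) with hGO
  set ML : ℕ → (ℕ → ℝ) → (ℕ → ℝ) → ℝ≥0∞ :=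
    fun d v _ => (∑ k ∈ Finset.range (d + 1), midTerm Γ n k v) * 1 with hML
  set OL : ℕ → (ℕ → ℝ) → (ℕ → ℝ) → ℝ≥0∞ := fun d v _ => outerLeft Γ d v * 1 with hOL
  set MR : ℕ → (ℕ → ℝ) → (ℕ → ℝ) → ℝ≥0∞ := fun _ _ w' => 1 * ∑' k, midTerm Γ n k w' with hMR
  set OR : ℕ → (ℕ → ℝ) → (ℕ → ℝ) → ℝ≥0∞ := fun _ _ w' => 1 * outerRight Γ w' with hOR
  have hmt : Measurable fun w' => ∑' k, midTerm Γ n k w' :=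
    Measurable.tsum fun k => measurable_midTerm Γ n k
  have mGW := measurable_slopeSum Γ (measurable_belowSlope (Γ := Γ) (n := n)
    (measurable_logWindow n))
  have mGO := measurable_slopeSum Γ (measurable_belowSlope (Γ := Γ) (n := n)
    (f := fun _ _ => 1) measurable_const)
  have mML : Measurable (slopeSum Γ ML) := measurable_slopeSum Γ fun d =>
    ((Finset.measurable_fun_sum _ fun k _ => measurable_midTerm Γ n k).mul
      measurable_const).comp measurable_fst
  have mOL : Measurable (slopeSum Γ OL) := measurable_slopeSum Γ fun d =>
    ((measurable_outerLeft Γ d).mul measurable_const).comp measurable_fst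
  have mMR : Measurable (slopeSum Γ MR) := measurable_slopeSum Γ fun d =>
    (hmt.const_mul 1).comp measurable_snd
  have dML : ∀ d w', DependsOn (fun v => ML d v w') (Set.Iio d) := by
    intro d w' v v' hv
    simp only [hML]
    congr 1
    refine Finset.sum_congr rfl fun k hk => dependsOn_midTerm Γ n k fun i hi => hv i ?_
    exact lt_of_lt_of_le hi (Nat.lt_succ_iff.1 (Finset.mem_range.1 hk))
  have dOL : ∀ d w', DependsOn (fun v => OL d v w') (Set.Iio d) := by
    intro d w' v v' hv
    simp only [hOL, dependsOn_outerLeft Γ d hv]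
  have hone : ∀ᵐ w ∂(iid μ), slopeSum Γ GO w ≤ 1 := by
    filter_upwards [ae_isSlope μ ho hΓ] with w hw
    obtain ⟨-, -, M, d, hs⟩ := hw
    rw [slopeSum_belowSlope hΓ (fun _ _ _ _ => rfl) hs, belowTerm, mul_one]
    exact mul_le_one' (Set.indicator_le_self' (fun _ _ => zero_le) _)
      (Set.indicator_le_self' (fun _ _ => zero_le) _)
  -- The indicator of the bad event is written as 1 minus a slope functional, so that its mean is
  -- expressed through `belowMean`.
  have hpt : ∀ᵐ w ∂(iid μ), ENNReal.ofReal (logSumFull (partialSum w) Γ) ≤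
      slopeSum Γ GW w + c * (1 - slopeSum Γ GO w) + (slopeSum Γ ML w + slopeSum Γ OL w) +
        (slopeSum Γ MR w + slopeSum Γ OR w) := by
    filter_upwards [ae_isSlope μ ho hΓ] with w hw
    obtain ⟨hb, ha, M, d, hs⟩ := hw
    refine (ofReal_logSumFull_le hΓ hb ha n hs).trans ?_
    rw [slopeSum_belowSlope hΓ (dependsOn_logWindow_left n) hs,
      slopeSum_belowSlope hΓ (fun _ _ _ _ => rfl) hs, slopeSum_eq dML hs, slopeSum_eq dOL hs,
      slopeSum_eq (fun _ _ _ _ _ => rfl) hs, slopeSum_eq (fun _ _ _ _ _ => rfl) hs]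
    simp only [hML, hOL, hMR, hOR, mul_one, one_mul]
    gcongr
    split_ifs with hc
    · rw [belowTerm, Set.indicator_of_mem hc.1, Set.indicator_of_mem hc.2, Pi.one_apply,
        Pi.one_apply, one_mul, one_mul]
      exact le_self_add
    · have hz : belowTerm Γ n (fun _ _ => 1) (backSeq (M + d) w) (shiftSeq (M + d) w) = 0 := by
        by_cases g1 : backSeq (M + d) w ∈ below (Γ / 2) (n + 1)
        · rw [belowTerm, Set.indicator_of_notMem fun g2 => hc ⟨g1, g2⟩, zero_mul, mul_zero]
        · rw [belowTerm, Set.indicator_of_notMem g1, zero_mul]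
      rw [hz, tsub_zero, mul_one]
      exact le_add_self
  have hGOint := lintegral_belowSlope (μ := μ) (n := n) (f := fun _ _ => 1) ho hΓ measurable_const
    (fun _ _ _ _ => rfl)
  have mNO : Measurable fun w => 1 - slopeSum Γ GO w := measurable_const.sub mGO
  have m2 : Measurable fun w => slopeSum Γ GW w + c * (1 - slopeSum Γ GO w) :=
    mGW.add (mNO.const_mul c)
  have m1 : Measurable fun w => slopeSum Γ GW w + c * (1 - slopeSum Γ GO w) +
    (slopeSum Γ ML w + slopeSum Γ OL w) := m2.add (mML.add mOL)
  have hsub : ∫⁻ w, c * (1 - slopeSum Γ GO w) ∂(iid μ) = c * (1 - belowMean μ Γ n fun _ _ => 1) := by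
    rw [lintegral_const_mul _ mNO, lintegral_sub mGO _ hone, lintegral_one,
      measure_univ, hGOint]
    rw [hGOint]
    exact ne_top_of_le_ne_top ENNReal.one_ne_top (belowMean_one_le μ Γ n)
  refine (lintegral_mono_ae hpt).trans ?_
  rw [lintegral_add_left m1, lintegral_add_left m2, lintegral_add_left mGW,
    lintegral_add_left mML, lintegral_add_left mMR, hsub,
    lintegral_belowSlope ho hΓ (measurable_logWindow n) (dependsOn_logWindow_left n)]
  have b1 := (lintegral_slopeSum_midLeft μ ho hΓ n).trans (h1 Γ n)
  have b2 := lintegral_slopeSum_outerLeft μ ho hΓ (h3 Γ)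
  have b3 : ∫⁻ w, slopeSum Γ MR w ∂(iid μ) ≤ C2 * tailMean μ (Set.Ici 0) n := by
    rw [lintegral_slopeSum_right μ ho hΓ hmt,
      lintegral_tsum fun k => (measurable_midTerm Γ n k).aemeasurable]
    exact h2 Γ n
  have b4 := lintegral_slopeSum_outerRight μ ho hΓ (h4 Γ)
  rw [add_assoc (_ + _)]
  refine add_le_add le_rfl ((add_le_add (add_le_add b1 b2) (add_le_add b3 b4)).trans ?_)
  have hle : ∀ {i : ℝ≥0∞}, i = C1 ∨ i = C2 ∨ i = C3 ∨ i = C4 → i ≤ C1 + C2 + C3 + C4 := by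
    rintro i (rfl | rfl | rfl | rfl)
    · rw [add_assoc, add_assoc]; exact le_self_add
    · rw [add_comm C1, add_assoc, add_assoc]; exact le_self_add
    · rw [add_comm (C1 + C2), add_assoc]; exact le_self_add
    · exact le_add_self
  rw [mul_add, mul_add, mul_add]
  calc _ ≤ ((C1 + C2 + C3 + C4) * tailMean (μ.map fun x => -x) (Set.Ioi 0) n +
        (C1 + C2 + C3 + C4) * reachProb (μ.map fun x => -x) (Set.Ioi 0) Γ 0) +
        ((C1 + C2 + C3 + C4) * tailMean μ (Set.Ici 0) n +
        (C1 + C2 + C3 + C4) * reachProb μ (Set.Ioi 0) Γ 0) := by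
        gcongr <;> exact hle (by tauto)
    _ = _ := by ring

end Bounds

/-! ### Measurability of the two sums -/

section Countable

variable {Ω α : Type*} [MeasurableSpace Ω] [Countable α]

section

variable [MeasurableSpace α]

/-- Handles infima and suprema with default values: `Q w k` says that k is the genuine extremum, and
c is the value taken when there is none. -/
lemma measurable_of_characterization {Q : Ω → α → Prop} (hQ : ∀ k, MeasurableSet {w | Q w k})
    {T : Ω → α} {c : α} (h1 : ∀ w k, Q w k → T w = k) (h2 : ∀ w, (∀ k, ¬ Q w k) → T w = c) :
    Measurable T := by
  refine measurable_to_countable' fun k => ?_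
  have e : T ⁻¹' {k} = {w | Q w k} ∪ ((⋂ l, {w | Q w l}ᶜ) ∩ {_w | c = k}) := by
    ext w
    simp only [Set.mem_preimage, Set.mem_singleton_iff, Set.mem_union, Set.mem_inter_iff,
      Set.mem_iInter, Set.mem_compl_iff, Set.mem_ofPred_eq]
    constructor
    · intro h
      by_cases hw : ∃ l, Q w l
      · obtain ⟨l, hl⟩ := hw
        rw [h1 w l hl] at h
        exact Or.inl (h ▸ hl)
      · push Not at hw
        exact Or.inr ⟨hw, (h2 w hw).symm.trans h⟩
    · rintro (h | ⟨h, rfl⟩)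
      · exact h1 w k h
      · exact h2 w h
  rw [e]
  exact (hQ k).union ((MeasurableSet.iInter fun l => (hQ l).compl).inter (MeasurableSet.const _))

variable [MeasurableSingletonClass α]

lemma measurableSet_of_countable_param {T : Ω → α} (hT : Measurable T) {P : α → Ω → Prop}
    (hP : ∀ t, MeasurableSet {w | P t w}) : MeasurableSet {w | P (T w) w} := by
  have e : {w | P (T w) w} = ⋃ t, T ⁻¹' {t} ∩ {w | P t w} := by
    ext w; simp
  rw [e]
  exact MeasurableSet.iUnion fun t => (hT (measurableSet_singleton t)).inter (hP t)

lemma measurable_of_countable_param {T : Ω → α} (hT : Measurable T) {f : α → Ω → ℝ}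
    (hf : ∀ t, Measurable (f t)) : Measurable fun w => f (T w) w := fun s hs =>
  measurableSet_of_countable_param hT (P := fun t w => f t w ∈ s) fun t => hf t hs

end

variable [LinearOrder α] {A : Ω → Set α}

lemma measurableSet_isLeast (hA : ∀ n, MeasurableSet {w | n ∈ A w}) (k : α) :
    MeasurableSet {w | IsLeast (A w) k} := by
  have e : {w | IsLeast (A w) k} = {w | k ∈ A w} ∩ ⋂ m, ({w | m ∈ A w}ᶜ ∪ {_w | k ≤ m}) := by
    ext w
    simp [IsLeast, lowerBounds, imp_iff_not_or]
  rw [e]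
  exact (hA k).inter (MeasurableSet.iInter fun m => (hA m).compl.union (MeasurableSet.const _))

lemma measurableSet_isGreatest (hA : ∀ n, MeasurableSet {w | n ∈ A w}) (k : α) :
    MeasurableSet {w | IsGreatest (A w) k} := by
  have e : {w | IsGreatest (A w) k} = {w | k ∈ A w} ∩ ⋂ m, ({w | m ∈ A w}ᶜ ∪ {_w | m ≤ k}) := by
    ext w
    simp [IsGreatest, upperBounds, imp_iff_not_or]
  rw [e]
  exact (hA k).inter (MeasurableSet.iInter fun m => (hA m).compl.union (MeasurableSet.const _))

end Countable

section Extrema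

variable {Ω : Type*} [MeasurableSpace Ω]

lemma measurable_sInf_nat {A : Ω → Set ℕ} (hA : ∀ n, MeasurableSet {w | n ∈ A w}) :
    Measurable fun w => sInf (A w) := by
  refine measurable_of_characterization (measurableSet_isLeast hA) (c := 0)
    (fun w k h => h.csInf_eq) fun w h => ?_
  rcases Set.eq_empty_or_nonempty (A w) with he | hne
  · rw [he, Nat.sInf_empty]
  · exact absurd ⟨Nat.sInf_mem hne, fun m hm => Nat.sInf_le hm⟩ (h _)

lemma measurable_sSup_nat {A : Ω → Set ℕ} (hA : ∀ n, MeasurableSet {w | n ∈ A w}) :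
    Measurable fun w => sSup (A w) := by
  refine measurable_of_characterization (measurableSet_isGreatest hA) (c := 0)
    (fun w k h => h.csSup_eq) fun w h => ?_
  rcases Set.eq_empty_or_nonempty (A w) with he | hne
  · rw [he]; simp
  · by_cases hb : BddAbove (A w)
    · exact absurd ⟨Nat.sSup_mem hne hb, fun m hm => le_csSup hb hm⟩ (h _)
    · exact Nat.sSup_of_not_bddAbove hb

lemma measurable_sInf_int {A : Ω → Set ℤ} (hA : ∀ n, MeasurableSet {w | n ∈ A w}) :
    Measurable fun w => sInf (A w) := by
  refine measurable_of_characterization (measurableSet_isLeast hA) (c := 0)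
    (fun w k h => h.csInf_eq) fun w h => ?_
  rcases Set.eq_empty_or_nonempty (A w) with he | hne
  · rw [he, Int.csInf_empty]
  · by_cases hb : BddBelow (A w)
    · exact absurd ⟨Int.csInf_mem hne hb, fun m hm => csInf_le hb hm⟩ (h _)
    · exact Int.csInf_of_not_bddBelow hb

lemma measurable_sSup_int {A : Ω → Set ℤ} (hA : ∀ n, MeasurableSet {w | n ∈ A w}) :
    Measurable fun w => sSup (A w) := by
  refine measurable_of_characterization (measurableSet_isGreatest hA) (c := 0)
    (fun w k h => h.csSup_eq) fun w h => ?_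
  rcases Set.eq_empty_or_nonempty (A w) with he | hne
  · rw [he, Int.csSup_empty]
  · by_cases hb : BddAbove (A w)
    · exact absurd ⟨Int.csSup_mem hne hb, fun m hm => le_csSup hb hm⟩ (h _)
    · exact Int.csSup_of_not_bddAbove hb

end Extrema

section Environment

variable (Γ : ℝ)

lemma measurableSet_hasRise (m n : ℕ) :
    MeasurableSet {w : ℕ → ℝ | HasRise (partialSum w) Γ m n} := by
  have e : {w : ℕ → ℝ | HasRise (partialSum w) Γ m n} =
      (fun w i => - w i) ⁻¹' {w | HasDrop (partialSum w) Γ m n} := by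
    ext w
    simp only [Set.mem_ofPred_eq, Set.mem_preimage, hasRise_iff_neg, ← partialSum_neg]
  rw [e]
  exact (measurable_pi_iff.2 fun i => (measurable_pi_apply i).neg) (measurableSet_hasDrop Γ m n)

lemma measurable_tTime (j : ℕ) : Measurable fun w : ℕ → ℝ => tTime (partialSum w) Γ j := by
  induction j with
  | zero => simp only [tTime]; exact measurable_const
  | succ j ih =>
    simp only [tTime]
    refine measurable_sInf_nat fun n => ?_
    refine measurableSet_of_countable_param ih (P := fun t w => t < n ∧
      if Even j then HasDrop (partialSum w) Γ t n else HasRise (partialSum w) Γ t n) fun t => ?_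
    by_cases hj : Even j
    · simp only [if_pos hj]
      exact (MeasurableSet.const (t < n)).inter (measurableSet_hasDrop Γ t n)
    · simp only [if_neg hj]
      exact (MeasurableSet.const (t < n)).inter (measurableSet_hasRise Γ t n)

lemma measurableSet_extremalTimes (j n : ℕ) :
    MeasurableSet {w : ℕ → ℝ | n ∈ extremalTimes (partialSum w) Γ j} := by
  have hps := measurable_partialSum
  refine measurableSet_of_countable_param
    ((measurable_tTime Γ j).prodMk (measurable_tTime Γ (j + 1)))
    (P := fun t w => n ∈ Set.Icc t.1 t.2 ∧ ∀ i ∈ Set.Icc t.1 t.2,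
      if Even j then partialSum w i ≤ partialSum w n else partialSum w n ≤ partialSum w i)
    fun t => ?_
  have key : ∀ R : ℕ → (ℕ → ℝ) → Prop, (∀ i, MeasurableSet {w | R i w}) →
      MeasurableSet {w | n ∈ Set.Icc t.1 t.2 ∧ ∀ i ∈ Set.Icc t.1 t.2, R i w} := by
    intro R hR
    have e : {w | n ∈ Set.Icc t.1 t.2 ∧ ∀ i ∈ Set.Icc t.1 t.2, R i w} =
        {_w | n ∈ Set.Icc t.1 t.2} ∩ ⋂ i, ⋂ (_ : i ∈ Set.Icc t.1 t.2), {w | R i w} := by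
      ext w; simp
    rw [e]
    exact (MeasurableSet.const _).inter
      (MeasurableSet.iInter fun i => MeasurableSet.iInter fun _ => hR i)
  by_cases hj : Even j
  · simp only [if_pos hj]
    exact key _ fun i => measurableSet_le (hps i) (hps n)
  · simp only [if_neg hj]
    exact key _ fun i => measurableSet_le (hps n) (hps i)

lemma measurable_uFirst (k : ℕ) : Measurable fun w : ℕ → ℝ => uFirst (partialSum w) Γ k :=
  measurable_sInf_nat fun n => measurableSet_extremalTimes Γ (k - 1) n

lemma measurable_uLast (k : ℕ) : Measurable fun w : ℕ → ℝ => uLast (partialSum w) Γ k :=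
  measurable_sSup_nat fun n => measurableSet_extremalTimes Γ (k - 1) n

lemma measurable_leftEnd : Measurable fun w : ℕ → ℝ => leftEnd (partialSum w) Γ :=
  (measurable_of_countable (fun p : ℕ × ℕ => (p.1 : ℤ) - p.2)).comp
    ((measurable_uFirst Γ 1).prodMk (measurable_uFirst Γ 2))

lemma measurable_rightEnd : Measurable fun w : ℕ → ℝ => rightEnd (partialSum w) Γ :=
  (measurable_of_countable (fun p : ℕ × ℕ => (p.1 : ℤ) - p.2)).comp
    ((measurable_uLast Γ 3).prodMk (measurable_uFirst Γ 2))

lemma measurable_envWalk (n : ℤ) : Measurable fun w : ℕ → ℝ => envWalk (partialSum w) Γ n :=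
  measurable_of_countable_param (measurable_uFirst Γ 2)
    (f := fun t w => partialSum w ((t : ℤ) + n).toNat - partialSum w t) fun _ =>
    (measurable_partialSum _).sub (measurable_partialSum _)

lemma measurable_tauMinus : Measurable fun w : ℕ → ℝ => tauMinus (partialSum w) Γ :=
  measurable_sSup_int fun n =>
    (measurableSet_le (measurable_leftEnd Γ) measurable_const).inter
      ((MeasurableSet.const (n ≤ 0)).inter
        (measurableSet_le measurable_const (measurable_envWalk Γ n)))

lemma measurable_tauPlus : Measurable fun w : ℕ → ℝ => tauPlus (partialSum w) Γ :=
  measurable_sInf_int fun n =>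
    (MeasurableSet.const (0 ≤ n)).inter
      ((measurableSet_le measurable_const (measurable_rightEnd Γ)).inter
        (measurableSet_le measurable_const (measurable_envWalk Γ n)))

lemma measurable_logSumBelow : Measurable fun w : ℕ → ℝ => logSumBelow (partialSum w) Γ :=
  Real.measurable_log.comp (measurable_of_countable_param
    ((measurable_tauMinus Γ).prodMk (measurable_tauPlus Γ))
    (f := fun t w => ∑ n ∈ Finset.Ioo t.1 t.2, Real.exp (-2 * envWalk (partialSum w) Γ n))
    fun _ => Finset.measurable_fun_sum _ fun n _ =>
      Real.measurable_exp.comp ((measurable_envWalk Γ n).const_mul _))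

lemma measurable_logSumFull : Measurable fun w : ℕ → ℝ => logSumFull (partialSum w) Γ :=
  Real.measurable_log.comp (measurable_of_countable_param
    ((measurable_leftEnd Γ).prodMk (measurable_rightEnd Γ))
    (f := fun t w => ∑ n ∈ Finset.Icc t.1 t.2, Real.exp (-2 * envWalk (partialSum w) Γ n))
    fun _ => Finset.measurable_fun_sum _ fun n _ =>
      Real.measurable_exp.comp ((measurable_envWalk Γ n).const_mul _))

end Environment

/-! ### The limit process, and the conclusion -/

/-- The sum of `exp (-2 z n)` over all `n`, in terms of the two halves of the process. -/
noncomputable def totalSum (p : (ℕ → ℝ) × (ℕ → ℝ)) : ℝ≥0∞ :=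
  ∑' k, expE (-2 * p.1 k) + ∑' k, expE (-2 * p.2 (k + 1))

lemma measurable_totalSum : Measurable totalSum := by
  have := measurable_expE
  exact (Measurable.tsum fun k => by fun_prop).add (Measurable.tsum fun k => by fun_prop)

lemma hasSum_glue (p : (ℕ → ℝ) × (ℕ → ℝ)) :
    HasSum (fun n : ℤ => expE (-2 * glue p n)) (totalSum p) := by
  refine HasSum.of_nat_of_neg_add_one ?_ ?_
  · have e : ∀ n : ℕ, glue p n = p.1 n := fun n => by simp [glue]
    simp only [e]
    exact ENNReal.summable.hasSum
  · have e : ∀ n : ℕ, glue p (-((n : ℤ) + 1)) = p.2 (n + 1) := fun n => by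
      rw [glue, if_neg (by omega)]
      congr 1
    simp only [e]
    exact ENNReal.summable.hasSum

lemma toReal_expE (x : ℝ) : (expE x).toReal = Real.exp x :=
  ENNReal.toReal_ofReal (Real.exp_pos x).le

lemma tsum_exp_glue (p : (ℕ → ℝ) × (ℕ → ℝ)) :
    ∑' n : ℤ, Real.exp (-2 * glue p n) = (totalSum p).toReal := by
  rw [← (hasSum_glue p).tsum_eq, ENNReal.tsum_toReal_eq fun n => expE_ne_top _]
  simp only [toReal_expE]

lemma measurable_log_tsum_exp :
    Measurable fun z : ℤ → ℝ => Real.log (∑' n : ℤ, Real.exp (-2 * z n)) := by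
  have hexp := measurable_expE
  have e : ∀ z : ℤ → ℝ, ∑' n : ℤ, Real.exp (-2 * z n) = (∑' n : ℤ, expE (-2 * z n)).toReal := by
    intro z
    rw [ENNReal.tsum_toReal_eq fun n => expE_ne_top _]
    simp only [toReal_expE]
  simp only [e]
  exact Real.measurable_log.comp (Measurable.tsum fun n => by fun_prop).ennreal_toReal

lemma ofReal_windowSum (n : ℕ) (p : (ℕ → ℝ) × (ℕ → ℝ)) :
    windowSum n p.2 p.1 = (∑ k ∈ Finset.range (n + 1), expE (-2 * p.1 k) +
      ∑ k ∈ Finset.range n, expE (-2 * p.2 (k + 1))).toReal := by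
  rw [ENNReal.toReal_add, ENNReal.toReal_sum, ENNReal.toReal_sum]
  · simp only [toReal_expE]
    exact add_comm _ _
  · exact fun _ _ => expE_ne_top _
  · exact fun _ _ => expE_ne_top _
  · exact ENNReal.sum_ne_top.2 fun _ _ => expE_ne_top _
  · exact ENNReal.sum_ne_top.2 fun _ _ => expE_ne_top _

/-- All window sums are at least 1, which keeps the limit away from the singularity of the
logarithm. -/
lemma tendsto_logWindow {p : (ℕ → ℝ) × (ℕ → ℝ)} (h0 : p.1 0 = 0) (hp : totalSum p ≠ ∞) :
    Tendsto (fun n => logWindow n p.2 p.1) atTop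
      (𝓝 (ENNReal.ofReal (Real.log (totalSum p).toReal))) := by
  have h1 : Tendsto (fun n => windowSum n p.2 p.1) atTop (𝓝 (totalSum p).toReal) := by
    simp only [ofReal_windowSum]
    refine (ENNReal.tendsto_toReal hp).comp (Tendsto.add ?_ (ENNReal.tendsto_nat_tsum _))
    exact (ENNReal.tendsto_nat_tsum fun k => expE (-2 * p.1 k)).comp (tendsto_add_atTop_nat 1)
  have h2 : 1 ≤ (totalSum p).toReal :=
    ge_of_tendsto' h1 fun n => one_le_windowSum n p.2 p.1 h0
  exact (ENNReal.continuous_ofReal.tendsto _).comp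
    ((Real.continuousAt_log (by linarith)).tendsto.comp h1)

lemma one_le_totalSum {p : (ℕ → ℝ) × (ℕ → ℝ)} (h0 : p.1 0 = 0) : 1 ≤ totalSum p := by
  refine le_trans ?_ le_self_add
  refine le_trans ?_ (ENNReal.le_tsum 0)
  simp [h0]

lemma monotone_logWindow {p : (ℕ → ℝ) × (ℕ → ℝ)} (h0 : p.1 0 = 0) :
    Monotone fun n => logWindow n p.2 p.1 := fun m n h =>
  ENNReal.ofReal_le_ofReal (Real.log_le_log (one_pos.trans_le (one_le_windowSum m _ _ h0))
    (windowSum_mono h (by omega) _ _))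

section LimitProcess

variable {μ : Measure ℝ} [IsProbabilityMeasure μ]

instance : IsProbabilityMeasure (condNonnegLaw μ) := by unfold condNonnegLaw; infer_instance

instance : IsProbabilityMeasure (condPosLaw μ) := by unfold condPosLaw; infer_instance

/-- Under each conditioned law the mean of exp(-2 z_k) is an exponential moment of the killed walk
weighted by the potential, and these are summable in k. -/
lemma lintegral_totalSum_ne_top (ho : Oscillates μ) :
    ∫⁻ p, totalSum p ∂((condNonnegLaw μ).prod (condPosLaw (μ.map fun x => -x))) ≠ ∞ := by
  have hexp := measurable_expE
  have hd : ∀ k, DependsOn (fun z : ℕ → ℝ => expE (-2 * z k)) (Set.Iic k) := fun k z z' h => by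
    simp only [h k (Set.mem_Iic.2 le_rfl)]
  have h1 := tsum_lintegral_staysIn_lt_top ho isHalfLine_Ici (c := 2) two_pos
  have h2 := tsum_lintegral_staysIn_lt_top ho.neg isHalfLine_Ioi (c := 2) two_pos
  have e1 : ∀ k, ∫⁻ z, expE (-2 * z k) ∂(condNonnegLaw μ) = _ := fun k =>
    lintegral_condNonnegLaw ho (by fun_prop) (hd k)
  have e2 : ∀ k, ∫⁻ z, expE (-2 * z k) ∂(condPosLaw (μ.map fun x => -x)) = _ := fun k =>
    lintegral_condPosLaw ho.neg (by fun_prop) (hd k)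
  have m1 : Measurable fun z : ℕ → ℝ => ∑' k, expE (-2 * z k) :=
    Measurable.tsum fun k => by fun_prop
  have m2 : Measurable fun z : ℕ → ℝ => ∑' k, expE (-2 * z (k + 1)) :=
    Measurable.tsum fun k => by fun_prop
  have m1' : Measurable fun p : (ℕ → ℝ) × (ℕ → ℝ) => ∑' k, expE (-2 * p.1 k) :=
    m1.comp measurable_fst
  have m2' : Measurable fun p : (ℕ → ℝ) × (ℕ → ℝ) => ∑' k, expE (-2 * p.2 (k + 1)) :=
    m2.comp measurable_snd
  unfold totalSum
  rw [lintegral_add_left m1', lintegral_prod _ m1'.aemeasurable,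
    lintegral_prod _ m2'.aemeasurable]
  simp only [lintegral_const, measure_univ, mul_one]
  refine ENNReal.add_ne_top.2 ⟨?_, ?_⟩
  · rw [lintegral_tsum fun k => (by fun_prop : Measurable _).aemeasurable]
    simp only [e1]
    exact h1.ne
  · refine ne_top_of_le_ne_top h2.ne ?_
    rw [lintegral_tsum fun k => (by fun_prop : Measurable _).aemeasurable]
    simp only [← e2]
    exact ENNReal.tsum_comp_le_tsum_of_injective (add_left_injective 1)
      (fun k => ∫⁻ z, expE (-2 * z k) ∂(condPosLaw (μ.map fun x => -x)))

lemma ae_totalSum (ho : Oscillates μ) :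
    ∀ᵐ p ∂((condNonnegLaw μ).prod (condPosLaw (μ.map fun x => -x))),
      p.1 0 = 0 ∧ totalSum p ≠ ∞ := by
  have h0 : ∀ᵐ z ∂(condNonnegLaw μ), z 0 = 0 := doobChain_map_eval_zero _ _ _
  filter_upwards [Measure.quasiMeasurePreserving_fst.ae h0,
    ae_lt_top measurable_totalSum (lintegral_totalSum_ne_top ho)] with p h1 h2 using ⟨h1, h2.ne⟩

variable (μ) in
/-- The expectation of the logarithm of the sum for the limit process. -/
noncomputable def limitMean : ℝ≥0∞ :=
  ∫⁻ p, ENNReal.ofReal (Real.log (totalSum p).toReal)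
    ∂((condNonnegLaw μ).prod (condPosLaw (μ.map fun x => -x)))

/-- From log t ≤ t - 1 and the finite mean of the sum. -/
lemma limitMean_ne_top (ho : Oscillates μ) : limitMean μ ≠ ∞ := by
  refine ne_top_of_le_ne_top (lintegral_totalSum_ne_top ho) (lintegral_mono_ae ?_)
  filter_upwards [ae_totalSum ho] with p hp
  have h1 : 0 < (totalSum p).toReal :=
    ENNReal.toReal_pos (one_pos.trans_le (one_le_totalSum hp.1)).ne' hp.2
  have h2 := Real.log_le_sub_one_of_pos h1
  exact ENNReal.ofReal_le_of_le_toReal (by linarith)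

/-- Monotone convergence: enlarging the window only adds positive terms. -/
lemma tendsto_lintegral_logWindow (ho : Oscillates μ) :
    Tendsto (fun n => ∫⁻ z', ∫⁻ z, logWindow n z' z ∂(condNonnegLaw μ)
      ∂(condPosLaw (μ.map fun x => -x))) atTop (𝓝 (limitMean μ)) := by
  have hm : ∀ n, Measurable fun p : (ℕ → ℝ) × (ℕ → ℝ) => logWindow n p.2 p.1 := fun n => by
    unfold logWindow windowSum
    fun_prop
  have e : ∀ n, ∫⁻ z', ∫⁻ z, logWindow n z' z ∂(condNonnegLaw μ)
      ∂(condPosLaw (μ.map fun x => -x)) = ∫⁻ p, logWindow n p.2 p.1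
        ∂((condNonnegLaw μ).prod (condPosLaw (μ.map fun x => -x))) := fun n =>
    (lintegral_prod_symm _ (hm n).aemeasurable).symm
  simp only [e]
  refine lintegral_tendsto_of_tendsto_of_monotone (fun n => (hm n).aemeasurable) ?_ ?_
  · filter_upwards [ae_totalSum ho] with p hp using monotone_logWindow hp.1
  · filter_upwards [ae_totalSum ho] with p hp using tendsto_logWindow hp.1 hp.2

/-! ### The two expectations and their common limit -/

variable (μ) in
/-- The expectation of the logarithm of the sum below `Γ / 2`. -/
noncomputable def belowLog (Γ : ℝ) : ℝ≥0∞ :=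
  ∫⁻ w, ENNReal.ofReal (logSumBelow (partialSum w) Γ) ∂(iid μ)

variable (μ) in
/-- The expectation of the logarithm of the full sum. -/
noncomputable def fullLog (Γ : ℝ) : ℝ≥0∞ :=
  ∫⁻ w, ENNReal.ofReal (logSumFull (partialSum w) Γ) ∂(iid μ)

lemma ae_logSum (ho : Oscillates μ) {Γ : ℝ} (hΓ : 0 < Γ) : ∀ᵐ w ∂(iid μ),
    0 ≤ logSumBelow (partialSum w) Γ ∧
      logSumBelow (partialSum w) Γ ≤ logSumFull (partialSum w) Γ := by
  filter_upwards [ho.1, ho.2] with w h1 h2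
  have h := slopeData hΓ h2 h1
  exact ⟨h.logSumBelow_nonneg hΓ, h.logSumBelow_le hΓ⟩

lemma belowLog_le_fullLog (ho : Oscillates μ) {Γ : ℝ} (hΓ : 0 < Γ) :
    belowLog μ Γ ≤ fullLog μ Γ := by
  refine lintegral_mono_ae ?_
  filter_upwards [ae_logSum ho hΓ] with w hw using ENNReal.ofReal_le_ofReal hw.2

/-- The window n = 0 suffices: its sum is the single term 1, with logarithm 0, and the error terms
are finite for each Γ. -/
lemma fullLog_ne_top (ho : Oscillates μ) {Γ : ℝ} (hΓ : 0 < Γ) : fullLog μ Γ ≠ ∞ := by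
  obtain ⟨C, hC, h⟩ := exists_lintegral_logSumFull_le ho
  refine ne_top_of_le_ne_top ?_ (h Γ hΓ 0)
  have hz : belowMean μ Γ 0 (logWindow 0) = 0 := by
    simp [belowMean, belowTerm, logWindow, windowSum]
  rw [hz, zero_add]
  refine ENNReal.add_ne_top.2 ⟨ENNReal.mul_ne_top ENNReal.ofReal_ne_top
    (ne_top_of_le_ne_top ENNReal.one_ne_top tsub_le_self), ENNReal.mul_ne_top hC ?_⟩
  refine ENNReal.add_ne_top.2 ⟨ENNReal.add_ne_top.2 ⟨ENNReal.add_ne_top.2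
    ⟨tailMean_ne_top ho.neg isHalfLine_Ioi 0, tailMean_ne_top ho isHalfLine_Ici 0⟩,
    reachProb_ne_top _ _ _⟩, reachProb_ne_top _ _ _⟩

lemma tendsto_belowMean_logWindow (ho : Oscillates μ) (n : ℕ) :
    Tendsto (fun Γ => belowMean μ Γ n (logWindow n)) atTop
      (𝓝 (∫⁻ z', ∫⁻ z, logWindow n z' z ∂(condNonnegLaw μ) ∂(condPosLaw (μ.map fun x => -x)))) :=
  tendsto_belowMean ho (measurable_logWindow n) (dependsOn_logWindow_left n)
    (dependsOn_logWindow_right n) ENNReal.ofReal_ne_top fun _ hv _ hw => logWindow_le hv hw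

/-- With n fixed, the window bounds the smaller expectation from below for every Γ > 0; Γ → ∞ is
taken first, then n → ∞. -/
lemma limitMean_le_liminf (ho : Oscillates μ) :
    limitMean μ ≤ liminf (belowLog μ) atTop := by
  refine le_of_tendsto' (tendsto_lintegral_logWindow ho) fun n => ?_
  rw [← (tendsto_belowMean_logWindow ho n).liminf_eq]
  refine liminf_le_liminf ?_
  filter_upwards [eventually_gt_atTop 0] with Γ hΓ
  exact belowMean_le_lintegral_logSumBelow ho hΓ n

/-- With n fixed and Γ → ∞, the bad event has vanishing probability, which makes the factor log(2n +
1) harmless, and the outer terms vanish with the reach probabilities. Only the tail sums remain, and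
n → ∞ removes them. -/
lemma limsup_le_limitMean (ho : Oscillates μ) :
    limsup (fullLog μ) atTop ≤ limitMean μ := by
  obtain ⟨C, hC, h⟩ := exists_lintegral_logSumFull_le ho
  have hn : ∀ n : ℕ, limsup (fullLog μ) atTop ≤
      ∫⁻ z', ∫⁻ z, logWindow n z' z ∂(condNonnegLaw μ) ∂(condPosLaw (μ.map fun x => -x)) +
      ENNReal.ofReal (Real.log (2 * n + 1)) * (1 - 1) +
      C * (tailMean (μ.map fun x => -x) (Set.Ioi 0) n + tailMean μ (Set.Ici 0) n + 0 + 0) := by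
    intro n
    have hone := tendsto_belowMean ho (n := n) (f := fun _ _ => 1) measurable_const
      (fun _ _ _ _ => rfl) (fun _ _ _ _ => rfl) (B := 1) ENNReal.one_ne_top fun _ _ _ _ => le_rfl
    simp only [lintegral_one, measure_univ] at hone
    have hlim := ((tendsto_belowMean_logWindow ho n).add (ENNReal.Tendsto.const_mul
      (ENNReal.Tendsto.sub tendsto_const_nhds hone (Or.inl ENNReal.one_ne_top))
        (Or.inr (ENNReal.ofReal_ne_top (r := Real.log (2 * n + 1)))))).add
      (ENNReal.Tendsto.const_mul (((tendsto_const_nhds (x := tailMean (μ.map fun x => -x)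
        (Set.Ioi 0) n + tailMean μ (Set.Ici 0) n)).add (tendsto_reachProb_zero ho.neg
          isHalfLine_Ioi)).add (tendsto_reachProb_zero ho isHalfLine_Ioi)) (Or.inr hC))
    rw [← hlim.limsup_eq]
    refine limsup_le_limsup ?_
    filter_upwards [eventually_gt_atTop 0] with Γ hΓ
    exact h Γ hΓ n
  have hlim : Tendsto (fun n : ℕ =>
      ∫⁻ z', ∫⁻ z, logWindow n z' z ∂(condNonnegLaw μ) ∂(condPosLaw (μ.map fun x => -x)) +
      ENNReal.ofReal (Real.log (2 * n + 1)) * (1 - 1) +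
      C * (tailMean (μ.map fun x => -x) (Set.Ioi 0) n + tailMean μ (Set.Ici 0) n + 0 + 0)) atTop
      (𝓝 (limitMean μ + C * (0 + 0))) := by
    simp only [tsub_self, mul_zero, add_zero]
    have := (tendsto_lintegral_logWindow ho).add (ENNReal.Tendsto.const_mul
      ((tendsto_tailMean ho.neg isHalfLine_Ioi).add (tendsto_tailMean ho isHalfLine_Ici))
      (Or.inr hC))
    simpa using this
  have := ge_of_tendsto' hlim hn
  simpa using this

lemma tendsto_belowLog_fullLog (ho : Oscillates μ) :
    Tendsto (belowLog μ) atTop (𝓝 (limitMean μ)) ∧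
      Tendsto (fullLog μ) atTop (𝓝 (limitMean μ)) := by
  have hle : ∀ᶠ Γ in atTop, belowLog μ Γ ≤ fullLog μ Γ := by
    filter_upwards [eventually_gt_atTop 0] with Γ hΓ using belowLog_le_fullLog ho hΓ
  exact ⟨tendsto_of_le_liminf_of_limsup_le (limitMean_le_liminf ho)
      ((limsup_le_limsup hle).trans (limsup_le_limitMean ho)),
    tendsto_of_le_liminf_of_limsup_le ((limitMean_le_liminf ho).trans (liminf_le_liminf hle))
      (limsup_le_limitMean ho)⟩

end LimitProcess

lemma integrable_of_lintegral_ofReal_ne_top {α : Type*} [MeasurableSpace α] {ρ : Measure α}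
    {g : α → ℝ} (hg : Measurable g) (h0 : 0 ≤ᵐ[ρ] g)
    (h : ∫⁻ x, ENNReal.ofReal (g x) ∂ρ ≠ ∞) : Integrable g ρ :=
  ⟨hg.aestronglyMeasurable, (hasFiniteIntegral_iff_ofReal h0).2 h.lt_top⟩

theorem lemma2p7 (μ : Measure ℝ) [IsProbabilityMeasure μ]
    (hμ_sq : Integrable (fun x : ℝ => x ^ 2) μ)
    (hμ_pos : 0 < ∫ x, x ^ 2 ∂μ)
    (hμ_mean : ∫ x, x ∂μ = 0)
    {Ω : Type*} [MeasurableSpace Ω] (P : Measure Ω) [IsProbabilityMeasure P]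
    (h : ℕ → Ω → ℝ) (h_law : ∀ n, HasLaw (h n) μ P) (h_indep : iIndepFun h P) :
    (∀ Γ : ℝ, 0 < Γ →
      Integrable (fun ω => logSumBelow (partialSum fun j => h j ω) Γ) P ∧
      Integrable (fun ω => logSumFull (partialSum fun j => h j ω) Γ) P) ∧
    (∀ᵐ z ∂(lawZ μ), Summable fun n : ℤ => Real.exp (-2 * z n)) ∧
    Integrable (fun z : ℤ → ℝ => Real.log (∑' n : ℤ, Real.exp (-2 * z n))) (lawZ μ) ∧
    Tendsto (fun Γ : ℝ => ∫ ω, logSumBelow (partialSum fun j => h j ω) Γ ∂P) atTop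
      (𝓝 (∫ z, Real.log (∑' n : ℤ, Real.exp (-2 * z n)) ∂(lawZ μ))) ∧
    Tendsto (fun Γ : ℝ => ∫ ω, logSumFull (partialSum fun j => h j ω) Γ ∂P) atTop
      (𝓝 (∫ z, Real.log (∑' n : ℤ, Real.exp (-2 * z n)) ∂(lawZ μ))) := by
  have ho := oscillates_of_integral_eq_zero hμ_sq hμ_pos hμ_mean
  have hm : AEMeasurable (fun ω i => h i ω) P :=
    aemeasurable_pi_iff.2 fun i => (h_law i).aemeasurable
  -- All quantities depend only on the joint law of the steps, so the proof moves to the product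
  -- space.
  have hX : P.map (fun ω i => h i ω) = iid μ := (h_indep.hasLaw_infinitePi h_law hm).map_eq
  -- the two sums
  have hB0 : ∀ {Γ : ℝ}, 0 < Γ → 0 ≤ᵐ[iid μ] fun w => logSumBelow (partialSum w) Γ := fun hΓ => by
    filter_upwards [ae_logSum ho hΓ] with w hw using hw.1
  have hF0 : ∀ {Γ : ℝ}, 0 < Γ → 0 ≤ᵐ[iid μ] fun w => logSumFull (partialSum w) Γ := fun hΓ => by
    filter_upwards [ae_logSum ho hΓ] with w hw using hw.1.trans hw.2
  have hBi : ∀ {Γ : ℝ}, 0 < Γ → Integrable (fun w => logSumBelow (partialSum w) Γ) (iid μ) :=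
    fun hΓ => integrable_of_lintegral_ofReal_ne_top (measurable_logSumBelow _) (hB0 hΓ)
      (ne_top_of_le_ne_top (fullLog_ne_top ho hΓ) (belowLog_le_fullLog ho hΓ))
  have hFi : ∀ {Γ : ℝ}, 0 < Γ → Integrable (fun w => logSumFull (partialSum w) Γ) (iid μ) :=
    fun hΓ => integrable_of_lintegral_ofReal_ne_top (measurable_logSumFull _) (hF0 hΓ)
      (fullLog_ne_top ho hΓ)
  have hint : ∀ {g : (ℕ → ℝ) → ℝ}, Measurable g →
      (Integrable g (iid μ) → Integrable (fun ω => g fun j => h j ω) P) ∧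
      ∫ ω, g (fun j => h j ω) ∂P = ∫ w, g w ∂(iid μ) := by
    intro g hg
    rw [← hX]
    exact ⟨fun hi => (integrable_map_measure hg.aestronglyMeasurable hm).1 hi,
      (integral_map hm hg.aestronglyMeasurable).symm⟩
  -- the limit process
  have hg := measurable_glue
  have hZ : lawZ μ = ((condNonnegLaw μ).prod (condPosLaw (μ.map fun x => -x))).map glue := rfl
  have hZm := measurable_log_tsum_exp
  have hp0 : 0 ≤ᵐ[(condNonnegLaw μ).prod (condPosLaw (μ.map fun x => -x))]
      fun p => Real.log (∑' n : ℤ, Real.exp (-2 * glue p n)) := by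
    filter_upwards [ae_totalSum ho] with p hp
    rw [tsum_exp_glue]
    exact Real.log_nonneg (by simpa using ENNReal.toReal_mono hp.2 (one_le_totalSum hp.1))
  have hpl : ∫⁻ p, ENNReal.ofReal (Real.log (∑' n : ℤ, Real.exp (-2 * glue p n)))
      ∂((condNonnegLaw μ).prod (condPosLaw (μ.map fun x => -x))) = limitMean μ := by
    simp only [tsum_exp_glue]
    rfl
  have hZint : ∫ z, Real.log (∑' n : ℤ, Real.exp (-2 * z n)) ∂(lawZ μ) = (limitMean μ).toReal := by
    rw [hZ, integral_map hg.aemeasurable hZm.aestronglyMeasurable,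
      integral_eq_lintegral_of_nonneg_ae hp0 (hZm.comp hg).aestronglyMeasurable, hpl]
  refine ⟨fun Γ hΓ => ⟨(hint (measurable_logSumBelow Γ)).1 (hBi hΓ),
    (hint (measurable_logSumFull Γ)).1 (hFi hΓ)⟩, ?_, ?_, ?_, ?_⟩
  · have hs : ∀ᵐ p ∂((condNonnegLaw μ).prod (condPosLaw (μ.map fun x => -x))),
        ∑' n : ℤ, expE (-2 * glue p n) ≠ ∞ := by
      filter_upwards [ae_totalSum ho] with p hp
      rw [(hasSum_glue p).tsum_eq]
      exact hp.2
    have hexp := measurable_expE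
    have hmeas : MeasurableSet {z : ℤ → ℝ | ∑' n : ℤ, expE (-2 * z n) ≠ ∞} :=
      ((Measurable.tsum fun n => by fun_prop) (measurableSet_singleton ∞)).compl
    have h2 : ∀ᵐ z ∂(lawZ μ), ∑' n : ℤ, expE (-2 * z n) ≠ ∞ := by
      rw [hZ]
      exact (ae_map_iff hg.aemeasurable hmeas).2 hs
    filter_upwards [h2] with z hz
    simpa only [toReal_expE] using ENNReal.summable_toReal hz
  · rw [hZ]
    refine (integrable_map_measure hZm.aestronglyMeasurable hg.aemeasurable).2 ?_
    refine integrable_of_lintegral_ofReal_ne_top (hZm.comp hg) hp0 ?_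
    exact hpl.trans_ne (limitMean_ne_top ho)
  · rw [hZint]
    refine Tendsto.congr' ?_ ((ENNReal.tendsto_toReal (limitMean_ne_top ho)).comp
      (tendsto_belowLog_fullLog ho).1)
    filter_upwards [eventually_gt_atTop 0] with Γ hΓ
    rw [(hint (measurable_logSumBelow Γ)).2, integral_eq_lintegral_of_nonneg_ae (hB0 hΓ)
      (measurable_logSumBelow Γ).aestronglyMeasurable]
    rfl
  · rw [hZint]
    refine Tendsto.congr' ?_ ((ENNReal.tendsto_toReal (limitMean_ne_top ho)).comp
      (tendsto_belowLog_fullLog ho).2)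
    filter_upwards [eventually_gt_atTop 0] with Γ hΓ
    rw [(hint (measurable_logSumFull Γ)).2, integral_eq_lintegral_of_nonneg_ae (hF0 hΓ)
      (measurable_logSumFull Γ).aestronglyMeasurable]
    rfl
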